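/- Let $\mathbb{T}=\mathbb{R}/2\pi\mathbb{Z}$, with $\int_{\mathbb{T}} f\,dx:=\frac1{2\pi}\int_{-\pi}^{\pi}f(x)\,dx$, $\widehat f(k)=\int_{\mathbb{T}} f(x)e^{-ikx}\,dx$ and $\|f\|_{H^s}^2=\sum_{k\in\mathbb{Z}}(1+k^2)^s|\widehat f(k)|^2$. Put $P_+f=\sum_{k>0}\widehat f(k)e^{ikx}$ and $P_-f=\sum_{k<0}\widehat f(k)e^{ikx}$. Let $F(\alpha,\beta,\bar\alpha,\bar\beta)$ be a polynomial with complex coefficients in $\alpha,\beta,\bar\alpha,\bar\beta$, and let $F_\beta=\frac12\big(\frac{\partial F}{\partial \operatorname{Re}\beta}-i\frac{\partial F}{\partial \operatorname{Im}\beta}\big)$. Consider the Cauchy problem $$\partial_t u+i\partial_x^2u=F(u,\partial_xu,\overline{u},\overline{\partial_xu}),\qquad u|_{t=0}=\phi. \tag{NLS}$$ For $s>\frac32$, $T>0$ and $\phi\in H^s(\mathbb{T})$, a solution of (NLS) in $H^s(\mathbb T)$ on $[0,T]$ is a function $u\in L^\infty([0,T];H^s(\mathbb{T}))$ such that for every $\chi\in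 C_c^\infty([0,T)\times\mathbb{T})$ $$-\int_0^T\!\!\int_{\mathbb{T}}u\,\partial_t\chi\,dx\,dt-\int_{\mathbb{T}}\phi\,\chi(0,\cdot)\,dx+i\int_0^T\!\!\int_{\mathbb{T}}u\,\partial_x^2\chi\,dx\,dt=\int_0^T\!\!\int_{\mathbb{T}}F(u,\partial_xu,\overline{u},\overline{\partial_xu})\,\chi\,dx\,dt .$$ A solution on $[-T,0]$ is defined similarly: $u\in L^\infty([-T,0];H^s(\mathbb{T}))$, $\chi\in C_c^\infty((-T,0]\times\mathbb{T})$, time integrals over $[-T,0]$, and $+\int_{\mathbb{T}}\phi\,\chi(0,\cdot)\,dx$ in place of $-\int_{\mathbb{T}}\phi\,\chi(0,\cdot)\,dx$. **Theorem.** Let $s>\frac52$, $T>0$ and $\phi\in H^s(\mathbb{T})$, and let $u\in C([0,T];H^s(\mathbb{T}))$ be a solution of (NLS). 1. If $\int_{\mathbb{T}}\operatorname{Im}F_\beta(\phi,\partial_x\phi,\overline{\phi},\overline{\partial_x\phi})\,dx>0$, then $P_-\phi\in H^{s+\delta}(\mathbb{T})$ for every $\delta\in(0,\frac12)$. 2.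 If $\int_{\mathbb{T}}\operatorname{Im}F_\beta(\phi,\partial_x\phi,\overline{\phi},\overline{\partial_x\phi})\,dx<0$, then $P_+\phi\in H^{s+\delta}(\mathbb{T})$ for every $\delta\in(0,\frac12)$. The same holds, with $P_-\phi$ and $P_+\phi$ interchanged, for a solution $u\in C([-T,0];H^s(\mathbb{T}))$ of (NLS). -/

import Mathlib

namespace TorusNLS

noncomputable section

open MeasureTheory Set Filter
open scoped ComplexConjugate

instance factTwoPiPos : Fact ((0 : ℝ) < 2 * Real.pi) := ⟨Real.two_pi_pos⟩

/-- The torus `ℝ / 2πℤ`. -/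
abbrev Torus : Type := AddCircle (2 * Real.pi)

/-- The normalised Lebesgue measure `dx / 2π` on the torus (total mass `1`). -/
abbrev torusMeasure : Measure Torus := AddCircle.haarAddCircle

/-- `L²` of the torus, with respect to the normalised measure. -/
abbrev L2T : Type := Lp ℂ 2 torusMeasure

/-- The Japanese bracket `⟨k⟩ = (1 + |k|²)^{1/2}`. -/
def bracket (k : ℤ) : ℝ := Real.sqrt (1 + (k : ℝ) ^ 2)

lemma bracket_pos (k : ℤ) : 0 < bracket k := Real.sqrt_pos.mpr (by positivity)

/-- The coefficients `⟨k⟩ˢ f̂(k)` of `⟨∂ₓ⟩ˢ f`, where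
`f̂(k) = (1/2π) ∫_{-π}^{π} f(x) e^{-ikx} dx`. -/
def weightedCoeff (s : ℝ) (f : L2T) (k : ℤ) : ℂ :=
  ((bracket k ^ s : ℝ) : ℂ) * fourierCoeff (f : Torus → ℂ) k

lemma weightedCoeff_eq (s : ℝ) (f : L2T) :
    weightedCoeff s f =
      fun k => ((bracket k ^ s : ℝ) : ℂ) * (fourierBasis (T := 2 * Real.pi)).repr f k := by
  funext k
  rw [weightedCoeff, fourierBasis_repr]

lemma weightedCoeff_zero (s : ℝ) : weightedCoeff s 0 = 0 := by
  rw [weightedCoeff_eq]; funext k; simp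

lemma weightedCoeff_add (s : ℝ) (f g : L2T) :
    weightedCoeff s (f + g) = weightedCoeff s f + weightedCoeff s g := by
  simp only [weightedCoeff_eq]; funext k; simp [mul_add]

lemma weightedCoeff_smul (s : ℝ) (c : ℂ) (f : L2T) :
    weightedCoeff s (c • f) = c • weightedCoeff s f := by
  simp only [weightedCoeff_eq]; funext k; simp [mul_left_comm]

/-- `Hˢ` of the torus as a subspace of `L²`, for `s ≥ 0`:
all `f` with `∑ₖ ⟨k⟩²ˢ |f̂(k)|² < ∞`. -/
def sobolev (s : ℝ) : Submodule ℂ L2T where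
  carrier := {f | Memℓp (weightedCoeff s f) 2}
  zero_mem' := by
    rw [mem_ofPred_eq, weightedCoeff_zero]; exact zero_memℓp
  add_mem' := by
    intro f g hf hg
    rw [mem_ofPred_eq, weightedCoeff_add]; exact Memℓp.add hf hg
  smul_mem' := by
    intro c f hf
    rw [mem_ofPred_eq, weightedCoeff_smul]; exact Memℓp.const_smul hf c

/-- `Hˢ` of the torus as a type of its own, so that it carries the `Hˢ` norm
and not the norm inherited from `L²`. -/
def Sobolev (s : ℝ) : Type := ↥(sobolev s)

instance (s : ℝ) : AddCommGroup (Sobolev s) := inferInstanceAs (AddCommGroup ↥(sobolev s))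

instance (s : ℝ) : Module ℂ (Sobolev s) := inferInstanceAs (Module ℂ ↥(sobolev s))

/-- The inclusion of `Hˢ` into `L²`. -/
def Sobolev.toL2 {s : ℝ} (f : Sobolev s) : L2T := Subtype.val f

/-- The map `f ↦ (⟨k⟩ˢ f̂(k))ₖ` from `Hˢ` to `ℓ²`. -/
def Sobolev.toSeq (s : ℝ) : Sobolev s →ₗ[ℂ] lp (fun _ : ℤ => ℂ) 2 where
  toFun f := ⟨weightedCoeff s f.toL2, f.2⟩
  map_add' f g := Subtype.ext (weightedCoeff_add s f.toL2 g.toL2)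
  map_smul' c f := Subtype.ext (weightedCoeff_smul s c f.toL2)

lemma Sobolev.toSeq_injective (s : ℝ) : Function.Injective (Sobolev.toSeq s) := by
  intro f g h
  have h2 : weightedCoeff s f.toL2 = weightedCoeff s g.toL2 := congrArg Subtype.val h
  refine Subtype.ext ((fourierBasis (T := 2 * Real.pi)).repr.injective (lp.ext ?_))
  funext k
  have h3 := congrFun h2 k
  simp only [weightedCoeff_eq] at h3
  have h4 : ((bracket k ^ s : ℝ) : ℂ) ≠ 0 :=
    Complex.ofReal_ne_zero.mpr (Real.rpow_pos_of_pos (bracket_pos k) s).ne.symm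
  exact mul_left_cancel₀ h4 h3

/-- The `Hˢ` norm `(∑ₖ ⟨k⟩²ˢ |f̂(k)|²)^{1/2}`. -/
instance (s : ℝ) : NormedAddCommGroup (Sobolev s) :=
  NormedAddCommGroup.induced (Sobolev s) (lp (fun _ : ℤ => ℂ) 2) (Sobolev.toSeq s)
    (Sobolev.toSeq_injective s)

instance (s : ℝ) : NormedSpace ℂ (Sobolev s) :=
  NormedSpace.induced ℂ (Sobolev s) (lp (fun _ : ℤ => ℂ) 2) (Sobolev.toSeq s)

open Classical in
/-- The Fourier multiplier operator `f ↦ ∑ₖ m(k) f̂(k) e^{ikx}` on `L²`, with value `0` by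
convention when the coefficients `m(k) f̂(k)` are not square summable. -/
def fourierMultiplier (m : ℤ → ℂ) (f : L2T) : L2T :=
  if h : Memℓp (fun k => m k * fourierCoeff (f : Torus → ℂ) k) 2 then
    (fourierBasis (T := 2 * Real.pi)).repr.symm
      (⟨fun k => m k * fourierCoeff (f : Torus → ℂ) k, h⟩ : lp (fun _ : ℤ => ℂ) 2)
  else 0

/-- The distributional derivative `∂ₓ f = ∑ₖ i k f̂(k) e^{ikx}`, used for `f` in `Hˢ`, `s ≥ 1`. -/
def dx (f : L2T) : L2T := fourierMultiplier (fun k => Complex.I * (k : ℂ)) f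

/-- `P₊ f = ∑_{k > 0} f̂(k) e^{ikx}`. -/
def projPos (f : L2T) : L2T := fourierMultiplier (fun k => if 0 < k then 1 else 0) f

/-- `P₋ f = ∑_{k < 0} f̂(k) e^{ikx}`. -/
def projNeg (f : L2T) : L2T := fourierMultiplier (fun k => if k < 0 then 1 else 0) f

/-- The value `F(α, β, ᾱ, β̄)` of the polynomial nonlinearity. The variables `0, 1, 2, 3` of `F`
stand for `α, β, ᾱ, β̄`. -/
def nonlin (F : MvPolynomial (Fin 4) ℂ) (a b : ℂ) : ℂ :=
  MvPolynomial.eval ![a, b, conj a, conj b] F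

/-- The Wirtinger derivative `F_β = (1/2) (∂F/∂(Re β) - i ∂F/∂(Im β))` at `(α, β, ᾱ, β̄)`. -/
def nonlinBeta (F : MvPolynomial (Fin 4) ℂ) (a b : ℂ) : ℂ :=
  (1 / 2 : ℂ) * (deriv (fun r : ℝ => nonlin F a (b + (r : ℂ))) 0
    - Complex.I * deriv (fun r : ℝ => nonlin F a (b + Complex.I * (r : ℂ))) 0)

/-- `∫ Im F_β(f, ∂ₓf, f̄, ∂ₓf̄) dx` over the torus. -/
def imBetaMean (F : MvPolynomial (Fin 4) ℂ) (f : L2T) : ℝ :=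
  ∫ x, (nonlinBeta F (f x) (dx f x)).im ∂torusMeasure

/-- Classical derivative of a function on the torus. -/
def torusDeriv (g : Torus → ℂ) (x : Torus) : ℂ := deriv (fun h : ℝ => g (x + (h : Torus))) 0

/-- Smooth functions on `ℝ × 𝕋`. -/
def SmoothST (χ : ℝ → Torus → ℂ) : Prop :=
  ContDiff ℝ ((⊤ : ℕ∞) : WithTop ℕ∞) (fun p : ℝ × ℝ => χ p.1 (p.2 : Torus))

/-- `∫_𝕋 f(x) χ(x) dx`. -/
def pairing (f χ : Torus → ℂ) : ℂ := ∫ x, f x * χ x ∂torusMeasure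

/-- `u` is a solution of `∂ₜu + i∂ₓ²u = F(u, ∂ₓu, ū, ∂ₓū)`, `u(0) = φ`, in `Hˢ` on `[0, T]`.
The test functions are the restrictions to `[0, T) × 𝕋` of smooth functions that
vanish for all times close to `T` and beyond. -/
structure IsForwardSolution (F : MvPolynomial (Fin 4) ℂ) (s T : ℝ) (φ : Sobolev s)
    (u : ℝ → Sobolev s) : Prop where
  memLp_top : MemLp u ⊤ (volume.restrict (Icc 0 T))
  weak : ∀ χ : ℝ → Torus → ℂ, SmoothST χ → (∃ T' < T, ∀ t, T' ≤ t → χ t = 0) →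
    - (∫ t in (0 : ℝ)..T, pairing ((u t).toL2) (fun x => deriv (fun τ => χ τ x) t))
      - pairing (φ.toL2) (χ 0)
      + Complex.I * (∫ t in (0 : ℝ)..T, pairing ((u t).toL2) (torusDeriv (torusDeriv (χ t))))
    = ∫ t in (0 : ℝ)..T,
        pairing (fun x => nonlin F ((u t).toL2 x) (dx (u t).toL2 x)) (χ t)

/-- `u` is a solution of `∂ₜu + i∂ₓ²u = F(u, ∂ₓu, ū, ∂ₓū)`, `u(0) = φ`, in `Hˢ` on `[-T, 0]`.
The test functions are the restrictions to `(-T, 0] × 𝕋` of smooth functions that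
vanish for all times close to `-T` and before. -/
structure IsBackwardSolution (F : MvPolynomial (Fin 4) ℂ) (s T : ℝ) (φ : Sobolev s)
    (u : ℝ → Sobolev s) : Prop where
  memLp_top : MemLp u ⊤ (volume.restrict (Icc (-T) 0))
  weak : ∀ χ : ℝ → Torus → ℂ, SmoothST χ → (∃ T' < T, ∀ t, t ≤ -T' → χ t = 0) →
    - (∫ t in (-T)..(0 : ℝ), pairing ((u t).toL2) (fun x => deriv (fun τ => χ τ x) t))
      + pairing (φ.toL2) (χ 0)
      + Complex.I * (∫ t in (-T)..(0 : ℝ), pairing ((u t).toL2) (torusDeriv (torusDeriv (χ t))))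
    = ∫ t in (-T)..(0 : ℝ),
        pairing (fun x => nonlin F ((u t).toL2 x) (dx (u t).toL2 x)) (χ t)

end

end TorusNLS

/-! The smoothing comes from a model equation. If `∂ₜW + i∂ₓ²W = m ∂ₓW + R` with `m` depending on
time only, then each mode satisfies `Ŵ' = (ik² + ikm) Ŵ + R̂`, and without `R` its modulus grows at
the rate `-k Im m`. A mode with `-k Im m > 0` that is still under control at a time `τ > 0` must
have been small at time `0`. Quantitatively, both the final value and the forcing bound `|Ŵ(k, 0)|²`
with a gain of `1/|k|`, so these modes of `W(0)` are half a derivative smoother than `W(τ)` and `R`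
(`growth_lower_bound`, `energy_bound`). This selects one sign of `k`, and reversing time (`ε = -1`)
selects the other.

The equation for `∂ₓ²u` is brought to this form with `σ = s - 2 > 1/2`, so that `H^σ` is an algebra.
The dangerous terms of `∂ₓ²F` are `F_β ∂ₓ³u` and the one containing the conjugate of `∂ₓ³u`. The
normal form `V = ∂ₓ²u + (i/2)F` removes the second: `-i∂ₓ²` acts with opposite signs on `u` and on
its conjugate (`dev_time`). The gauge `E = exp((i/2) ∂ₓ⁻¹F_β)`, where `∂ₓ⁻¹` discards the mean, then
replaces the coefficient `F_β` by its mean `m` in the equation of `W = EV`. In the remainder a third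
derivative survives only under a primitive, where integration by parts recovers the loss, so the
remainder stays bounded in `H^σ` (`UB.remainder`).

Since `u` has too few derivatives for this computation, it is carried out for the Fourier
truncations `u_N` (`hasDerivAt_cf_gauge_mul_normalForm`, `hasDerivAt_truncated`). They solve the
equation up to `E ∂ₓ²d`, where `d`, the truncation of `F(u)` minus `F(u_N)`, tends to `0` uniformly.
In a fixed mode both derivatives can be moved onto `E`, so over finitely many modes the error
vanishes as `N → ∞`, and the final bound does not depend on the finite set chosen.

Finally `V = E⁻¹W` with `E⁻¹ ∈ H^{σ+1}`. Multiplication by `E⁻¹` mixes the two signs of frequency,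
but going from one sign to the other costs a frequency of `E⁻¹` at least as large as the output
frequency, so the one-sided gain survives (`sq_conv_one_sided`). Subtracting the smoother `(i/2)F`
leaves the gain for `∂ₓ²φ` (`sq_indicator_second_deriv_ne_top`). -/

namespace TorusNLS

noncomputable section

open MeasureTheory Set Filter
open scoped ComplexConjugate ENNReal Topology

/-! ### Weights and weighted square sums -/

/-- The weight `⟨k⟩ʳ` as an extended nonnegative number. -/
def wt (r : ℝ) (k : ℤ) : ℝ≥0∞ := ENNReal.ofReal (bracket k ^ r)

lemma one_le_bracket (k : ℤ) : 1 ≤ bracket k := by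
  rw [bracket, Real.one_le_sqrt]; nlinarith [sq_nonneg (k : ℝ)]

lemma bracket_sq (k : ℤ) : bracket k ^ 2 = 1 + (k : ℝ) ^ 2 := Real.sq_sqrt (by positivity)

lemma abs_le_bracket (k : ℤ) : |(k : ℝ)| ≤ bracket k :=
  Real.abs_le_sqrt (by linarith)

lemma bracket_neg (k : ℤ) : bracket (-k) = bracket k := by simp [bracket]

/-- After squaring, all that is needed is `ab ≤ ⟨a⟩⟨b⟩` for the cross term. -/
lemma bracket_le_add (k l : ℤ) : bracket k ≤ bracket (k - l) + bracket l := by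
  have h1 := abs_le_bracket (k - l)
  have h2 := abs_le_bracket l
  have h3 := bracket_sq (k - l)
  have h4 := bracket_sq l
  have h5 := bracket_pos (k - l)
  have h6 := bracket_pos l
  have h7 : |((k - l : ℤ) : ℝ)| * |(l : ℝ)| ≤ bracket (k - l) * bracket l := by gcongr
  rw [← abs_mul] at h7
  have h8 := le_abs_self (((k - l : ℤ) : ℝ) * (l : ℝ))
  push_cast at *
  rw [bracket]
  apply Real.sqrt_le_iff.mpr ⟨by positivity, ?_⟩
  nlinarith

lemma bracket_le_of_abs_le {k l : ℤ} (h : |k| ≤ |l|) : bracket k ≤ bracket l := by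
  have : ((k : ℝ)) ^ 2 ≤ (l : ℝ) ^ 2 := by exact_mod_cast sq_le_sq.mpr h
  exact Real.sqrt_le_sqrt (by linarith)

lemma wt_neg (r : ℝ) (k : ℤ) : wt r (-k) = wt r k := by rw [wt, bracket_neg, wt]

lemma wt_mono {r q : ℝ} (h : r ≤ q) (k : ℤ) : wt r k ≤ wt q k :=
  ENNReal.ofReal_le_ofReal (Real.rpow_le_rpow_of_exponent_le (one_le_bracket k) h)

lemma wt_le_of_abs_le {r : ℝ} (hr : 0 ≤ r) {k l : ℤ} (h : |k| ≤ |l|) : wt r k ≤ wt r l :=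
  ENNReal.ofReal_le_ofReal (Real.rpow_le_rpow (bracket_pos k).le (bracket_le_of_abs_le h) hr)

lemma wt_add (r q : ℝ) (k : ℤ) : wt (r + q) k = wt r k * wt q k := by
  rw [wt, Real.rpow_add (bracket_pos k), ENNReal.ofReal_mul (by have := bracket_pos k; positivity)]
  rfl

lemma wt_zero (k : ℤ) : wt 0 k = 1 := by simp [wt]

/-- Peetre-type subadditivity of the weight. -/
lemma wt_le_add {r : ℝ} (hr : 0 ≤ r) (k l : ℤ) :
    wt r k ≤ ENNReal.ofReal (2 ^ r) * (wt r (k - l) + wt r l) := by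
  have h1 := bracket_pos (k - l)
  have h2 := bracket_pos l
  rw [wt, wt, wt, ← ENNReal.ofReal_add (by positivity) (by positivity),
    ← ENNReal.ofReal_mul (by positivity)]
  apply ENNReal.ofReal_le_ofReal
  have h3 := bracket_le_add k l
  rcases le_total (bracket (k - l)) (bracket l) with h | h
  · calc bracket k ^ r ≤ (2 * bracket l) ^ r :=
          Real.rpow_le_rpow (bracket_pos k).le (by linarith) hr
      _ = 2 ^ r * bracket l ^ r := Real.mul_rpow (by norm_num) h2.le
      _ ≤ _ := by gcongr; have := Real.rpow_nonneg h1.le r; linarith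
  · calc bracket k ^ r ≤ (2 * bracket (k - l)) ^ r :=
          Real.rpow_le_rpow (bracket_pos k).le (by linarith) hr
      _ = 2 ^ r * bracket (k - l) ^ r := Real.mul_rpow (by norm_num) h1.le
      _ ≤ _ := by gcongr; have := Real.rpow_nonneg h2.le r; linarith

lemma summable_bracket_rpow {p : ℝ} (hp : p < -1) : Summable fun k : ℤ => bracket k ^ p := by
  have h1 : Summable fun k : ℤ => |(k : ℝ)| ^ p := by
    have := (Real.summable_abs_int_rpow (b := -p) (by linarith))
    simpa using this
  refine Summable.of_norm_bounded_eventually h1 ?_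
  have : ({0}ᶜ : Set ℤ) ∈ cofinite := (Set.finite_singleton 0).compl_mem_cofinite
  filter_upwards [this] with k hk
  have hk' : 0 < |(k : ℝ)| := by
    rw [abs_pos]; exact_mod_cast hk
  rw [Real.norm_of_nonneg (Real.rpow_nonneg (bracket_pos k).le p)]
  exact Real.rpow_le_rpow_of_nonpos hk' (abs_le_bracket k) (by linarith)

lemma tsum_wt_ne_top {p : ℝ} (hp : p < -1) : ∑' k, wt p k ≠ ⊤ := by
  have := (summable_bracket_rpow hp).tsum_ofReal_ne_top
  exact this

/-- Leaving out the factor `1/2` avoids division in `ℝ≥0∞`; it accounts for the non-optimal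
constants `3` and `2` in the next two inequalities. -/
lemma ennreal_mul_le_sq_add_sq (x y : ℝ≥0∞) : x * y ≤ x ^ 2 + y ^ 2 := by
  rcases le_total x y with h | h
  · calc x * y ≤ y * y := by gcongr
      _ = y ^ 2 := (sq y).symm
      _ ≤ _ := le_add_self
  · calc x * y ≤ x * x := by gcongr
      _ = x ^ 2 := (sq x).symm
      _ ≤ _ := le_self_add

lemma ennreal_add_sq_le (x y : ℝ≥0∞) : (x + y) ^ 2 ≤ 3 * (x ^ 2 + y ^ 2) := by
  have := ennreal_mul_le_sq_add_sq x y
  calc (x + y) ^ 2 = x ^ 2 + y ^ 2 + (x * y + x * y) := by ring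
    _ ≤ x ^ 2 + y ^ 2 + (x ^ 2 + y ^ 2 + (x ^ 2 + y ^ 2)) := by gcongr
    _ = _ := by ring

/-- A weighted Cauchy-Schwarz inequality. -/
lemma tsum_mul_sq_le {ι : Type*} (a x : ι → ℝ≥0∞) :
    (∑' i, a i * x i) ^ 2 ≤ 2 * (∑' i, a i) * ∑' i, a i * x i ^ 2 := by
  -- The square is a double sum; bounding `xᵢxⱼ` by `xᵢ² + xⱼ²` gives two equal halves, with no
  -- summability to check.
  calc (∑' i, a i * x i) ^ 2 = ∑' i, ∑' j, (a i * a j) * (x i * x j) := by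
        rw [sq, ← ENNReal.tsum_mul_right]
        congr 1; ext i
        rw [← ENNReal.tsum_mul_left]
        congr 1; ext j; ring
    _ ≤ ∑' i, ∑' j, (a i * a j) * (x i ^ 2 + x j ^ 2) := by
        gcongr with i j
        exact ennreal_mul_le_sq_add_sq _ _
    _ = ∑' i, ∑' j, (a i * x i ^ 2) * a j + ∑' i, ∑' j, a i * (a j * x j ^ 2) := by
        rw [← ENNReal.tsum_add]
        congr 1; ext i
        rw [← ENNReal.tsum_add]
        congr 1; ext j; ring
    _ = _ := by
        simp_rw [ENNReal.tsum_mul_left, ENNReal.tsum_mul_right]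
        ring

/-- Young's inequality `ℓ¹ * ℓ² ⊆ ℓ²`. -/
lemma young_sq (a b : ℤ → ℝ≥0∞) :
    ∑' k, (∑' l, a (k - l) * b l) ^ 2 ≤ 2 * (∑' k, a k) ^ 2 * ∑' k, b k ^ 2 := by
  calc ∑' k, (∑' l, a (k - l) * b l) ^ 2
      ≤ ∑' k, 2 * (∑' l, a (k - l)) * ∑' l, a (k - l) * b l ^ 2 := by
        gcongr with k; exact tsum_mul_sq_le _ _
    _ = ∑' k, 2 * (∑' l, a l) * ∑' l, a (k - l) * b l ^ 2 := by
        congr 1; ext k; congr 2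
        exact (Equiv.subLeft k).tsum_eq a
    _ = 2 * (∑' l, a l) * ∑' l, ∑' k, a (k - l) * b l ^ 2 := by
        rw [ENNReal.tsum_mul_left, ENNReal.tsum_comm]
    _ = 2 * (∑' l, a l) * ∑' l, (∑' k, a k) * b l ^ 2 := by
        congr 2; ext l
        rw [ENNReal.tsum_mul_right]
        congr 1
        exact (Equiv.subRight l).tsum_eq a
    _ = _ := by rw [ENNReal.tsum_mul_left]; ring

/-- The substitution `l ↦ k - l` exchanges the roles of the `ℓ¹` and the `ℓ²` factor. -/
lemma young_sq' (a b : ℤ → ℝ≥0∞) :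
    ∑' k, (∑' l, a (k - l) * b l) ^ 2 ≤ 2 * (∑' k, b k) ^ 2 * ∑' k, a k ^ 2 := by
  refine le_trans (le_of_eq ?_) (young_sq b a)
  congr 1; ext k; congr 1
  rw [← (Equiv.subLeft k).tsum_eq]
  congr 1; ext l
  simp [mul_comm]

/-- The squared weighted norm `∑ ⟨k⟩²ʳ |aₖ|²`. -/
def sq (r : ℝ) (a : ℤ → ℂ) : ℝ≥0∞ := ∑' k, (wt r k * ‖a k‖ₑ) ^ 2

lemma sq_mono_of_le {r : ℝ} {a b : ℤ → ℂ} (h : ∀ k, ‖a k‖ₑ ≤ ‖b k‖ₑ) : sq r a ≤ sq r b := by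
  unfold sq; gcongr with k; exact h k

lemma sq_mono {r q : ℝ} (h : r ≤ q) (a : ℤ → ℂ) : sq r a ≤ sq q a := by
  unfold sq; gcongr with k; exact wt_mono h k

lemma sq_add_le (r : ℝ) (a b : ℤ → ℂ) : sq r (a + b) ≤ 3 * (sq r a + sq r b) := by
  unfold sq
  rw [← ENNReal.tsum_add, ← ENNReal.tsum_mul_left]
  gcongr with k
  refine le_trans ?_ (ennreal_add_sq_le _ _)
  rw [← mul_add]
  gcongr
  exact enorm_add_le _ _

lemma sq_smul (r : ℝ) (c : ℂ) (a : ℤ → ℂ) : sq r (c • a) = ‖c‖ₑ ^ 2 * sq r a := by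
  unfold sq
  rw [← ENNReal.tsum_mul_left]
  congr 1; ext k
  simp only [Pi.smul_apply, smul_eq_mul, enorm_mul]; ring

/-- `ℓ¹` is controlled by the weighted norm of order `r > 1/2`. -/
lemma tsum_enorm_sq_le {r : ℝ} (a : ℤ → ℂ) :
    (∑' k, ‖a k‖ₑ) ^ 2 ≤ 2 * (∑' k, wt (-2 * r) k) * sq r a := by
  -- The weight `⟨k⟩^{-2r}` serves as the measure in the weighted Cauchy-Schwarz inequality; its
  -- total mass is finite when `r > 1/2`.
  have key : ∀ k, ‖a k‖ₑ = wt (-2 * r) k * (wt (2 * r) k * ‖a k‖ₑ) := fun k => by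
    rw [← mul_assoc, ← wt_add]; ring_nf; rw [wt_zero, one_mul]
  calc (∑' k, ‖a k‖ₑ) ^ 2 = (∑' k, wt (-2 * r) k * (wt (2 * r) k * ‖a k‖ₑ)) ^ 2 := by
        congr 2; ext k; exact key k
    _ ≤ _ := tsum_mul_sq_le _ _
    _ = _ := by
        congr 1
        unfold sq
        congr 1; ext k
        rw [show 2 * r = r + r by ring, wt_add, show -2 * r = - r + - r by ring, wt_add]
        have : wt (-r) k * wt r k = 1 := by rw [← wt_add]; simp [wt_zero]
        calc _ = (wt (-r) k * wt r k) ^ 2 * (wt r k * ‖a k‖ₑ) ^ 2 := by ring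
          _ = _ := by rw [this]; simp

/-- Subadditivity of the weight puts it on one factor at a time, and Young's inequality needs only
the `ℓ¹` norm of the other. The constant is `6 = 3 · 2`, from `ennreal_add_sq_le` and `young_sq`. -/
lemma sq_conv_le {r : ℝ} (hr : 0 ≤ r) {a b c : ℤ → ℂ}
    (h : ∀ k, ‖c k‖ₑ ≤ ∑' l, ‖a (k - l)‖ₑ * ‖b l‖ₑ) :
    sq r c ≤ 6 * ENNReal.ofReal (2 ^ r) ^ 2 *
      ((∑' k, ‖b k‖ₑ) ^ 2 * sq r a + (∑' k, ‖a k‖ₑ) ^ 2 * sq r b) := by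
  set C := ENNReal.ofReal (2 ^ r)
  calc sq r c ≤ ∑' k, (C * (∑' l, (wt r (k - l) * ‖a (k - l)‖ₑ) * ‖b l‖ₑ
          + ∑' l, ‖a (k - l)‖ₑ * (wt r l * ‖b l‖ₑ))) ^ 2 := by
        refine ENNReal.tsum_le_tsum fun k => pow_le_pow_left' ?_ 2
        refine (mul_le_mul_right (h k) _).trans ?_
        rw [← ENNReal.tsum_mul_left, ← ENNReal.tsum_add, ← ENNReal.tsum_mul_left]
        refine ENNReal.tsum_le_tsum fun l => ?_
        calc wt r k * (‖a (k - l)‖ₑ * ‖b l‖ₑ)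
            ≤ (C * (wt r (k - l) + wt r l)) * (‖a (k - l)‖ₑ * ‖b l‖ₑ) := by
              gcongr; exact wt_le_add hr k l
          _ = _ := by ring
    _ ≤ ∑' k, C ^ 2 * (3 * ((∑' l, (wt r (k - l) * ‖a (k - l)‖ₑ) * ‖b l‖ₑ) ^ 2
          + (∑' l, ‖a (k - l)‖ₑ * (wt r l * ‖b l‖ₑ)) ^ 2)) := by
        gcongr with k
        rw [mul_pow]
        gcongr
        exact ennreal_add_sq_le _ _
    _ ≤ C ^ 2 * (3 * (2 * (∑' k, ‖b k‖ₑ) ^ 2 * sq r a + 2 * (∑' k, ‖a k‖ₑ) ^ 2 * sq r b)) := by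
        rw [ENNReal.tsum_mul_left, ENNReal.tsum_mul_left, ENNReal.tsum_add]
        gcongr
        · exact young_sq' (fun k => wt r k * ‖a k‖ₑ) (fun k => ‖b k‖ₑ)
        · exact young_sq (fun k => ‖a k‖ₑ) (fun k => wt r k * ‖b k‖ₑ)
    _ = _ := by ring

/-- The constant in the algebra property of order `r`. -/
def algConst (r : ℝ) : ℝ≥0∞ := 24 * ENNReal.ofReal (2 ^ r) ^ 2 * ∑' k, wt (-2 * r) k

lemma algConst_ne_top {r : ℝ} (hr : 1 / 2 < r) : algConst r ≠ ⊤ := by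
  unfold algConst
  have := tsum_wt_ne_top (p := -2 * r) (by linarith)
  finiteness

lemma sq_conv_le_mul {r : ℝ} (hr : 0 ≤ r) {a b c : ℤ → ℂ}
    (h : ∀ k, ‖c k‖ₑ ≤ ∑' l, ‖a (k - l)‖ₑ * ‖b l‖ₑ) :
    sq r c ≤ algConst r * sq r a * sq r b := by
  refine (sq_conv_le hr h).trans ?_
  have ha := tsum_enorm_sq_le (r := r) a
  have hb := tsum_enorm_sq_le (r := r) b
  calc _ ≤ 6 * ENNReal.ofReal (2 ^ r) ^ 2 *
      ((2 * (∑' k, wt (-2 * r) k) * sq r b) * sq r a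
        + (2 * (∑' k, wt (-2 * r) k) * sq r a) * sq r b) := by gcongr
    _ = _ := by unfold algConst; ring

/-- A one-sided product estimate: on a set `S` of modes `k` such that `|k| ≤ |k - l|` for
`l ∉ S`, only the part of `b` in `S` has to be regular. -/
lemma sq_conv_one_sided {r : ℝ} (hr : 0 ≤ r) {S : Set ℤ} {a b c : ℤ → ℂ}
    (hS : ∀ k ∈ S, ∀ l ∉ S, |k| ≤ |k - l|)
    (h : ∀ k, ‖c k‖ₑ ≤ ∑' l, ‖a (k - l)‖ₑ * ‖b l‖ₑ) :
    sq r (S.indicator c) ≤ 6 * ENNReal.ofReal (2 ^ r) ^ 2 *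
      ((∑' k, ‖b k‖ₑ) ^ 2 * sq r a + (∑' k, ‖a k‖ₑ) ^ 2 * sq r (S.indicator b)) := by
  set C := ENNReal.ofReal (2 ^ r)
  have hC : 1 ≤ C := by
    rw [← ENNReal.ofReal_one]
    exact ENNReal.ofReal_le_ofReal (Real.one_le_rpow (by norm_num) hr)
  calc sq r (S.indicator c) ≤ ∑' k, (C * (∑' l, (wt r (k - l) * ‖a (k - l)‖ₑ) * ‖b l‖ₑ
          + ∑' l, ‖a (k - l)‖ₑ * (wt r l * ‖S.indicator b l‖ₑ))) ^ 2 := by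
        refine ENNReal.tsum_le_tsum fun k => pow_le_pow_left' ?_ 2
        by_cases hk : k ∈ S
        · rw [indicator_of_mem hk]
          refine (mul_le_mul_right (h k) _).trans ?_
          rw [← ENNReal.tsum_mul_left, ← ENNReal.tsum_add, ← ENNReal.tsum_mul_left]
          refine ENNReal.tsum_le_tsum fun l => ?_
          by_cases hl : l ∈ S
          · rw [indicator_of_mem hl]
            calc wt r k * (‖a (k - l)‖ₑ * ‖b l‖ₑ)
                ≤ (C * (wt r (k - l) + wt r l)) * (‖a (k - l)‖ₑ * ‖b l‖ₑ) := by
                  gcongr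
                  exact wt_le_add hr k l
              _ = _ := by ring
          -- For `l` outside `S` the whole weight goes onto `a`, so no regularity of `b l` is used;
          -- `C ≥ 1` only brings this case to the same form as the other.
          · rw [indicator_of_notMem hl]
            calc wt r k * (‖a (k - l)‖ₑ * ‖b l‖ₑ)
                ≤ (C * wt r (k - l)) * (‖a (k - l)‖ₑ * ‖b l‖ₑ) := by
                  gcongr
                  exact (wt_le_of_abs_le hr (hS k hk l hl)).trans (le_mul_of_one_le_left' hC)
              _ = _ := by
                rw [enorm_zero, mul_zero, mul_zero, add_zero]
                ring
        · rw [indicator_of_notMem hk]; simp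
    _ ≤ ∑' k, C ^ 2 * (3 * ((∑' l, (wt r (k - l) * ‖a (k - l)‖ₑ) * ‖b l‖ₑ) ^ 2
          + (∑' l, ‖a (k - l)‖ₑ * (wt r l * ‖S.indicator b l‖ₑ)) ^ 2)) := by
        gcongr with k
        rw [mul_pow]
        gcongr
        exact ennreal_add_sq_le _ _
    _ ≤ C ^ 2 * (3 * (2 * (∑' k, ‖b k‖ₑ) ^ 2 * sq r a
          + 2 * (∑' k, ‖a k‖ₑ) ^ 2 * sq r (S.indicator b))) := by
        rw [ENNReal.tsum_mul_left, ENNReal.tsum_mul_left, ENNReal.tsum_add]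
        gcongr
        · exact young_sq' (fun k => wt r k * ‖a k‖ₑ) (fun k => ‖b k‖ₑ)
        · exact young_sq (fun k => ‖a k‖ₑ) (fun k => wt r k * ‖S.indicator b k‖ₑ)
    _ = _ := by ring

/-! ### Fourier coefficients of continuous functions -/

/-- Continuous complex functions on the torus. -/
abbrev CT : Type := C(Torus, ℂ)

/-- The `k`-th Fourier coefficient as a continuous linear functional. -/
def coef (k : ℤ) : CT →L[ℂ] ℂ :=
  LinearMap.mkContinuous
    { toFun := fun f => fourierCoeff (f : Torus → ℂ) k
      map_add' := fun f g => by
        have hf := f.continuous.integrable_of_hasCompactSupport (μ := torusMeasure)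
          (HasCompactSupport.of_compactSpace _)
        have hg := g.continuous.integrable_of_hasCompactSupport (μ := torusMeasure)
          (HasCompactSupport.of_compactSpace _)
        exact congrFun (fourierCoeff.add hf hg) k
      map_smul' := fun c f => fourierCoeff.const_smul (f : Torus → ℂ) c k } 1 (by
    intro f
    change ‖fourierCoeff (f : Torus → ℂ) k‖ ≤ 1 * ‖f‖
    unfold fourierCoeff
    refine (norm_integral_le_of_norm_le_const (C := ‖f‖) (.of_forall fun x => ?_)).trans ?_
    · rw [norm_smul]
      calc _ ≤ 1 * ‖f‖ := by
            gcongr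
            · rw [← fourier_norm (T := 2 * Real.pi) (-k)]
              exact ContinuousMap.norm_coe_le_norm _ x
            · exact ContinuousMap.norm_coe_le_norm _ x
        _ = _ := one_mul _
    · simp)

lemma coef_apply (k : ℤ) (f : CT) : coef k f = fourierCoeff (f : Torus → ℂ) k := rfl

/-- The sequence of Fourier coefficients. -/
def cf (f : CT) (k : ℤ) : ℂ := coef k f

lemma norm_cf_le (f : CT) (k : ℤ) : ‖cf f k‖ ≤ ‖f‖ := by
  have := (coef k).le_of_opNorm_le (LinearMap.mkContinuous_norm_le _ zero_le_one _) f
  rwa [one_mul] at this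

@[simp] lemma cf_add (f g : CT) : cf (f + g) = cf f + cf g := by ext; simp [cf]
@[simp] lemma cf_sub (f g : CT) : cf (f - g) = cf f - cf g := by ext; simp [cf]
@[simp] lemma cf_neg (f : CT) : cf (-f) = - cf f := by ext; simp [cf]
@[simp] lemma cf_smul (c : ℂ) (f : CT) : cf (c • f) = c • cf f := by ext; simp [cf]
@[simp] lemma cf_zero : cf 0 = 0 := by ext; simp [cf]

lemma toLp_repr (f : CT) (k : ℤ) :
    (fourierBasis (T := 2 * Real.pi)).repr (ContinuousMap.toLp 2 torusMeasure ℂ f) k = cf f k := by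
  rw [fourierBasis_repr, fourierCoeff_toLp]; rfl

lemma cf_injective : Function.Injective cf := by
  intro f g h
  have h1 : Function.Injective (ContinuousMap.toLp (E := ℂ) 2 torusMeasure ℂ) :=
    ContinuousMap.toLp_injective torusMeasure
  apply h1
  apply (fourierBasis (T := 2 * Real.pi)).repr.injective
  ext k
  rw [toLp_repr, toLp_repr, h]

lemma cf_mul_fourier (f : CT) (m k : ℤ) : cf (f * fourier m) k = cf f (k - m) := by
  simp only [cf, coef_apply, fourierCoeff]
  congr 1; ext x
  rw [show -(k - m) = -k + m by ring, fourier_add]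
  simp only [ContinuousMap.coe_mul, Pi.mul_apply, smul_eq_mul]
  ring

lemma cf_one (k : ℤ) : cf 1 k = if k = 0 then 1 else 0 := by
  have h := orthonormal_iff_ite.mp (fourierBasis (T := 2 * Real.pi)).orthonormal k 0
  have h1 := (fourierBasis (T := 2 * Real.pi)).repr_apply_apply
    (ContinuousMap.toLp 2 torusMeasure ℂ (1 : CT)) k
  rw [toLp_repr] at h1
  rw [h1, ← h]
  congr 1
  rw [coe_fourierBasis]
  change _ = ContinuousMap.toLp 2 torusMeasure ℂ (fourier 0)
  congr 1
  ext x
  simp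

lemma cf_fourier (m k : ℤ) : cf (fourier m) k = if k = m then 1 else 0 := by
  have := cf_mul_fourier 1 m k
  rw [one_mul, cf_one] at this
  rw [this]
  simp [sub_eq_zero]

lemma cf_star (f : CT) (k : ℤ) : cf (star f) k = conj (cf f (-k)) := by
  simp only [cf, coef_apply, fourierCoeff]
  rw [← integral_conj]
  congr 1; ext x
  simp only [ContinuousMap.star_apply, smul_eq_mul, map_mul]
  rw [← fourier_neg, neg_neg]
  rfl

/-- Fourier coefficients of a product. -/
lemma hasSum_cf_mul (f g : CT) (k : ℤ) :
    HasSum (fun l => cf f (k - l) * cf g l) (cf (f * g) k) := by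
  -- Parseval's identity for the pair `f̄ e_k` and `g`, whose inner product is the `k`-th
  -- coefficient of `f g`.
  have h := (fourierBasis (T := 2 * Real.pi)).hasSum_inner_mul_inner
    (ContinuousMap.toLp 2 torusMeasure ℂ (star f * fourier k))
    (ContinuousMap.toLp 2 torusMeasure ℂ g)
  have e1 : ∀ l, inner ℂ (ContinuousMap.toLp 2 torusMeasure ℂ (star f * fourier k))
      ((fourierBasis (T := 2 * Real.pi)) l) * inner ℂ ((fourierBasis (T := 2 * Real.pi)) l)
      (ContinuousMap.toLp 2 torusMeasure ℂ g) = cf f (k - l) * cf g l := fun l => by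
    rw [← (fourierBasis (T := 2 * Real.pi)).repr_apply_apply,
      ← inner_conj_symm, ← (fourierBasis (T := 2 * Real.pi)).repr_apply_apply, toLp_repr, toLp_repr,
      cf_mul_fourier, cf_star]
    simp
  have e2 : inner ℂ (ContinuousMap.toLp 2 torusMeasure ℂ (star f * fourier k))
      (ContinuousMap.toLp 2 torusMeasure ℂ g) = cf (f * g) k := by
    rw [ContinuousMap.inner_toLp]
    simp only [cf, coef_apply, fourierCoeff]
    congr 1; ext x
    simp only [ContinuousMap.coe_mul, Pi.mul_apply, smul_eq_mul, map_mul, fourier_neg]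
    simp only [ContinuousMap.star_apply, RCLike.star_def, Complex.conj_conj]
    ring
  simp_rw [e1, e2] at h
  exact h

lemma enorm_cf_mul_le (f g : CT) (k : ℤ) :
    ‖cf (f * g) k‖ₑ ≤ ∑' l, ‖cf f (k - l)‖ₑ * ‖cf g l‖ₑ := by
  rw [← (hasSum_cf_mul f g k).tsum_eq]
  refine enorm_tsum_le_tsum_enorm.trans (le_of_eq ?_)
  simp_rw [enorm_mul]

/-- Synthesis of a continuous function from its Fourier coefficients. -/
def syn (a : ℤ → ℂ) : CT := ∑' k, a k • (fourier k : CT)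

lemma summable_syn {a : ℤ → ℂ} (ha : Summable a) : Summable fun k => a k • (fourier k : CT) := by
  refine Summable.of_norm ?_
  simp_rw [norm_smul, fourier_norm, mul_one]
  exact ha.norm

lemma cf_syn {a : ℤ → ℂ} (ha : Summable a) : cf (syn a) = a := by
  ext k
  have h := (coef k).hasSum (summable_syn ha).hasSum
  have h2 : HasSum (fun l => coef k (a l • (fourier l : CT))) (a k) := by
    convert hasSum_ite_eq k (a k) using 2 with l
    rw [map_smul]
    change a l • cf _ k = _
    rw [cf_fourier]
    by_cases h : k = l
    · simp [h]
    · simp [h, Ne.symm h]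
  exact h.unique h2

lemma norm_le_tsum_cf {f : CT} (h : Summable (cf f)) : ‖f‖ ≤ ∑' k, ‖cf f k‖ := by
  have h1 : syn (cf f) = f := cf_injective (cf_syn h)
  rw [← h1]
  have e : ∀ k, ‖cf f k • (fourier k : CT)‖ = ‖cf f k‖ := fun k => by
    rw [norm_smul, fourier_norm, mul_one]
  have hs : Summable fun k => ‖cf f k • (fourier k : CT)‖ := h.norm.congr fun k => (e k).symm
  refine (norm_tsum_le_tsum_norm hs).trans (le_of_eq ?_)
  simp_rw [e, h1]

/-- In `ℝ≥0∞` no summability has to be assumed: a divergent right-hand side makes the bound trivial.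
-/
lemma enorm_le_tsum_cf (f : CT) : ‖f‖ₑ ≤ ∑' k, ‖cf f k‖ₑ := by
  by_cases h : ∑' k, ‖cf f k‖ₑ = ⊤
  · rw [h]; exact le_top
  · have hs : Summable (cf f) := by
      refine Summable.of_norm ?_
      have := ENNReal.summable_toReal h
      simpa using this
    have := norm_le_tsum_cf hs
    rw [← ofReal_norm]
    refine (ENNReal.ofReal_le_ofReal this).trans (le_of_eq ?_)
    rw [ENNReal.ofReal_tsum_of_nonneg (fun _ => norm_nonneg _) hs.norm]
    simp_rw [ofReal_norm]

/-! ### Derivatives on the Fourier side -/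

/-- `f'` is the derivative of `f`, expressed through Fourier coefficients. -/
def IsDeriv (f f' : CT) : Prop := ∀ k : ℤ, cf f' k = Complex.I * k * cf f k

lemma IsDeriv.add {f f' g g' : CT} (hf : IsDeriv f f') (hg : IsDeriv g g') :
    IsDeriv (f + g) (f' + g') := fun k => by
  simp only [cf_add, Pi.add_apply, hf k, hg k]; ring

lemma IsDeriv.sub {f f' g g' : CT} (hf : IsDeriv f f') (hg : IsDeriv g g') :
    IsDeriv (f - g) (f' - g') := fun k => by
  simp only [cf_sub, Pi.sub_apply, hf k, hg k]; ring

lemma IsDeriv.smul {f f' : CT} (hf : IsDeriv f f') (c : ℂ) : IsDeriv (c • f) (c • f') := fun k => by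
  simp only [cf_smul, Pi.smul_apply, hf k, smul_eq_mul]; ring

lemma IsDeriv.star {f f' : CT} (hf : IsDeriv f f') : IsDeriv (star f) (star f') := fun k => by
  simp only [cf_star, hf (-k), map_mul, Complex.conj_I]; simp

lemma isDeriv_const (c : ℂ) : IsDeriv (algebraMap ℂ CT c) 0 := fun k => by
  rw [Algebra.algebraMap_eq_smul_one]
  simp only [cf_smul, cf_zero, Pi.zero_apply, Pi.smul_apply, cf_one]
  split_ifs with h <;> simp [h]

/-- The Leibniz rule is `k = (k - l) + l` inside the convolution sum. -/
lemma IsDeriv.mul {f f' g g' : CT} (hf : IsDeriv f f') (hg : IsDeriv g g') :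
    IsDeriv (f * g) (f' * g + f * g') := fun k => by
  have h1 := (hasSum_cf_mul f' g k).add (hasSum_cf_mul f g' k)
  have h2 := (hasSum_cf_mul f g k).mul_left (Complex.I * k)
  simp only [cf_add, Pi.add_apply]
  have e : ∀ l, cf f' (k - l) * cf g l + cf f (k - l) * cf g' l =
      Complex.I * k * (cf f (k - l) * cf g l) := fun l => by
    rw [hf, hg]; push_cast; ring
  simp_rw [e] at h1
  exact h1.unique h2

lemma IsDeriv.pow_succ {f f' : CT} (hf : IsDeriv f f') (n : ℕ) :
    IsDeriv (f ^ (n + 1)) (((n + 1 : ℕ) : ℂ) • (f' * f ^ n)) := by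
  induction n with
  | zero => simpa using hf
  | succ n ih =>
    have := ih.mul hf
    convert this using 1
    · rw [_root_.pow_succ]
    rw [Algebra.smul_def, Algebra.smul_def]
    push_cast
    ring

lemma hasSum_exp_CT (g : CT) :
    HasSum (fun n : ℕ => ((n.factorial : ℂ)⁻¹) • g ^ n) (NormedSpace.exp g) :=
  NormedSpace.exp_series_hasSum_exp' (𝕂 := ℂ) g

/-- Termwise in the exponential series: the derivative of `g^{n+1}/(n+1)!` is `g' g^n/n!`, and the
constant term drops out, whence the index shift. -/
lemma IsDeriv.exp {g g' : CT} (hg : IsDeriv g g') :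
    IsDeriv (NormedSpace.exp g) (g' * NormedSpace.exp g) := fun k => by
  have h1 := ((coef k).hasSum (hasSum_exp_CT g)).mul_left (Complex.I * k)
  have h2 := (coef k).hasSum ((hasSum_exp_CT g).mul_left g')
  rw [← hasSum_nat_add_iff' 1] at h1
  have h0 : Complex.I * k * coef k 1 = 0 := by
    have := cf_one k
    change Complex.I * k * cf 1 k = 0
    rw [this]; split_ifs with h <;> simp [h]
  simp only [Finset.range_one, Finset.sum_singleton, Nat.factorial_zero, Nat.cast_one, inv_one,
    pow_zero, one_smul, h0, sub_zero] at h1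
  have e : ∀ n : ℕ, coef k (g' * (((n.factorial : ℂ)⁻¹) • g ^ n)) =
      Complex.I * k * coef k ((((n + 1).factorial : ℂ)⁻¹) • g ^ (n + 1)) := fun n => by
    have h3 := hg.pow_succ n k
    rw [mul_smul_comm, map_smul, map_smul, smul_eq_mul, smul_eq_mul]
    change _ * cf _ k = _ * (_ * cf _ k)
    rw [mul_left_comm, ← h3, cf_smul, Pi.smul_apply, smul_eq_mul, ← mul_assoc]
    congr 1
    rw [Nat.factorial_succ]; push_cast
    have : ((n : ℂ) + 1) ≠ 0 := by exact_mod_cast Nat.succ_ne_zero n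
    field_simp
  simp_rw [e] at h2
  exact h2.unique h1

/-- Parseval, together with `‖f‖_{L²} ≤ ‖f‖_∞` for a measure of total mass `1`. -/
lemma sum_sq_cf_le (f : CT) :
    Summable (fun k : ℤ => ‖cf f k‖ ^ 2) ∧ ∑' k : ℤ, ‖cf f k‖ ^ 2 ≤ ‖f‖ ^ 2 := by
  have h1 := (hasSum_sq_fourierCoeff (ContinuousMap.toLp 2 torusMeasure ℂ f)).summable
  have h2 := tsum_sq_fourierCoeff (ContinuousMap.toLp 2 torusMeasure ℂ f)
  simp only [fourierCoeff_toLp] at h1 h2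
  refine ⟨h1, ?_⟩
  change ∑' k : ℤ, ‖fourierCoeff (f : Torus → ℂ) k‖ ^ 2 ≤ _
  rw [h2]
  have h3 : ∫ t, ‖(ContinuousMap.toLp (E := ℂ) 2 torusMeasure ℂ f : Torus → ℂ) t‖ ^ 2
      ∂torusMeasure = ∫ t, ‖f t‖ ^ 2 ∂torusMeasure := by
    apply integral_congr_ae
    have h4 := ContinuousMap.coeFn_toLp (E := ℂ) (p := 2) (𝕜 := ℂ) torusMeasure f
    filter_upwards [h4] with x hx
    rw [hx]
  rw [h3]
  refine (Real.le_norm_self _).trans ?_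
  refine (norm_integral_le_of_norm_le_const (μ := torusMeasure) (C := ‖f‖ ^ 2) (.of_forall fun x => ?_)).trans ?_
  · rw [norm_pow, norm_norm]
    gcongr
    exact ContinuousMap.norm_coe_le_norm _ x
  · simp

/-- The sequence `1/(ik)` is square summable, so the coefficients of the primitive are absolutely
summable and the primitive is bounded in the sup norm. The mode `k = 0` contributes `0` because the
inverse of `0` is `0`. -/
lemma sum_inv_mul_cf_le (f : CT) :
    Summable (fun k : ℤ => ‖(Complex.I * (k : ℂ))⁻¹ * cf f k‖) ∧
      ∑' k : ℤ, ‖(Complex.I * (k : ℂ))⁻¹ * cf f k‖ ≤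
        (∑' k : ℤ, ‖(Complex.I * (k : ℂ))⁻¹‖ ^ 2 + 1) * ‖f‖ := by
  have hz : Summable (fun k : ℤ => ‖(Complex.I * (k : ℂ))⁻¹‖ ^ 2) := by
    have := (Real.summable_one_div_int_pow (p := 2)).mpr (by norm_num)
    refine this.congr fun k => ?_
    simp [div_eq_mul_inv]
  obtain ⟨hs1, hs2⟩ := sum_sq_cf_le f
  rcases eq_or_ne ‖f‖ 0 with h0 | h0
  · have : f = 0 := norm_eq_zero.mp h0
    subst this
    simp
  have hpos : 0 < ‖f‖ := lt_of_le_of_ne (norm_nonneg _) h0.symm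
  -- Young's inequality balanced by `‖f‖`, so that both sums come out linear in `‖f‖`.
  have hle : ∀ k : ℤ, ‖(Complex.I * (k : ℂ))⁻¹ * cf f k‖ ≤
      ‖f‖ * ‖(Complex.I * (k : ℂ))⁻¹‖ ^ 2 + ‖f‖⁻¹ * ‖cf f k‖ ^ 2 := fun k => by
    rw [norm_mul]
    set x := ‖(Complex.I * (k : ℂ))⁻¹‖
    set y := ‖cf f k‖
    have : 0 ≤ ‖f‖⁻¹ * (‖f‖ * x - y) ^ 2 := by positivity
    have hx : 0 ≤ x * y := by positivity
    have e : ‖f‖⁻¹ * (‖f‖ * x - y) ^ 2 = ‖f‖ * x ^ 2 + ‖f‖⁻¹ * y ^ 2 - 2 * (x * y) := by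
      field_simp; ring
    linarith
  have hsum := (hz.mul_left ‖f‖).add (hs1.mul_left ‖f‖⁻¹)
  have hs3 := Summable.of_nonneg_of_le (fun _ => norm_nonneg _) hle hsum
  refine ⟨hs3, ?_⟩
  refine (Summable.tsum_le_tsum hle hs3 hsum).trans ?_
  rw [(hz.mul_left ‖f‖).tsum_add (hs1.mul_left ‖f‖⁻¹), tsum_mul_left, tsum_mul_left]
  have : ‖f‖⁻¹ * ∑' k : ℤ, ‖cf f k‖ ^ 2 ≤ ‖f‖⁻¹ * ‖f‖ ^ 2 := by gcongr
  have e : ‖f‖⁻¹ * ‖f‖ ^ 2 = ‖f‖ := by field_simp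
  rw [e] at this
  linarith

lemma cf_syn_inv_mul (f : CT) : cf (syn fun k : ℤ => (Complex.I * (k : ℂ))⁻¹ * cf f k) =
    fun k : ℤ => (Complex.I * (k : ℂ))⁻¹ * cf f k := cf_syn (sum_inv_mul_cf_le f).1.of_norm

/-- The primitive of `f` minus its mean: the multiplier `1 / (ik)`, with value `0` at `k = 0`. -/
def prim : CT →L[ℂ] CT :=
  LinearMap.mkContinuous
    { toFun := fun f => syn fun k : ℤ => (Complex.I * (k : ℂ))⁻¹ * cf f k
      map_add' := fun f g => cf_injective (by
        ext k
        rw [cf_syn_inv_mul, cf_add, cf_add, Pi.add_apply, cf_syn_inv_mul,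
          cf_syn_inv_mul, ← mul_add]
        rfl)
      map_smul' := fun c f => cf_injective (by
        ext k
        rw [RingHom.id_apply, cf_syn_inv_mul, cf_smul, cf_smul, Pi.smul_apply,
          cf_syn_inv_mul, smul_eq_mul, mul_left_comm]
        rfl) }
    (∑' k : ℤ, ‖(Complex.I * (k : ℂ))⁻¹‖ ^ 2 + 1) (fun f => by
      change ‖syn fun k : ℤ => (Complex.I * (k : ℂ))⁻¹ * cf f k‖ ≤ _
      refine (norm_le_tsum_cf ?_).trans ?_
      · rw [cf_syn_inv_mul]; exact (sum_inv_mul_cf_le f).1.of_norm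
      · rw [cf_syn_inv_mul]; exact (sum_inv_mul_cf_le f).2)

lemma cf_prim (f : CT) (k : ℤ) : cf (prim f) k = (Complex.I * (k : ℂ))⁻¹ * cf f k :=
  congrFun (cf_syn_inv_mul f) k

lemma isDeriv_prim (f : CT) : IsDeriv (prim f) (f - algebraMap ℂ CT (cf f 0)) := fun k => by
  rw [cf_prim, cf_sub, Algebra.algebraMap_eq_smul_one, cf_smul]
  simp only [Pi.sub_apply, Pi.smul_apply, cf_one, smul_eq_mul]
  by_cases h : k = 0
  · subst h; simp
  · have : (k : ℂ) ≠ 0 := by exact_mod_cast h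
    simp only [h, if_false]
    field_simp
    simp

lemma prim_of_isDeriv {f f' : CT} (h : IsDeriv f f') :
    prim f' = f - algebraMap ℂ CT (cf f 0) := by
  apply cf_injective
  ext k
  rw [cf_prim, h, cf_sub, Algebra.algebraMap_eq_smul_one, cf_smul]
  simp only [Pi.sub_apply, Pi.smul_apply, cf_one, smul_eq_mul]
  by_cases h : k = 0
  · subst h; simp
  · have : (k : ℂ) ≠ 0 := by exact_mod_cast h
    simp only [h, if_false]
    field_simp
    simp

/-! ### Families bounded in a Sobolev norm -/

/-- The family `f` is bounded in the Sobolev norm of order `r`. -/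
def UB {ι : Type*} (r : ℝ) (f : ι → CT) : Prop := ∃ C : ℝ≥0∞, C ≠ ⊤ ∧ ∀ i, sq r (cf (f i)) ≤ C

section UB

variable {ι : Type*} {r q : ℝ} {f g : ι → CT}

lemma UB.mono (h : UB r f) (hq : q ≤ r) : UB q f := by
  obtain ⟨C, hC, h⟩ := h
  exact ⟨C, hC, fun i => (sq_mono hq _).trans (h i)⟩

lemma UB.add (hf : UB r f) (hg : UB r g) : UB r (fun i => f i + g i) := by
  obtain ⟨C, hC, hf⟩ := hf
  obtain ⟨D, hD, hg⟩ := hg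
  refine ⟨3 * (C + D), by finiteness, fun i => ?_⟩
  rw [cf_add]
  refine (sq_add_le r _ _).trans ?_
  gcongr
  exacts [hf i, hg i]

lemma UB.smul (hf : UB r f) (c : ℂ) : UB r (fun i => c • f i) := by
  obtain ⟨C, hC, hf⟩ := hf
  refine ⟨‖c‖ₑ ^ 2 * C, by finiteness, fun i => ?_⟩
  rw [cf_smul, sq_smul]
  gcongr
  exact hf i

lemma UB.neg (hf : UB r f) : UB r (fun i => -f i) := by
  have := hf.smul (-1)
  simpa using this

lemma UB.sub (hf : UB r f) (hg : UB r g) : UB r (fun i => f i - g i) := by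
  simpa [sub_eq_add_neg] using hf.add hg.neg

lemma sq_cf_one (r : ℝ) : sq r (cf 1) = 1 := by
  unfold sq
  rw [tsum_eq_single 0]
  · simp [cf_one, wt, bracket]
  · intro k hk; simp [cf_one, hk]

lemma UB.scalar {c : ι → ℂ} {M : ℝ} (hc : ∀ i, ‖c i‖ ≤ M) :
    UB r (fun i => algebraMap ℂ CT (c i)) := by
  refine ⟨ENNReal.ofReal M ^ 2, by finiteness, fun i => ?_⟩
  have e : (algebraMap ℂ CT) (c i) = c i • (1 : CT) := Algebra.algebraMap_eq_smul_one _
  simp only [e]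
  rw [cf_smul, sq_smul, sq_cf_one, mul_one]
  gcongr
  rw [← ofReal_norm]
  exact ENNReal.ofReal_le_ofReal (hc i)

lemma UB.mul (hr : 1 / 2 < r) (hf : UB r f) (hg : UB r g) : UB r (fun i => f i * g i) := by
  obtain ⟨C, hC, hf⟩ := hf
  obtain ⟨D, hD, hg⟩ := hg
  have hA := algConst_ne_top hr
  refine ⟨algConst r * C * D, by finiteness, fun i => ?_⟩
  refine (sq_conv_le_mul (by linarith) (enorm_cf_mul_le (f i) (g i))).trans ?_
  gcongr
  exacts [hf i, hg i]

lemma sq_star (r : ℝ) (f : CT) : sq r (cf (star f)) = sq r (cf f) := by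
  unfold sq
  rw [← (Equiv.neg ℤ).tsum_eq]
  congr 1; ext k
  simp [cf_star, wt_neg, enorm_eq_nnnorm]

lemma UB.star (hf : UB r f) : UB r (fun i => star (f i)) := by
  obtain ⟨C, hC, hf⟩ := hf
  exact ⟨C, hC, fun i => (sq_star r _).trans_le (hf i)⟩

lemma UB.norm_le (hr : 1 / 2 < r) (hf : UB r f) : ∃ M : ℝ, 0 ≤ M ∧ ∀ i, ‖f i‖ ≤ M := by
  obtain ⟨C, hC, hf⟩ := hf
  have hw := tsum_wt_ne_top (p := -2 * r) (by linarith)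
  set D := 2 * (∑' k, wt (-2 * r) k) * C
  have hD : D ≠ ⊤ := by finiteness
  refine ⟨(D + 1).toReal, ENNReal.toReal_nonneg, fun i => ?_⟩
  have h1 : ‖f i‖ₑ ^ 2 ≤ D :=
    ((pow_le_pow_left' (enorm_le_tsum_cf (f i)) 2).trans (tsum_enorm_sq_le (r := r) _)).trans
      (by unfold D; gcongr; exact hf i)
  -- From `x² ≤ D` follows `x ≤ D + 1` without a square root.
  have h2 : ‖f i‖ₑ ≤ D + 1 := by
    rcases le_total ‖f i‖ₑ 1 with h | h
    · exact h.trans le_add_self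
    · exact ((le_self_pow₀ h two_ne_zero).trans h1).trans le_self_add
  have := ENNReal.toReal_mono (by finiteness) h2
  simpa using this

lemma sq_pow_le (hr : 0 ≤ r) (f : CT) (n : ℕ) :
    sq r (cf (f ^ n)) ≤ (algConst r * sq r (cf f)) ^ n := by
  induction n with
  | zero => simp [sq_cf_one]
  | succ n ih =>
    rw [pow_succ, pow_succ]
    refine (sq_conv_le_mul hr (enorm_cf_mul_le (f ^ n) f)).trans ?_
    calc _ = sq r (cf (f ^ n)) * (algConst r * sq r (cf f)) := by ring
      _ ≤ _ := by gcongr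

lemma tsum_factorial_inv_mul_pow_ne_top {c : ℝ≥0∞} (hc : c ≠ ⊤) :
    ∑' n : ℕ, ENNReal.ofReal ((n.factorial : ℝ)⁻¹) * c ^ n ≠ ⊤ := by
  lift c to NNReal using hc
  have h := (Real.summable_pow_div_factorial (c : ℝ)).tsum_ofReal_ne_top
  convert h using 3 with n
  rw [div_eq_inv_mul, ENNReal.ofReal_mul (by positivity), ENNReal.ofReal_pow (by positivity),
    ENNReal.ofReal_coe_nnreal]

/-- Cauchy-Schwarz with weights `1/n!` moves the square onto each power of `f`; the `n`-th power
costs a geometric factor by the algebra property, and the factorials keep the series finite. -/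
lemma sq_exp_le (hr : 0 ≤ r) (f : CT) :
    sq r (cf (NormedSpace.exp f)) ≤ 2 * (∑' n : ℕ, ENNReal.ofReal ((n.factorial : ℝ)⁻¹)) *
      ∑' n : ℕ, ENNReal.ofReal ((n.factorial : ℝ)⁻¹) * (algConst r * sq r (cf f)) ^ n := by
  set a : ℕ → ℝ≥0∞ := fun n => ENNReal.ofReal ((n.factorial : ℝ)⁻¹)
  have h1 : ∀ k, ‖cf (NormedSpace.exp f) k‖ₑ ≤ ∑' n, a n * ‖cf (f ^ n) k‖ₑ := fun k => by
    have h := (coef k).hasSum (hasSum_exp_CT f)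
    change ‖coef k _‖ₑ ≤ _
    rw [← h.tsum_eq]
    refine enorm_tsum_le_tsum_enorm.trans (le_of_eq ?_)
    congr 1; ext n
    rw [map_smul, smul_eq_mul, enorm_mul]
    congr 1
    rw [← ofReal_norm]
    simp [a]
  calc sq r (cf (NormedSpace.exp f))
      ≤ ∑' k, wt r k ^ 2 * (2 * (∑' n, a n) * ∑' n, a n * ‖cf (f ^ n) k‖ₑ ^ 2) := by
        refine ENNReal.tsum_le_tsum fun k => ?_
        rw [mul_pow]
        gcongr
        exact (pow_le_pow_left' (h1 k) 2).trans (tsum_mul_sq_le _ _)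
    _ = 2 * (∑' n, a n) * ∑' n, a n * sq r (cf (f ^ n)) := by
        unfold sq
        simp_rw [← ENNReal.tsum_mul_left]
        rw [ENNReal.tsum_comm]
        congr 1; ext n; congr 1; ext k
        ring
    _ ≤ _ := by
        gcongr with n
        exact sq_pow_le hr f n

lemma UB.exp (hr : 1 / 2 < r) (hf : UB r f) : UB r (fun i => NormedSpace.exp (f i)) := by
  obtain ⟨C, hC, hf⟩ := hf
  have hA := algConst_ne_top hr
  have h1 := tsum_factorial_inv_mul_pow_ne_top (c := 1) (by finiteness)
  simp only [one_pow, mul_one] at h1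
  have h2 := tsum_factorial_inv_mul_pow_ne_top (c := algConst r * C) (by finiteness)
  refine ⟨_, ENNReal.mul_ne_top (ENNReal.mul_ne_top (a := 2) (by simp) h1) h2, fun i => ?_⟩
  refine (sq_exp_le (by linarith) (f i)).trans ?_
  gcongr
  exact hf i

lemma enorm_I_mul_intCast_le_wt (k : ℤ) : ‖Complex.I * (k : ℂ)‖ₑ ≤ wt 1 k := by
  rw [← ofReal_norm, wt, Real.rpow_one]
  refine ENNReal.ofReal_le_ofReal ?_
  simpa using abs_le_bracket k

lemma UB.isDeriv {f' : ι → CT} (hf : UB (r + 1) f) (h : ∀ i, IsDeriv (f i) (f' i)) : UB r f' := by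
  obtain ⟨C, hC, hf⟩ := hf
  refine ⟨C, hC, fun i => le_trans ?_ (hf i)⟩
  refine ENNReal.tsum_le_tsum fun k => pow_le_pow_left' ?_ 2
  rw [h i k, enorm_mul, ← mul_assoc, wt_add]
  gcongr
  exact enorm_I_mul_intCast_le_wt k

lemma wt_one_mul_enorm_inv_le (k : ℤ) : wt 1 k * ‖(Complex.I * (k : ℂ))⁻¹‖ₑ ≤ 2 := by
  rw [← ofReal_norm, wt, Real.rpow_one, ← ENNReal.ofReal_mul (bracket_pos k).le]
  rw [show (2 : ℝ≥0∞) = ENNReal.ofReal 2 by simp]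
  refine ENNReal.ofReal_le_ofReal ?_
  by_cases hk : k = 0
  · simp [hk]
  · have h1 : (1 : ℝ) ≤ |(k : ℝ)| := by exact_mod_cast Int.one_le_abs hk
    have h2 : bracket k ≤ 2 * |(k : ℝ)| := by
      rw [bracket]
      apply Real.sqrt_le_iff.mpr ⟨by positivity, ?_⟩
      have := sq_abs (k : ℝ)
      nlinarith
    rw [norm_inv, norm_mul, Complex.norm_I, one_mul, Complex.norm_intCast, ← div_eq_mul_inv,
      div_le_iff₀ (by linarith)]
    exact h2

lemma UB.prim (hf : UB r f) : UB (r + 1) (fun i => prim (f i)) := by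
  obtain ⟨C, hC, hf⟩ := hf
  refine ⟨2 ^ 2 * C, by finiteness, fun i => ?_⟩
  refine le_trans ?_ (mul_le_mul_right (hf i) _)
  unfold sq
  rw [← ENNReal.tsum_mul_left]
  refine ENNReal.tsum_le_tsum fun k => ?_
  rw [← mul_pow, cf_prim, enorm_mul, wt_add]
  refine pow_le_pow_left' ?_ 2
  calc _ = (wt 1 k * ‖(Complex.I * (k : ℂ))⁻¹‖ₑ) * (wt r k * ‖cf (f i) k‖ₑ) := by ring
    _ ≤ _ := by
      gcongr
      exact wt_one_mul_enorm_inv_le k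

/-- `prim (h ∂y)` loses no derivative on `y`. -/
lemma UB.prim_mul_deriv {h h' y y' : ι → CT} (hr : 1 / 2 < r) (hh : UB (r + 1) h)
    (hy : UB r y) (hd : ∀ i, IsDeriv (h i) (h' i)) (hyd : ∀ i, IsDeriv (y i) (y' i)) :
    UB r (fun i => TorusNLS.prim (h i * y' i)) := by
  have hhy := (hh.mono (by linarith)).mul hr hy
  -- Integration by parts, `h y' = (h y)' - h' y`; the primitive of the exact term is `h y` minus
  -- its mean.
  have key : ∀ i, TorusNLS.prim (h i * y' i) = h i * y i - algebraMap ℂ CT (cf (h i * y i) 0)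
      - TorusNLS.prim (h' i * y i) := fun i => by
    have := prim_of_isDeriv ((hd i).mul (hyd i))
    rw [map_add] at this
    rw [← this]; ring
  simp_rw [key]
  obtain ⟨M, -, hM⟩ := hhy.norm_le hr
  refine (hhy.sub (UB.scalar (M := M) fun i => (norm_cf_le _ _).trans (hM i))).sub ?_
  exact (((hh.isDeriv hd).mul hr hy).prim).mono (by linarith)

end UB

/-! ### Polynomials in `u`, `∂ₓu` and their conjugates -/

/-- The four arguments `v, v₁, v̄, v̄₁` of the nonlinearity. -/
def jet (v v1 : CT) : Fin 4 → CT := ![v, v1, star v, star v1]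

/-- The value of a polynomial at `(v, v₁, v̄, v̄₁)`. -/
def ev (P : MvPolynomial (Fin 4) ℂ) (v v1 : CT) : CT := MvPolynomial.aeval (jet v v1) P

/-- The derivative of `ev P` at `(v, v₁)` in the direction `(z, z₁)`. -/
def dev (P : MvPolynomial (Fin 4) ℂ) (v v1 z z1 : CT) : CT :=
  ∑ i, ev (MvPolynomial.pderiv i P) v v1 * jet z z1 i

lemma ev_C (c : ℂ) (v v1 : CT) : ev (MvPolynomial.C c) v v1 = algebraMap ℂ CT c := by simp [ev]

lemma ev_add (P Q : MvPolynomial (Fin 4) ℂ) (v v1 : CT) :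
    ev (P + Q) v v1 = ev P v v1 + ev Q v v1 := by simp [ev]

lemma ev_mul_X (P : MvPolynomial (Fin 4) ℂ) (n : Fin 4) (v v1 : CT) :
    ev (P * MvPolynomial.X n) v v1 = ev P v v1 * jet v v1 n := by simp [ev]

lemma ev_apply (P : MvPolynomial (Fin 4) ℂ) (v v1 : CT) (x : Torus) :
    ev P v v1 x = nonlin P (v x) (v1 x) := by
  induction P using MvPolynomial.induction_on with
  | C a => simp [ev_C, nonlin]
  | add p q hp hq => rw [ev_add, ContinuousMap.add_apply, hp, hq]; simp [nonlin]
  | mul_X p n hp =>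
    rw [ev_mul_X, ContinuousMap.mul_apply, hp]
    simp only [nonlin, map_mul, MvPolynomial.eval_X]
    congr 1
    fin_cases n <;> simp [jet]

lemma dev_C (c : ℂ) (v v1 z z1 : CT) : dev (MvPolynomial.C c) v v1 z z1 = 0 := by
  simp [dev, ev]

lemma dev_add (P Q : MvPolynomial (Fin 4) ℂ) (v v1 z z1 : CT) :
    dev (P + Q) v v1 z z1 = dev P v v1 z z1 + dev Q v v1 z z1 := by
  simp [dev, ev, add_mul, Finset.sum_add_distrib]

lemma dev_mul_X (P : MvPolynomial (Fin 4) ℂ) (n : Fin 4) (v v1 z z1 : CT) :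
    dev (P * MvPolynomial.X n) v v1 z z1 =
      dev P v v1 z z1 * jet v v1 n + ev P v v1 * jet z z1 n := by
  have h : ∀ i, ev (MvPolynomial.pderiv i (P * MvPolynomial.X n)) v v1 * jet z z1 i =
      ev (MvPolynomial.pderiv i P) v v1 * jet z z1 i * jet v v1 n
        + if i = n then ev P v v1 * jet z z1 n else 0 := fun i => by
    rw [Derivation.leibniz, MvPolynomial.pderiv_X]
    by_cases hi : i = n
    · subst hi
      simp only [ev, Pi.single_eq_same, smul_eq_mul, mul_one, map_add, map_mul,
        MvPolynomial.aeval_X, if_true]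
      ring
    · simp only [ev, Pi.single_eq_of_ne (Ne.symm hi), smul_eq_mul, map_add, map_mul,
        MvPolynomial.aeval_X, if_neg hi, mul_zero, map_zero]
      ring
  unfold dev
  simp_rw [h, Finset.sum_add_distrib, Finset.sum_mul]
  simp

lemma isDeriv_jet {v v1 z z1 : CT} (h : IsDeriv v z) (h1 : IsDeriv v1 z1) (i : Fin 4) :
    IsDeriv (jet v v1 i) (jet z z1 i) := by
  fin_cases i
  exacts [h, h1, h.star, h1.star]

lemma isDeriv_ev (P : MvPolynomial (Fin 4) ℂ) {v v1 z z1 : CT} (h : IsDeriv v z)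
    (h1 : IsDeriv v1 z1) : IsDeriv (ev P v v1) (dev P v v1 z z1) := by
  induction P using MvPolynomial.induction_on with
  | C a => rw [ev_C, dev_C]; exact isDeriv_const a
  | add p q hp hq => rw [ev_add, dev_add]; exact hp.add hq
  | mul_X p n hp => rw [ev_mul_X, dev_mul_X]; exact hp.mul (isDeriv_jet h h1 n)

/-- The form of the derivative isolates the terms linear in the new derivative `v3` in the last
summand; the sum is quadratic in `(v1, v2)` and is the expression called `hess` below. -/
lemma isDeriv_dev (P : MvPolynomial (Fin 4) ℂ) {v v1 v2 v3 : CT} (h : IsDeriv v v1)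
    (h1 : IsDeriv v1 v2) (h2 : IsDeriv v2 v3) :
    IsDeriv (dev P v v1 v1 v2)
      (∑ i, dev (MvPolynomial.pderiv i P) v v1 v1 v2 * jet v1 v2 i + dev P v v1 v2 v3) := by
  have key : ∀ s : Finset (Fin 4),
      IsDeriv (∑ i ∈ s, ev (MvPolynomial.pderiv i P) v v1 * jet v1 v2 i)
        (∑ i ∈ s, (dev (MvPolynomial.pderiv i P) v v1 v1 v2 * jet v1 v2 i
          + ev (MvPolynomial.pderiv i P) v v1 * jet v2 v3 i)) := by
    intro s
    induction s using Finset.induction_on with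
    | empty => simpa using isDeriv_const 0
    | insert a s ha ih =>
      rw [Finset.sum_insert ha, Finset.sum_insert ha]
      exact ((isDeriv_ev _ h h1).mul (isDeriv_jet h1 h2 a)).add ih
  have := key Finset.univ
  rw [Finset.sum_add_distrib] at this
  exact this

lemma HasDerivAt.jet {v v1 : ℝ → CT} {z z1 : CT} {t : ℝ} (h : HasDerivAt v z t)
    (h1 : HasDerivAt v1 z1 t) (i : Fin 4) :
    HasDerivAt (fun t => jet (v t) (v1 t) i) (TorusNLS.jet z z1 i) t := by
  fin_cases i
  exacts [h, h1, h.star, h1.star]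

lemma HasDerivAt.ev (P : MvPolynomial (Fin 4) ℂ) {v v1 : ℝ → CT} {z z1 : CT} {t : ℝ}
    (h : HasDerivAt v z t) (h1 : HasDerivAt v1 z1 t) :
    HasDerivAt (fun t => ev P (v t) (v1 t)) (dev P (v t) (v1 t) z z1) t := by
  induction P using MvPolynomial.induction_on with
  | C a => simp_rw [ev_C, dev_C]; exact hasDerivAt_const _ _
  | add p q hp hq => simp_rw [ev_add, dev_add]; exact hp.add hq
  | mul_X p n hp => simp_rw [ev_mul_X, dev_mul_X]; exact hp.mul (HasDerivAt.jet h h1 n)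

lemma UB.jet {ι : Type*} {r : ℝ} {v v1 : ι → CT} (h : UB r v) (h1 : UB r v1) (n : Fin 4) :
    UB r (fun i => jet (v i) (v1 i) n) := by
  fin_cases n
  exacts [h, h1, h.star, h1.star]

lemma UB.ev {ι : Type*} {r : ℝ} (hr : 1 / 2 < r) (P : MvPolynomial (Fin 4) ℂ) {v v1 : ι → CT}
    (h : UB r v) (h1 : UB r v1) : UB r (fun i => ev P (v i) (v1 i)) := by
  induction P using MvPolynomial.induction_on with
  | C a => simp_rw [ev_C]; exact UB.scalar (M := ‖a‖) fun _ => le_rfl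
  | add p q hp hq => simp_rw [ev_add]; exact hp.add hq
  | mul_X p n hp => simp_rw [ev_mul_X]; exact hp.mul hr (h.jet h1 n)

lemma UB.finset_sum {ι κ : Type*} {r : ℝ} (s : Finset κ) {f : κ → ι → CT} (h : ∀ j, UB r (f j)) :
    UB r (fun i => ∑ j ∈ s, f j i) := by
  classical
  induction s using Finset.induction_on with
  | empty => simpa using UB.scalar (ι := ι) (r := r) (c := fun _ => 0) (M := 0) (by simp)
  | insert a s ha ih => simp_rw [Finset.sum_insert ha]; exact (h a).add ih

lemma UB.dev {ι : Type*} {r : ℝ} (hr : 1 / 2 < r) (P : MvPolynomial (Fin 4) ℂ)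
    {v v1 z z1 : ι → CT} (h : UB r v) (h1 : UB r v1) (hz : UB r z) (hz1 : UB r z1) :
    UB r (fun i => dev P (v i) (v1 i) (z i) (z1 i)) :=
  UB.finset_sum _ fun n => (UB.ev hr _ h h1).mul hr (hz.jet hz1 n)

/-- This carries uniform convergence of the truncations over to the nonlinearity. The constants
involve `|M|` because they must be nonnegative whatever the sign of `M`. -/
lemma ev_lipschitz (P : MvPolynomial (Fin 4) ℂ) (M : ℝ) : ∃ B L : ℝ, 0 ≤ B ∧ 0 ≤ L ∧
    ∀ v v1 w w1 : CT, ‖v‖ ≤ M → ‖v1‖ ≤ M → ‖w‖ ≤ M → ‖w1‖ ≤ M →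
      ‖ev P v v1‖ ≤ B ∧ ‖ev P v v1 - ev P w w1‖ ≤ L * (‖v - w‖ + ‖v1 - w1‖) := by
  induction P using MvPolynomial.induction_on with
  | C a => exact ⟨‖algebraMap ℂ CT a‖, 0, norm_nonneg _, le_rfl, by simp [ev_C]⟩
  | add p q hp hq =>
    obtain ⟨B, L, hB, hL, h⟩ := hp
    obtain ⟨B', L', hB', hL', h'⟩ := hq
    refine ⟨B + B', L + L', by positivity, by positivity, fun v v1 w w1 a1 a2 a3 a4 => ?_⟩
    obtain ⟨x1, x2⟩ := h v v1 w w1 a1 a2 a3 a4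
    obtain ⟨y1, y2⟩ := h' v v1 w w1 a1 a2 a3 a4
    rw [ev_add, ev_add]
    refine ⟨(norm_add_le _ _).trans (by linarith), ?_⟩
    rw [add_sub_add_comm]
    exact (norm_add_le _ _).trans (by linarith)
  | mul_X p n hp =>
    obtain ⟨B, L, hB, hL, h⟩ := hp
    refine ⟨B * |M|, L * |M| + B, by positivity, by positivity, fun v v1 w w1 a1 a2 a3 a4 => ?_⟩
    obtain ⟨x1, x2⟩ := h v v1 w w1 a1 a2 a3 a4
    obtain ⟨z1, -⟩ := h w w1 w w1 a3 a4 a3 a4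
    have hj : ‖jet v v1 n‖ ≤ |M| := by
      fin_cases n <;> simp only [jet] <;> simp <;> exact le_trans (by assumption) (le_abs_self M)
    have hj2 : ‖jet v v1 n - jet w w1 n‖ ≤ ‖v - w‖ + ‖v1 - w1‖ := by
      have h1 := norm_nonneg (v - w)
      have h2 := norm_nonneg (v1 - w1)
      fin_cases n <;> simp only [jet] <;> simp [← star_sub]
    rw [ev_mul_X, ev_mul_X]
    refine ⟨(norm_mul_le _ _).trans (by gcongr), ?_⟩
    rw [show ev p v v1 * jet v v1 n - ev p w w1 * jet w w1 n =
      (ev p v v1 - ev p w w1) * jet v v1 n + ev p w w1 * (jet v v1 n - jet w w1 n) by ring]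
    calc _ ≤ ‖ev p v v1 - ev p w w1‖ * ‖jet v v1 n‖
            + ‖ev p w w1‖ * ‖jet v v1 n - jet w w1 n‖ :=
          (norm_add_le _ _).trans (add_le_add (norm_mul_le _ _) (norm_mul_le _ _))
      _ ≤ L * (‖v - w‖ + ‖v1 - w1‖) * |M| + B * (‖v - w‖ + ‖v1 - w1‖) := by
          gcongr
      _ = _ := by ring

/-! ### The normal form and the gauge transformation -/

/-- The normal form variable `v₂ + (i/2) F(v, v₁, v̄, v̄₁)`. -/
def normalForm (F : MvPolynomial (Fin 4) ℂ) (v v1 v2 : CT) : CT :=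
  v2 + (Complex.I / 2) • ev F v v1

/-- The gauge factor `exp ((i/2) ∂⁻¹ F_β)`. -/
def gauge (F : MvPolynomial (Fin 4) ℂ) (v v1 : CT) : CT :=
  NormedSpace.exp ((Complex.I / 2) • prim (ev (MvPolynomial.pderiv 1 F) v v1))

/-- The mean of `F_β`. -/
def betaMean (F : MvPolynomial (Fin 4) ℂ) (v v1 : CT) : ℂ :=
  cf (ev (MvPolynomial.pderiv 1 F) v v1) 0

/-- The second order part of the second derivative of `F(v, v₁, v̄, v̄₁)`. -/
def hess (F : MvPolynomial (Fin 4) ℂ) (v v1 v2 : CT) : CT :=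
  ∑ i, dev (MvPolynomial.pderiv i F) v v1 v1 v2 * jet v1 v2 i

/-- The remainder in the equation of the normal form variable. -/
def remainderNF (F : MvPolynomial (Fin 4) ℂ) (v v1 v2 f f1 : CT) : CT :=
  ev (MvPolynomial.pderiv 0 F) v v1 * v2 + (1 / 2 : ℂ) • hess F v v1 v2
    + (Complex.I / 2) • dev F v v1 f f1
    - (Complex.I / 2) • (ev (MvPolynomial.pderiv 1 F) v v1 * dev F v v1 v1 v2)

/-- The potential created by the gauge transformation. -/
def remainderGauge (F : MvPolynomial (Fin 4) ℂ) (ε : ℝ) (v v1 v2 v3 f f1 : CT) : CT :=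
  ((ε : ℂ) * (Complex.I / 2)) • prim (dev (MvPolynomial.pderiv 1 F) v v1
      ((ε : ℂ) • (f - Complex.I • v2)) ((ε : ℂ) • (f1 - Complex.I • v3)))
    - (1 / 2 : ℂ) • dev (MvPolynomial.pderiv 1 F) v v1 v1 v2
    - (Complex.I / 4) • (ev (MvPolynomial.pderiv 1 F) v v1
        - algebraMap ℂ CT (betaMean F v v1)) ^ 2
    - (betaMean F v v1 * (Complex.I / 2)) • (ev (MvPolynomial.pderiv 1 F) v v1
        - algebraMap ℂ CT (betaMean F v v1))

/-- The remainder in the equation of the gauged normal form variable. -/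
def remainder (F : MvPolynomial (Fin 4) ℂ) (ε : ℝ) (v v1 v2 v3 f f1 : CT) : CT :=
  gauge F v v1 * remainderNF F v v1 v2 f f1
    + remainderGauge F ε v v1 v2 v3 f f1 * gauge F v v1 * normalForm F v v1 v2

lemma isDeriv_gauge (F : MvPolynomial (Fin 4) ℂ) (v v1 : CT) :
    IsDeriv (gauge F v v1) ((Complex.I / 2) • (ev (MvPolynomial.pderiv 1 F) v v1
      - algebraMap ℂ CT (betaMean F v v1)) * gauge F v v1) :=
  ((isDeriv_prim _).smul _).exp

lemma hasDerivAt_exp_comp {g : ℝ → CT} {g' : CT} {t : ℝ} (h : HasDerivAt g g' t) :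
    HasDerivAt (fun t => NormedSpace.exp (g t)) (g' * NormedSpace.exp (g t)) t := by
  have h1 := (hasFDerivAt_exp (𝕂 := ℝ) (x := g t)).comp_hasDerivAt t h
  have e : (NormedSpace.exp (g t) • (1 : CT →L[ℝ] CT)) g' = g' * NormedSpace.exp (g t) :=
    mul_comm (NormedSpace.exp (g t)) g'
  rwa [e] at h1

/-- This is `E d'' = (E d)'' - 2 (E' d)' + E'' d` on the Fourier side: in a fixed mode no derivative
of `d` is left, so a bound on `d` in the sup norm is enough. -/
lemma cf_mul_second_deriv {E E1 E2 d d1 d2 : CT}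
    (hE : IsDeriv E E1) (hE1 : IsDeriv E1 E2) (hd : IsDeriv d d1) (hd1 : IsDeriv d1 d2) (k : ℤ) :
    cf (E * d2) k = (Complex.I * k) ^ 2 * cf (E * d) k - 2 * (Complex.I * k) * cf (E1 * d) k
      + cf (E2 * d) k := by
  have h1 := (hE.mul hd) k
  have h2 := (hE.mul hd1) k
  have h3 := (hE1.mul hd) k
  simp only [cf_add, Pi.add_apply] at h1 h2 h3
  linear_combination h2 + (Complex.I * k) * h1 - h3

/-- A factor `i` in the direction comes out as `i` in the slots `α, β` and as `-i` in the conjugate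
slots, hence as `i` times twice the holomorphic part minus the whole. This sign is what lets the
normal form cancel the conjugate third derivative. -/
lemma dev_time (F : MvPolynomial (Fin 4) ℂ) (ε : ℝ) (v v1 v2 v3 f f1 : CT) :
    dev F v v1 ((ε : ℂ) • (f - Complex.I • v2)) ((ε : ℂ) • (f1 - Complex.I • v3)) =
      (ε : ℂ) • (dev F v v1 f f1 - Complex.I • ((2 : ℂ) • (ev (MvPolynomial.pderiv 0 F) v v1 * v2
        + ev (MvPolynomial.pderiv 1 F) v v1 * v3) - dev F v v1 v2 v3)) := by
  ext x
  simp only [dev, jet, Fin.sum_univ_four]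
  simp
  ring

/-- The pointwise algebra behind the equation of `E V`. Here `G = F`, `b = F_β` has mean `b0` and
derivative `b'`, `p` is the primitive of `∂ₜF_β`, `H + D` is `∂ₓ²F` with `D` its part linear in the
top derivatives, `P` is the holomorphic part of `D`, and `Df` is the derivative of `F` along the
forcing. The relation `e² = 1` makes the term in `p` agree on both sides. -/
lemma gauge_identity {e E G v2 v3 v4 f2 b b0 b' H Gx P D Df p : ℂ} (he : e * e = 1) :
    (Complex.I / 2) * p * E * (v2 + Complex.I / 2 * G) +
      E * (e * (f2 - Complex.I * v4) + Complex.I / 2 * (e * (Df - Complex.I * (2 * P - D)))) =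
    e * (-Complex.I * ((Complex.I / 2 * b' * E
              + Complex.I / 2 * (b - b0) * (Complex.I / 2 * (b - b0) * E))
                * (v2 + Complex.I / 2 * G)
            + Complex.I / 2 * (b - b0) * E * (v3 + Complex.I / 2 * Gx)
            + (Complex.I / 2 * (b - b0) * E * (v3 + Complex.I / 2 * Gx)
              + E * (v4 + Complex.I / 2 * (H + D))))
        + b0 * (Complex.I / 2 * (b - b0) * E * (v2 + Complex.I / 2 * G)
            + E * (v3 + Complex.I / 2 * Gx))
        + (E * (P - b * v3 + 1 / 2 * H + Complex.I / 2 * Df - Complex.I / 2 * (b * Gx))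
          + (e * (Complex.I / 2) * p - 1 / 2 * b' - Complex.I / 4 * (b - b0) ^ 2
            - b0 * (Complex.I / 2) * (b - b0)) * E * (v2 + Complex.I / 2 * G))
        + E * (f2 - (H + D))) := by
  linear_combination e * (b' / 2 * E * (v2 + Complex.I / 2 * G)
      + Complex.I / 4 * (b - b0) ^ 2 * E * (v2 + Complex.I / 2 * G)
      + (b - b0) * E * (v3 + Complex.I / 2 * Gx) + E * (H / 2 + D - P)) * Complex.I_sq
    - Complex.I / 2 * p * E * (v2 + Complex.I / 2 * G) * he

/-- The equation of the gauged normal form variable, mode by mode. -/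
lemma hasDerivAt_cf_gauge_mul_normalForm (F : MvPolynomial (Fin 4) ℂ) {ε : ℝ} (hε : ε * ε = 1)
    {u0 u1 u2 : ℝ → CT} {t : ℝ} {v3 v4 f f1 f2 : CT}
    (h0 : HasDerivAt u0 ((ε : ℂ) • (f - Complex.I • u2 t)) t)
    (h1 : HasDerivAt u1 ((ε : ℂ) • (f1 - Complex.I • v3)) t)
    (h2 : HasDerivAt u2 ((ε : ℂ) • (f2 - Complex.I • v4)) t)
    (d0 : IsDeriv (u0 t) (u1 t)) (d1 : IsDeriv (u1 t) (u2 t)) (d2 : IsDeriv (u2 t) v3)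
    (d3 : IsDeriv v3 v4) (k : ℤ) :
    HasDerivAt (fun t => cf (gauge F (u0 t) (u1 t) * normalForm F (u0 t) (u1 t) (u2 t)) k)
      ((ε : ℂ) * (((Complex.I * (k : ℂ) ^ 2 + Complex.I * k * betaMean F (u0 t) (u1 t)) *
          cf (gauge F (u0 t) (u1 t) * normalForm F (u0 t) (u1 t) (u2 t)) k)
        + cf (remainder F ε (u0 t) (u1 t) (u2 t) v3 f f1) k
        + cf (gauge F (u0 t) (u1 t) *
          (f2 - (hess F (u0 t) (u1 t) (u2 t) + dev F (u0 t) (u1 t) (u2 t) v3))) k)) t := by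
  set v := u0 t with hv
  set v1 := u1 t with hv1
  set v2 := u2 t with hv2
  set b0 := betaMean F v v1 with hb0
  set E := gauge F v v1 with hE
  set b := ev (MvPolynomial.pderiv 1 F) v v1 with hb
  set b' := dev (MvPolynomial.pderiv 1 F) v v1 v1 v2 with hb'
  set bt := dev (MvPolynomial.pderiv 1 F) v v1 ((ε : ℂ) • (f - Complex.I • v2))
    ((ε : ℂ) • (f1 - Complex.I • v3)) with hbt
  set G := ev F v v1 with hG
  set H := hess F v v1 v2 with hH
  have hEt : HasDerivAt (fun t => gauge F (u0 t) (u1 t)) ((Complex.I / 2) • prim bt * E) t :=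
    hasDerivAt_exp_comp (((prim.restrictScalars ℝ).hasFDerivAt.comp_hasDerivAt t
      (HasDerivAt.ev (MvPolynomial.pderiv 1 F) h0 h1)).const_smul (Complex.I / 2))
  have hVt : HasDerivAt (fun t => normalForm F (u0 t) (u1 t) (u2 t))
      ((ε : ℂ) • (f2 - Complex.I • v4) + (Complex.I / 2) • dev F v v1
        ((ε : ℂ) • (f - Complex.I • v2)) ((ε : ℂ) • (f1 - Complex.I • v3))) t :=
    h2.add ((HasDerivAt.ev F h0 h1).const_smul (Complex.I / 2))
  have hWt := ((coef k).restrictScalars ℝ).hasFDerivAt.comp_hasDerivAt t (hEt.mul hVt)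
  have hE1 : IsDeriv E ((Complex.I / 2) • (b - algebraMap ℂ CT b0) * E) := isDeriv_gauge F v v1
  have hE2 := (((isDeriv_ev (MvPolynomial.pderiv 1 F) d0 d1).sub
    (isDeriv_const b0)).smul (Complex.I / 2)).mul hE1
  have hV1 : IsDeriv (normalForm F v v1 v2) (v3 + (Complex.I / 2) • dev F v v1 v1 v2) :=
    d2.add ((isDeriv_ev F d0 d1).smul _)
  have hV2 := d3.add ((isDeriv_dev F d0 d1 d2).smul (Complex.I / 2))
  have hW1 := hE1.mul hV1
  have hW2 := (hE2.mul hV1).add (hE1.mul hV2)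
  set W1 := (Complex.I / 2) • (b - algebraMap ℂ CT b0) * E * normalForm F v v1 v2
    + E * (v3 + (Complex.I / 2) • dev F v v1 v1 v2) with hW1def
  -- The time derivative of `E V` with `-i ∂ₓ²` and `b0 ∂ₓ` of `E V` made explicit. The forcing `f2`
  -- need not equal `∂ₓ²F`, so their difference stays as a separate last term.
  have key : (Complex.I / 2) • prim bt * E * normalForm F v v1 v2 +
      E * ((ε : ℂ) • (f2 - Complex.I • v4) + (Complex.I / 2) • dev F v v1
        ((ε : ℂ) • (f - Complex.I • v2)) ((ε : ℂ) • (f1 - Complex.I • v3))) =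
      (ε : ℂ) • ((-Complex.I) • (((Complex.I / 2) • (b' - 0) * E + (Complex.I / 2) •
          (b - algebraMap ℂ CT b0) * ((Complex.I / 2) • (b - algebraMap ℂ CT b0) * E))
            * normalForm F v v1 v2
          + (Complex.I / 2) • (b - algebraMap ℂ CT b0) * E
            * (v3 + (Complex.I / 2) • dev F v v1 v1 v2)
          + ((Complex.I / 2) • (b - algebraMap ℂ CT b0) * E
            * (v3 + (Complex.I / 2) • dev F v v1 v1 v2)
            + E * (v4 + (Complex.I / 2) • (H + dev F v v1 v2 v3))))
        + b0 • W1 + remainder F ε v v1 v2 v3 f f1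
        + E * (f2 - (H + dev F v v1 v2 v3))) := by
    have he : (ε : ℂ) * ε = 1 := by exact_mod_cast hε
    rw [dev_time]
    unfold remainder remainderNF remainderGauge normalForm
    rw [← hbt, ← hb', ← hE, ← hH, ← hb, ← hb0]
    ext x
    have hA : (algebraMap ℂ CT b0) x = b0 := by simp [Algebra.algebraMap_eq_smul_one]
    have := gauge_identity (e := ε) (E := E x) (G := G x) (v2 := v2 x) (v3 := v3 x) (v4 := v4 x)
      (f2 := f2 x) (b := b x) (b0 := b0) (b' := b' x) (H := H x) (Gx := dev F v v1 v1 v2 x)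
      (P := ev (MvPolynomial.pderiv 0 F) v v1 x * v2 x + b x * v3 x) (D := dev F v v1 v2 v3 x)
      (Df := dev F v v1 f f1 x) (p := prim bt x) he
    simp only [ContinuousMap.add_apply, ContinuousMap.sub_apply, ContinuousMap.mul_apply,
      ContinuousMap.smul_apply, smul_eq_mul, hA, ContinuousMap.pow_apply,
      ContinuousMap.zero_apply, hW1def, normalForm] at this ⊢
    linear_combination this
  -- Differentiating twice in space amounts to the factor `(ik)²`, which turns `-i ∂ₓ²` into `ik²`.
  have hW2k := hW2 k
  rw [hW1 k] at hW2k
  refine HasDerivAt.congr_deriv hWt ?_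
  change cf _ k = _
  refine (congrArg (fun z => cf z k) key).trans ?_
  rw [cf_smul, cf_add, cf_add, cf_add, cf_smul, cf_smul]
  simp only [Pi.smul_apply, Pi.add_apply, smul_eq_mul]
  have h3 : cf (((Complex.I / 2) • (b' - 0) * E + (Complex.I / 2) •
          (b - algebraMap ℂ CT b0) * ((Complex.I / 2) • (b - algebraMap ℂ CT b0) * E))
            * normalForm F v v1 v2
          + (Complex.I / 2) • (b - algebraMap ℂ CT b0) * E
            * (v3 + (Complex.I / 2) • dev F v v1 v1 v2)
          + ((Complex.I / 2) • (b - algebraMap ℂ CT b0) * E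
            * (v3 + (Complex.I / 2) • dev F v v1 v1 v2)
            + E * (v4 + (Complex.I / 2) • (H + dev F v v1 v2 v3)))) k =
      Complex.I * k * (Complex.I * k * cf (E * normalForm F v v1 v2) k) := hW2k
  rw [h3, hW1 k]
  linear_combination -(ε : ℂ) * Complex.I * (k : ℂ) ^ 2 * cf (E * normalForm F v v1 v2) k *
    Complex.I_sq

/-! ### Uniform bounds for the remainder -/

section Bounds

variable {ι : Type*} {σ : ℝ} (F : MvPolynomial (Fin 4) ℂ)

lemma UB.smul_family {r : ℝ} (hr : 1 / 2 < r) {f : ι → CT} (hf : UB r f) {c : ι → ℂ} {M : ℝ}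
    (hc : ∀ i, ‖c i‖ ≤ M) : UB r (fun i => c i • f i) := by
  simp_rw [Algebra.smul_def]
  exact (UB.scalar hc).mul hr hf

lemma exists_norm_betaMean_le (hσ : 1 / 2 < σ) {v v1 : ι → CT} (h : UB σ v) (h1 : UB σ v1) :
    ∃ M : ℝ, ∀ i, ‖betaMean F (v i) (v1 i)‖ ≤ M := by
  obtain ⟨M, -, hM⟩ := (UB.ev hσ (MvPolynomial.pderiv 1 F) h h1).norm_le hσ
  exact ⟨M, fun i => (norm_cf_le _ _).trans (hM i)⟩

lemma UB.gauge (hσ : 1 / 2 < σ) {v v1 : ι → CT} (h : UB σ v) (h1 : UB σ v1) :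
    UB (σ + 1) (fun i => gauge F (v i) (v1 i)) :=
  UB.exp (by linarith) ((UB.ev hσ (MvPolynomial.pderiv 1 F) h h1).prim.smul _)

lemma UB.normalForm (hσ : 1 / 2 < σ) {v v1 v2 : ι → CT} (h : UB σ v) (h1 : UB σ v1)
    (h2 : UB σ v2) : UB σ (fun i => normalForm F (v i) (v1 i) (v2 i)) :=
  h2.add ((UB.ev hσ F h h1).smul _)

/-- The direction contains `y1 = y'`, which is one derivative worse than `y`; the primitive makes up
for it. In the application `y1` contains the third derivative of the solution. -/
lemma UB.prim_dev (hσ : 1 / 2 < σ) (P : MvPolynomial (Fin 4) ℂ) {v v1 v2 y y1 : ι → CT}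
    (h : UB (σ + 1) v) (h1 : UB (σ + 1) v1) (d0 : ∀ i, IsDeriv (v i) (v1 i))
    (d1 : ∀ i, IsDeriv (v1 i) (v2 i)) (hy : UB σ y) (dy : ∀ i, IsDeriv (y i) (y1 i)) :
    UB σ (fun i => TorusNLS.prim (TorusNLS.dev P (v i) (v1 i) (y i) (y1 i))) := by
  have hev : ∀ n, UB (σ + 1) (fun i => TorusNLS.ev (MvPolynomial.pderiv n P) (v i) (v1 i)) :=
    fun n => UB.ev (by linarith) _ h h1
  have hdev : ∀ n i, IsDeriv (TorusNLS.ev (MvPolynomial.pderiv n P) (v i) (v1 i)) _ :=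
    fun n i => isDeriv_ev (MvPolynomial.pderiv n P) (d0 i) (d1 i)
  unfold TorusNLS.dev
  simp_rw [map_sum]
  refine UB.finset_sum _ fun n => ?_
  -- The slots `α` and `ᾱ` contain only `y`; the slots `β` and `β̄` contain `y'` and need the
  -- integration by parts.
  fin_cases n
  · exact ((((hev 0).mono (by linarith)).mul hσ hy).prim).mono (by linarith)
  · exact UB.prim_mul_deriv hσ (hev 1) hy (hdev 1) dy
  · exact ((((hev 2).mono (by linarith)).mul hσ hy.star).prim).mono (by linarith)
  · exact UB.prim_mul_deriv hσ (hev 3) hy.star (hdev 3) fun i => (dy i).star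

/-- The third derivative `v3` enters only under the primitive in `remainderGauge`, where
`UB.prim_dev` applies. All other terms are products of functions bounded in the algebra `H^σ`. -/
lemma UB.remainder (hσ : 1 / 2 < σ) {ε : ℝ} {v v1 v2 v3 f f1 : ι → CT}
    (h : UB (σ + 1) v) (h1 : UB (σ + 1) v1) (h2 : UB σ v2) (hf : UB σ f) (hf1 : UB σ f1)
    (d0 : ∀ i, IsDeriv (v i) (v1 i)) (d1 : ∀ i, IsDeriv (v1 i) (v2 i))
    (d2 : ∀ i, IsDeriv (v2 i) (v3 i)) (df : ∀ i, IsDeriv (f i) (f1 i)) :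
    UB σ (fun i => remainder F ε (v i) (v1 i) (v2 i) (v3 i) (f i) (f1 i)) := by
  have g := h.mono (q := σ) (by linarith)
  have g1 := h1.mono (q := σ) (by linarith)
  have hE : UB σ (fun i => TorusNLS.gauge F (v i) (v1 i)) := (UB.gauge F hσ g g1).mono (by linarith)
  have hb := UB.ev hσ (MvPolynomial.pderiv 1 F) g g1
  obtain ⟨M, hM⟩ := exists_norm_betaMean_le F hσ g g1
  have hbb := hb.sub (UB.scalar hM)
  have hH : UB σ (fun i => hess F (v i) (v1 i) (v2 i)) :=
    UB.finset_sum _ fun n => (UB.dev hσ _ g g1 g1 h2).mul hσ (UB.jet g1 h2 n)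
  refine (hE.mul hσ ?_).add ((UB.mul hσ ?_ hE).mul hσ (UB.normalForm F hσ g g1 h2))
  · exact ((((UB.ev hσ _ g g1).mul hσ h2).add (hH.smul _)).add
      ((UB.dev hσ F g g1 hf hf1).smul _)).sub ((hb.mul hσ (UB.dev hσ F g g1 g1 h2)).smul _)
  · refine ((UB.sub ?_ ((UB.dev hσ _ g g1 g1 h2).smul _)).sub ?_).sub ?_
    · exact (UB.prim_dev hσ _ h h1 d0 d1 ((hf.sub (h2.smul _)).smul _)
        fun i => ((df i).sub ((d2 i).smul _)).smul _).smul _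
    · simp_rw [pow_two]
      exact (hbb.mul hσ hbb).smul _
    · refine hbb.smul_family hσ (M := M * ‖Complex.I / 2‖) fun i => ?_
      rw [norm_mul]
      gcongr
      exact hM i

/-- Pairing the gauge with a second derivative costs only the norm of the function. -/
lemma exists_norm_cf_gauge_mul_le (hσ : 1 / 2 < σ) {v v1 v2 : ι → CT} (h : UB σ v) (h1 : UB σ v1)
    (h2 : UB σ v2) (d0 : ∀ i, IsDeriv (v i) (v1 i)) (d1 : ∀ i, IsDeriv (v1 i) (v2 i)) (k : ℤ) :
    ∃ C : ℝ, 0 ≤ C ∧ ∀ i, ∀ d d' d'' : CT, IsDeriv d d' → IsDeriv d' d'' →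
      ‖cf (gauge F (v i) (v1 i) * d'') k‖ ≤ C * ‖d‖ := by
  have hE : UB σ (fun i => TorusNLS.gauge F (v i) (v1 i)) := (UB.gauge F hσ h h1).mono (by linarith)
  have hb := UB.ev hσ (MvPolynomial.pderiv 1 F) h h1
  obtain ⟨M, hM⟩ := exists_norm_betaMean_le F hσ h h1
  have hA := (hb.sub (UB.scalar hM)).smul (Complex.I / 2)
  have hA1 := (UB.dev hσ (MvPolynomial.pderiv 1 F) h h1 h1 h2).smul (Complex.I / 2)
  have hE1 := hA.mul hσ hE
  obtain ⟨M0, p0, hM0⟩ := hE.norm_le hσ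
  obtain ⟨M1, p1, hM1⟩ := hE1.norm_le hσ
  obtain ⟨M2, p2, hM2⟩ := ((hA1.mul hσ hE).add (hA.mul hσ hE1)).norm_le hσ
  refine ⟨‖(Complex.I * k) ^ 2‖ * M0 + ‖2 * (Complex.I * k)‖ * M1 + M2, by positivity,
    fun i d d' d'' hd hd' => ?_⟩
  have e1 := isDeriv_gauge F (v i) (v1 i)
  have e2 := (((isDeriv_ev (MvPolynomial.pderiv 1 F) (d0 i) (d1 i)).sub
    (isDeriv_const (betaMean F (v i) (v1 i)))).smul (Complex.I / 2)).mul e1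
  rw [sub_zero] at e2
  rw [cf_mul_second_deriv e1 e2 hd hd' k]
  have key : ∀ (A : CT) (M : ℝ), ‖A‖ ≤ M → ‖cf (A * d) k‖ ≤ M * ‖d‖ := fun A M hAM =>
    ((norm_cf_le _ _).trans (norm_mul_le _ _)).trans (by gcongr)
  calc _ ≤ ‖(Complex.I * k) ^ 2‖ * (M0 * ‖d‖) + ‖2 * (Complex.I * k)‖ * (M1 * ‖d‖) + M2 * ‖d‖ := by
        refine (norm_add_le _ _).trans (add_le_add ((norm_sub_le _ _).trans (add_le_add ?_ ?_)) ?_)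
        · rw [norm_mul]; gcongr; exact key _ _ (hM0 i)
        · rw [norm_mul]; gcongr; exact key _ _ (hM1 i)
        · exact key _ _ (hM2 i)
    _ = _ := by ring

end Bounds

/-! ### Truncation in frequency -/

/-- The `m`-th derivative of the Fourier partial sum of order `N`. -/
def tr (N m : ℕ) : CT →L[ℂ] CT :=
  ∑ k ∈ Finset.Icc (-(N : ℤ)) N, ((Complex.I * k) ^ m) • (coef k).smulRight (fourier k : CT)

lemma tr_apply (N m : ℕ) (f : CT) : tr N m f =
    ∑ k ∈ Finset.Icc (-(N : ℤ)) N, ((Complex.I * k) ^ m * cf f k) • (fourier k : CT) := by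
  simp [tr, cf, smul_smul]

lemma cf_sum {κ : Type*} (s : Finset κ) (f : κ → CT) (k : ℤ) :
    cf (∑ j ∈ s, f j) k = ∑ j ∈ s, cf (f j) k := by simp [cf]

lemma cf_tr (N m : ℕ) (f : CT) (k : ℤ) : cf (tr N m f) k =
    if k ∈ Finset.Icc (-(N : ℤ)) N then (Complex.I * k) ^ m * cf f k else 0 := by
  rw [tr_apply, cf_sum]
  simp only [cf_smul, Pi.smul_apply, cf_fourier, smul_eq_mul, mul_ite, mul_one, mul_zero]
  rw [Finset.sum_ite_eq]

lemma isDeriv_tr (N m : ℕ) (f : CT) : IsDeriv (tr N m f) (tr N (m + 1) f) := fun k => by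
  rw [cf_tr, cf_tr]
  split_ifs
  · ring
  · simp

lemma sq_tr_le (r : ℝ) (N m : ℕ) (f : CT) : sq r (cf (tr N m f)) ≤ sq (r + m) (cf f) := by
  refine ENNReal.tsum_le_tsum fun k => pow_le_pow_left' ?_ 2
  rw [cf_tr]
  split_ifs
  · rw [enorm_mul, enorm_pow, ← mul_assoc, wt_add]
    gcongr
    refine (pow_le_pow_left' (enorm_I_mul_intCast_le_wt k) m).trans (le_of_eq ?_)
    rw [wt, wt, ← ENNReal.ofReal_pow (by have := bracket_pos k; positivity), Real.rpow_one,
      Real.rpow_natCast]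
  · simp

lemma UB.tr {ι : Type*} {r : ℝ} {f : ι → CT} (m : ℕ) (hf : UB (r + m) f) :
    UB r (fun p : ℕ × ι => TorusNLS.tr p.1 m (f p.2)) := by
  obtain ⟨C, hC, hf⟩ := hf
  exact ⟨C, hC, fun p => (sq_tr_le r p.1 m _).trans (hf p.2)⟩

/-- Fourier partial sums converge uniformly on bounded families. -/
lemma exists_norm_tr_sub_le {ι : Type*} {r : ℝ} (hr : 1 / 2 < r) {f g : ι → CT} {m : ℕ}
    (hg : UB r g) (hfg : ∀ i k, cf (g i) k = (Complex.I * k) ^ m * cf (f i) k) {η : ℝ}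
    (hη : 0 < η) : ∃ N0 : ℕ, ∀ N ≥ N0, ∀ i, ‖tr N m (f i) - g i‖ ≤ η := by
  obtain ⟨C, hC, hg⟩ := hg
  have hw := tsum_wt_ne_top (p := -2 * r) (by linarith)
  -- The error is governed by the tail of this fixed convergent series, hence the uniformity over
  -- the family.
  have ht := ENNReal.tendsto_tsum_compl_atTop_zero hw
  have hI : Tendsto (fun N : ℕ => Finset.Icc (-(N : ℤ)) N) atTop atTop := by
    refine tendsto_atTop_finset_of_monotone (fun a b hab => ?_) fun k => ?_
    · apply Finset.Icc_subset_Icc <;> simpa using hab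
    · refine ⟨k.natAbs, ?_⟩
      rw [Finset.mem_Icc]; omega
  have ht2 := ENNReal.Tendsto.mul_const (b := 2 * C) (ht.comp hI) (Or.inr (by finiteness))
  rw [zero_mul] at ht2
  have hpos : (0 : ℝ≥0∞) < ENNReal.ofReal η ^ 2 := by
    have := ENNReal.ofReal_pos.mpr hη
    positivity
  obtain ⟨N0, hN0⟩ := eventually_atTop.mp (ht2.eventually_lt_const hpos)
  refine ⟨N0, fun N hN i => ?_⟩
  have h1 := hN0 N hN
  simp only [Function.comp_apply] at h1
  set d := tr N m (f i) - g i with hd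
  -- For `|k| ≤ N` the coefficients cancel; outside, those of `-g` remain.
  have hcf : ∀ k, ‖cf d k‖ₑ = (if k ∈ Finset.Icc (-(N : ℤ)) N then 0 else wt (-2 * r) k) *
      (wt (2 * r) k * ‖cf (g i) k‖ₑ) := fun k => by
    rw [hd, cf_sub, Pi.sub_apply, cf_tr]
    split_ifs with hk
    · rw [hfg]; simp
    · rw [← mul_assoc, ← wt_add]
      simp [wt_zero]
  have h2 : ‖d‖ₑ ^ 2 ≤ ENNReal.ofReal η ^ 2 := by
    calc ‖d‖ₑ ^ 2 ≤ (∑' k, ‖cf d k‖ₑ) ^ 2 := pow_le_pow_left' (enorm_le_tsum_cf d) 2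
      _ = (∑' k, (if k ∈ Finset.Icc (-(N : ℤ)) N then 0 else wt (-2 * r) k) *
          (wt (2 * r) k * ‖cf (g i) k‖ₑ)) ^ 2 := by simp_rw [hcf]
      _ ≤ _ := tsum_mul_sq_le _ _
      _ ≤ 2 * (∑' k, if k ∈ Finset.Icc (-(N : ℤ)) N then 0 else wt (-2 * r) k) *
          sq r (cf (g i)) := by
        gcongr
        refine ENNReal.tsum_le_tsum fun k => ?_
        split_ifs
        · simp
        · rw [show 2 * r = r + r by ring, wt_add, show -2 * r = - r + - r by ring, wt_add]
          have : wt (-r) k * wt r k = 1 := by rw [← wt_add]; simp [wt_zero]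
          refine le_of_eq ?_
          calc _ = (wt (-r) k * wt r k) ^ 2 * (wt r k * ‖cf (g i) k‖ₑ) ^ 2 := by ring
            _ = _ := by rw [this]; simp
      _ ≤ 2 * (∑' k : { x // x ∉ Finset.Icc (-(N : ℤ)) N }, wt (-2 * r) k) * C := by
        gcongr
        · refine le_of_eq ?_
          have := tsum_subtype {x | x ∉ Finset.Icc (-(N : ℤ)) N} (fun k => wt (-2 * r) k)
          refine Eq.trans ?_ this.symm
          congr 1; ext k
          by_cases hk : k ∈ Finset.Icc (-(N : ℤ)) N
          · simp only [hk, if_true]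
            rw [indicator_of_notMem]; simpa using hk
          · simp only [hk, if_false]
            rw [indicator_of_mem]; simpa using hk
        · exact hg i
      _ = (∑' k : { x // x ∉ Finset.Icc (-(N : ℤ)) N }, wt (-2 * r) k) * (2 * C) := by ring
      _ ≤ _ := h1.le
  have h3 : ‖d‖ₑ ≤ ENNReal.ofReal η := by
    by_contra hlt
    push Not at hlt
    exact absurd h2 (not_le.mpr (ENNReal.pow_lt_pow_left two_ne_zero hlt))
  rw [← ofReal_norm] at h3
  exact (ENNReal.ofReal_le_ofReal_iff hη.le).mp h3

/-- A truncation is a finite sum of modes, so the mode equations suffice; `ik² = -i (ik)²` produces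
the truncation of order `m + 2`. -/
lemma hasDerivAt_tr {u : ℝ → CT} {t : ℝ} {ε : ℝ} {w Φ : CT}
    (h : ∀ k, HasDerivAt (fun t => cf (u t) k)
      ((ε : ℂ) * (Complex.I * (k : ℂ) ^ 2 * cf w k + cf Φ k)) t) (N m : ℕ) :
    HasDerivAt (fun t => tr N m (u t))
      ((ε : ℂ) • (tr N m Φ - Complex.I • tr N (m + 2) w)) t := by
  have h1 := HasDerivAt.fun_sum (u := Finset.Icc (-(N : ℤ)) N) fun k _ =>
    ((h k).const_mul ((Complex.I * k) ^ m)).smul_const (fourier k : CT)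
  simp_rw [tr_apply]
  refine HasDerivAt.congr_deriv h1 ?_
  rw [Finset.smul_sum, ← Finset.sum_sub_distrib, Finset.smul_sum]
  refine Finset.sum_congr rfl fun k _ => ?_
  rw [smul_smul, ← sub_smul, smul_smul]
  refine congrArg (· • (fourier k : CT)) ?_
  linear_combination (ε : ℂ) * (Complex.I * k) ^ m * cf w k * k ^ 2 * Complex.I * Complex.I_sq

/-! ### The energy estimate for growing modes -/

lemma bracket_le_two_mul_abs {k : ℤ} (hk : k ≠ 0) : bracket k ≤ 2 * |(k : ℝ)| := by
  have h1 : (1 : ℝ) ≤ |(k : ℝ)| := by exact_mod_cast Int.one_le_abs hk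
  rw [bracket]
  apply Real.sqrt_le_iff.mpr ⟨by positivity, ?_⟩
  have := sq_abs (k : ℝ)
  nlinarith

/-- The terms `ik²` and `ik Re b` rotate `w` without changing its modulus; only `-εk Im b`
contributes to the growth. -/
lemma growth_lower_bound {β ε : ℝ} {k : ℤ} {b w ρ : ℂ} (hβ : 0 < β) (hk : k ≠ 0)
    (hε : ε * ε = 1) (hb : β * |(k : ℝ)| ≤ -(ε * k * b.im)) :
    β * |(k : ℝ)| * ‖w‖ ^ 2 - ‖ρ‖ ^ 2 / (β * |(k : ℝ)|) ≤
      2 * inner ℝ w ((ε : ℂ) * ((Complex.I * (k : ℂ) ^ 2 + Complex.I * k * b) * w + ρ)) := by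
  have hk' : 0 < |(k : ℝ)| := abs_pos.mpr (by exact_mod_cast hk)
  have h1 : inner ℝ w ((ε : ℂ) * ((Complex.I * (k : ℂ) ^ 2 + Complex.I * k * b) * w + ρ)) =
      -(ε * k * b.im) * ‖w‖ ^ 2 + ε * inner ℝ w ρ := by
    rw [Complex.inner, Complex.inner, ← Complex.normSq_eq_norm_sq, Complex.normSq_apply]
    simp only [pow_two, Complex.mul_re, Complex.mul_im, Complex.add_re, Complex.add_im,
      Complex.conj_re, Complex.conj_im, Complex.ofReal_re, Complex.ofReal_im, Complex.I_re,
      Complex.I_im, Complex.intCast_re, Complex.intCast_im]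
    ring
  have hε1 : |ε| = 1 := by
    have : |ε| * |ε| = 1 := by rw [← abs_mul, hε, abs_one]
    nlinarith [abs_nonneg ε]
  have h2 : -(‖w‖ * ‖ρ‖) ≤ ε * inner ℝ w ρ := by
    have h3 := abs_real_inner_le_norm w ρ
    have h4 : |ε * inner ℝ w ρ| ≤ ‖w‖ * ‖ρ‖ := by rw [abs_mul, hε1, one_mul]; exact h3
    exact (abs_le.mp h4).1
  rw [h1]
  set c := β * |(k : ℝ)|
  have hc : 0 < c := by positivity
  have h5 : c * ‖w‖ ^ 2 ≤ -(ε * k * b.im) * ‖w‖ ^ 2 := by gcongr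
  -- The derivative of `‖w‖²` supplies `2c‖w‖²`; one copy absorbs the cross term with `ρ`, the other
  -- remains.
  have h6 : 0 ≤ c * (‖w‖ - ‖ρ‖ / c) ^ 2 := by positivity
  have h7 : c * (‖w‖ - ‖ρ‖ / c) ^ 2 = c * ‖w‖ ^ 2 - 2 * (‖w‖ * ‖ρ‖) + ‖ρ‖ ^ 2 / c := by
    field_simp
    ring
  linarith

/-- A mode that grows at the rate `β |k|` gains half a derivative at the initial time. -/
lemma energy_bound {K : Finset ℤ} {σ β τ C ε : ℝ} (hβ : 0 < β) (hτ : 0 < τ) (hε : ε * ε = 1)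
    {w ρ : ℤ → ℝ → ℂ} {b : ℝ → ℂ} (hK : ∀ k ∈ K, k ≠ 0)
    (hc : ∀ k ∈ K, ContinuousOn (w k) (Icc 0 τ))
    (hd : ∀ k ∈ K, ∀ t ∈ Ioo 0 τ, HasDerivAt (w k)
      ((ε : ℂ) * ((Complex.I * (k : ℂ) ^ 2 + Complex.I * k * b t) * w k t + ρ k t)) t)
    (hb : ∀ k ∈ K, ∀ t ∈ Ioo 0 τ, β * |(k : ℝ)| ≤ -(ε * k * (b t).im))
    (hρ : ∀ t ∈ Ioo 0 τ, ∑ k ∈ K, (bracket k ^ σ * ‖ρ k t‖) ^ 2 ≤ C) :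
    ∑ k ∈ K, bracket k * (bracket k ^ σ * ‖w k 0‖) ^ 2 ≤
      2 / (β * τ) * ∑ k ∈ K, (bracket k ^ σ * ‖w k τ‖) ^ 2 + 2 / β * C * τ := by
  set ω : ℤ → ℝ := fun k => bracket k * (bracket k ^ σ) ^ 2 with hω
  have hω0 : ∀ k, 0 ≤ ω k := fun k => by have := bracket_pos k; positivity
  -- The exponential compensates the guaranteed growth of `‖w‖²`, and the term linear in `t`
  -- compensates the forcing, so `X` is nondecreasing.
  set X : ℝ → ℝ := fun t =>
    ∑ k ∈ K, ω k * (Real.exp (-(β * |(k : ℝ)|) * t) * ‖w k t‖ ^ 2) + 2 / β * C * t with hX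
  have hcont : ContinuousOn X (Icc 0 τ) := by
    refine (continuousOn_finsetSum K fun k hk => ?_).add (by fun_prop)
    exact continuousOn_const.mul (ContinuousOn.mul (by fun_prop) ((hc k hk).norm.pow 2))
  have hder : ∀ t ∈ Ioo 0 τ, HasDerivAt X (∑ k ∈ K, ω k *
      ((Real.exp (-(β * |(k : ℝ)|) * t) * (-(β * |(k : ℝ)|) * 1)) * ‖w k t‖ ^ 2 +
        Real.exp (-(β * |(k : ℝ)|) * t) * (2 * inner ℝ (w k t)
          ((ε : ℂ) * ((Complex.I * (k : ℂ) ^ 2 + Complex.I * k * b t) * w k t + ρ k t))))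
      + 2 / β * C * 1) t := by
    intro t ht
    refine (HasDerivAt.fun_sum fun k hk => ?_).add ((hasDerivAt_id t).const_mul _)
    exact ((((hasDerivAt_id t).const_mul _).exp).mul (hd k hk t ht).norm_sq).const_mul _
  have hmono : MonotoneOn X (Icc 0 τ) := by
    refine monotoneOn_of_deriv_nonneg (convex_Icc 0 τ) hcont ?_ ?_
    · rw [interior_Icc]
      exact fun t ht => (hder t ht).differentiableAt.differentiableWithinAt
    · rw [interior_Icc]
      intro t ht
      rw [(hder t ht).deriv, mul_one]
      have h1 : ∀ k ∈ K, -(2 / β * (bracket k ^ σ * ‖ρ k t‖) ^ 2) ≤ ω k *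
          ((Real.exp (-(β * |(k : ℝ)|) * t) * (-(β * |(k : ℝ)|) * 1)) * ‖w k t‖ ^ 2 +
          Real.exp (-(β * |(k : ℝ)|) * t) * (2 * inner ℝ (w k t)
          ((ε : ℂ) * ((Complex.I * (k : ℂ) ^ 2 + Complex.I * k * b t) * w k t + ρ k t)))) := by
        intro k hk
        have hk' : 0 < |(k : ℝ)| := abs_pos.mpr (by exact_mod_cast hK k hk)
        have g := growth_lower_bound (w := w k t) (ρ := ρ k t) hβ (hK k hk) hε (hb k hk t ht)
        set e := Real.exp (-(β * |(k : ℝ)|) * t)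
        have he : 0 < e := Real.exp_pos _
        have he1 : e ≤ 1 := by
          apply Real.exp_le_one_iff.mpr
          have := ht.1
          have : 0 ≤ β * |(k : ℝ)| * t := by positivity
          linarith
        calc -(2 / β * (bracket k ^ σ * ‖ρ k t‖) ^ 2)
            ≤ -(ω k * (‖ρ k t‖ ^ 2 / (β * |(k : ℝ)|))) := by
              apply neg_le_neg
              -- The extra bracket in `ω` is paid for by the `1/|k|` in front of the forcing.
              have h2 := bracket_le_two_mul_abs (hK k hk)
              calc ω k * (‖ρ k t‖ ^ 2 / (β * |(k : ℝ)|))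
                  = (bracket k / |(k : ℝ)|) * (1 / β * (bracket k ^ σ * ‖ρ k t‖) ^ 2) := by
                    rw [hω]; field_simp
                _ ≤ 2 * (1 / β * (bracket k ^ σ * ‖ρ k t‖) ^ 2) := by
                    gcongr
                    rwa [div_le_iff₀ hk']
                _ = _ := by ring
          _ ≤ -(ω k * (e * (‖ρ k t‖ ^ 2 / (β * |(k : ℝ)|)))) := by
              apply neg_le_neg
              have := hω0 k
              gcongr
              exact mul_le_of_le_one_left (by positivity) he1
          _ ≤ ω k * (e * (2 * inner ℝ (w k t)
                ((ε : ℂ) * ((Complex.I * (k : ℂ) ^ 2 + Complex.I * k * b t) * w k t + ρ k t))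
                - β * |(k : ℝ)| * ‖w k t‖ ^ 2)) := by
              rw [← mul_neg, ← mul_neg]
              have := hω0 k
              gcongr
              linarith
          _ = _ := by ring
      have h3 := Finset.sum_le_sum h1
      rw [Finset.sum_neg_distrib, ← Finset.mul_sum] at h3
      have h4 : 2 / β * ∑ k ∈ K, (bracket k ^ σ * ‖ρ k t‖) ^ 2 ≤ 2 / β * C := by
        gcongr
        exact hρ t ht
      linarith
  have h0 := hmono (left_mem_Icc.mpr hτ.le) (right_mem_Icc.mpr hτ.le) hτ.le
  simp only [hX, mul_zero, Real.exp_zero, one_mul, add_zero] at h0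
  have e0 : ∑ k ∈ K, bracket k * (bracket k ^ σ * ‖w k 0‖) ^ 2 = ∑ k ∈ K, ω k * ‖w k 0‖ ^ 2 :=
    Finset.sum_congr rfl fun k _ => by rw [hω]; ring
  rw [e0]
  refine h0.trans ?_
  gcongr
  rw [Finset.mul_sum]
  refine Finset.sum_le_sum fun k hk => ?_
  have hk' : 0 < |(k : ℝ)| := abs_pos.mpr (by exact_mod_cast hK k hk)
  set y := β * |(k : ℝ)| * τ with hy
  have hy0 : 0 < y := by positivity
  -- At time `τ` the decay `e^{-y} ≤ 1/y` supplies the factor `1/|k|` that pays for the extra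
  -- bracket.
  have h5 : Real.exp (-(β * |(k : ℝ)|) * τ) ≤ 1 / y := by
    rw [show -(β * |(k : ℝ)|) * τ = -y by rw [hy]; ring, Real.exp_neg, ← one_div]
    apply one_div_le_one_div_of_le hy0
    linarith [Real.add_one_le_exp y]
  calc ω k * (Real.exp (-(β * |(k : ℝ)|) * τ) * ‖w k τ‖ ^ 2)
      ≤ ω k * (1 / y * ‖w k τ‖ ^ 2) := by have := hω0 k; gcongr
    _ = (bracket k / |(k : ℝ)|) * (1 / (β * τ) * (bracket k ^ σ * ‖w k τ‖) ^ 2) := by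
        rw [hω, hy]; field_simp
    _ ≤ 2 * (1 / (β * τ) * (bracket k ^ σ * ‖w k τ‖) ^ 2) := by
        gcongr
        rw [div_le_iff₀ hk']
        exact bracket_le_two_mul_abs (hK k hk)
    _ = _ := by ring

/-! ### The smoothing estimate -/

section Limits

variable {X : Type*} {l : Filter X} {v v1 v2 : X → CT} {a a1 a2 : CT}

lemma tendsto_jet (h : Tendsto v l (𝓝 a)) (h1 : Tendsto v1 l (𝓝 a1)) (n : Fin 4) :
    Tendsto (fun x => jet (v x) (v1 x) n) l (𝓝 (jet a a1 n)) := by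
  fin_cases n
  exacts [h, h1, h.star, h1.star]

lemma tendsto_ev (P : MvPolynomial (Fin 4) ℂ) (h : Tendsto v l (𝓝 a)) (h1 : Tendsto v1 l (𝓝 a1)) :
    Tendsto (fun x => ev P (v x) (v1 x)) l (𝓝 (ev P a a1)) := by
  induction P using MvPolynomial.induction_on with
  | C c => simp_rw [ev_C]; exact tendsto_const_nhds
  | add p q hp hq => simp_rw [ev_add]; exact hp.add hq
  | mul_X p n hp => simp_rw [ev_mul_X]; exact hp.mul (tendsto_jet h h1 n)

lemma tendsto_gauge (F : MvPolynomial (Fin 4) ℂ) (h : Tendsto v l (𝓝 a))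
    (h1 : Tendsto v1 l (𝓝 a1)) : Tendsto (fun x => gauge F (v x) (v1 x)) l (𝓝 (gauge F a a1)) := by
  have h2 := (prim.continuous.tendsto _).comp (tendsto_ev (MvPolynomial.pderiv 1 F) h h1)
  exact ((hasFDerivAt_exp (𝕂 := ℂ)).continuousAt.tendsto).comp (h2.const_smul (Complex.I / 2))

lemma tendsto_cf_gauge_mul_normalForm (F : MvPolynomial (Fin 4) ℂ) (h : Tendsto v l (𝓝 a))
    (h1 : Tendsto v1 l (𝓝 a1)) (h2 : Tendsto v2 l (𝓝 a2)) (k : ℤ) :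
    Tendsto (fun x => cf (gauge F (v x) (v1 x) * normalForm F (v x) (v1 x) (v2 x)) k) l
      (𝓝 (cf (gauge F a a1 * normalForm F a a1 a2) k)) := by
  have h3 : Tendsto (fun x => normalForm F (v x) (v1 x) (v2 x)) l (𝓝 (normalForm F a a1 a2)) :=
    h2.add ((tendsto_ev F h h1).const_smul (Complex.I / 2))
  exact ((coef k).continuous.tendsto _).comp ((tendsto_gauge F h h1).mul h3)

end Limits

lemma sq_term_eq (σ : ℝ) (a : ℤ → ℂ) (k : ℤ) :
    (wt σ k * ‖a k‖ₑ) ^ 2 = ENNReal.ofReal ((bracket k ^ σ * ‖a k‖) ^ 2) := by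
  have := bracket_pos k
  rw [ENNReal.ofReal_pow (by positivity), ENNReal.ofReal_mul (by positivity), ofReal_norm]
  rfl

lemma sum_le_of_sq_le {σ : ℝ} {a : ℤ → ℂ} {C : ℝ} (hC : 0 ≤ C) (h : sq σ a ≤ ENNReal.ofReal C)
    (K : Finset ℤ) : ∑ k ∈ K, (bracket k ^ σ * ‖a k‖) ^ 2 ≤ C := by
  have h1 : ∑ k ∈ K, (wt σ k * ‖a k‖ₑ) ^ 2 ≤ ENNReal.ofReal C := (ENNReal.sum_le_tsum K).trans h
  simp_rw [sq_term_eq] at h1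
  rw [← ENNReal.ofReal_sum_of_nonneg fun _ _ => sq_nonneg _] at h1
  exact (ENNReal.ofReal_le_ofReal_iff hC).mp h1

lemma UB.exists_sum_le {ι : Type*} {σ : ℝ} {f : ι → CT} (h : UB σ f) : ∃ C : ℝ, 0 ≤ C ∧
    ∀ i, ∀ K : Finset ℤ, ∑ k ∈ K, (bracket k ^ σ * ‖cf (f i) k‖) ^ 2 ≤ C := by
  obtain ⟨C, hC, h⟩ := h
  refine ⟨C.toReal, ENNReal.toReal_nonneg, fun i K => sum_le_of_sq_le ENNReal.toReal_nonneg ?_ K⟩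
  rw [ENNReal.ofReal_toReal hC]
  exact h i

/-- The infinite sum is the supremum of the finite ones, and the additional factor `⟨k⟩` in a square
is half a derivative. -/
lemma sq_indicator_le {σ : ℝ} {a : ℤ → ℂ} {S : Set ℤ} {C : ℝ}
    (h : ∀ K : Finset ℤ, (∀ k ∈ K, k ∈ S) →
      ∑ k ∈ K, bracket k * (bracket k ^ σ * ‖a k‖) ^ 2 ≤ C) :
    sq (σ + 1 / 2) (S.indicator a) ≤ ENNReal.ofReal C := by
  classical
  unfold sq
  rw [ENNReal.tsum_eq_iSup_sum]
  refine iSup_le fun K => ?_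
  calc ∑ k ∈ K, (wt (σ + 1 / 2) k * ‖S.indicator a k‖ₑ) ^ 2
      = ∑ k ∈ K.filter (· ∈ S), (wt (σ + 1 / 2) k * ‖a k‖ₑ) ^ 2 := by
        rw [Finset.sum_filter]
        refine Finset.sum_congr rfl fun k _ => ?_
        split_ifs with hk
        · rw [indicator_of_mem hk]
        · rw [indicator_of_notMem hk]; simp
    _ = ∑ k ∈ K.filter (· ∈ S), ENNReal.ofReal (bracket k * (bracket k ^ σ * ‖a k‖) ^ 2) := by
        refine Finset.sum_congr rfl fun k _ => ?_
        rw [sq_term_eq, Real.rpow_add (bracket_pos k), ← Real.sqrt_eq_rpow]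
        congr 1
        have := Real.sq_sqrt (bracket_pos k).le
        linear_combination (bracket k ^ σ * ‖a k‖) ^ 2 * this
    _ = ENNReal.ofReal (∑ k ∈ K.filter (· ∈ S), bracket k * (bracket k ^ σ * ‖a k‖) ^ 2) := by
        rw [ENNReal.ofReal_sum_of_nonneg]
        intro k _
        have := bracket_pos k
        positivity
    _ ≤ _ := ENNReal.ofReal_le_ofReal (h _ fun k hk => (Finset.mem_filter.mp hk).2)

section Smoothing

variable (F : MvPolynomial (Fin 4) ℂ) {ε σ T : ℝ} {U U1 U2 : ℝ → CT}

/-- Truncated data converge uniformly under polynomial maps. -/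
lemma exists_norm_ev_tr_sub_le (P : MvPolynomial (Fin 4) ℂ) (hσ : 1 / 2 < σ)
    (hU : UB (σ + 2) (fun t : Icc 0 T => U t))
    (hd : ∀ t ∈ Icc 0 T, IsDeriv (U t) (U1 t)) {η : ℝ} (hη : 0 < η) :
    ∃ N0 : ℕ, ∀ N ≥ N0, ∀ t ∈ Icc 0 T,
      ‖ev P (tr N 0 (U t)) (tr N 1 (U t)) - ev P (U t) (U1 t)‖ ≤ η := by
  have hd' : ∀ t : Icc 0 T, IsDeriv (U t) (U1 t) := fun t => hd t t.2
  have hU' : UB (σ + 1 + 1) (fun t : Icc 0 T => U t) := hU.mono (by linarith)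
  have hU1 := hU'.isDeriv hd'
  obtain ⟨M0, -, hM0⟩ := hU.norm_le (by linarith)
  obtain ⟨M1, -, hM1⟩ := hU1.norm_le (by linarith)
  obtain ⟨M2, -, hM2⟩ := (UB.tr 0 (r := σ) (hU.mono (by push_cast; linarith))).norm_le hσ
  obtain ⟨M3, -, hM3⟩ := (UB.tr 1 (r := σ) (hU.mono (by push_cast; linarith))).norm_le hσ
  obtain ⟨B, L, -, hL, hBL⟩ := ev_lipschitz P (max (max M0 M1) (max M2 M3))
  -- The Lipschitz constant may be `0`; `L + 1` keeps the denominator positive.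
  have hη' : 0 < η / (2 * (L + 1)) := by positivity
  obtain ⟨N0, hN0⟩ := exists_norm_tr_sub_le (f := fun t : Icc 0 T => U t) (m := 0) (r := σ + 2)
    (by linarith) hU (fun _ _ => by simp) hη'
  obtain ⟨N1, hN1⟩ := exists_norm_tr_sub_le (f := fun t : Icc 0 T => U t) (m := 1) (r := σ + 1)
    (by linarith) hU1 (fun t k => by rw [pow_one]; exact hd' t k) hη'
  refine ⟨max N0 N1, fun N hN t ht => ?_⟩
  have h0 := hN0 N (le_trans (le_max_left _ _) hN) ⟨t, ht⟩
  have h1 := hN1 N (le_trans (le_max_right _ _) hN) ⟨t, ht⟩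
  have h2 := (hBL _ _ _ _ ((hM2 (N, ⟨t, ht⟩)).trans (by simp)) ((hM3 (N, ⟨t, ht⟩)).trans (by simp))
    ((hM0 ⟨t, ht⟩).trans (by simp)) ((hM1 ⟨t, ht⟩).trans (by simp))).2
  refine h2.trans ?_
  calc L * (‖tr N 0 (U t) - U t‖ + ‖tr N 1 (U t) - U1 t‖)
      ≤ (L + 1) * (η / (2 * (L + 1)) + η / (2 * (L + 1))) := by
        gcongr
        linarith
    _ = η := by field_simp; norm_num

/-- The commutator of truncation and nonlinearity tends to `0` uniformly in time: both terms are
close to `F(u)`. -/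
lemma exists_norm_tr_ev_sub_le (hσ : 1 / 2 < σ)
    (hU : UB (σ + 2) (fun t : Icc 0 T => U t))
    (hd : ∀ t ∈ Icc 0 T, IsDeriv (U t) (U1 t)) {η : ℝ} (hη : 0 < η) :
    ∃ N0 : ℕ, ∀ N ≥ N0, ∀ t ∈ Icc 0 T,
      ‖tr N 0 (ev F (U t) (U1 t)) - ev F (tr N 0 (U t)) (tr N 1 (U t))‖ ≤ η := by
  have hd' : ∀ t : Icc 0 T, IsDeriv (U t) (U1 t) := fun t => hd t t.2
  have hU' : UB (σ + 1 + 1) (fun t : Icc 0 T => U t) := hU.mono (by linarith)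
  have hΦ : UB (σ + 1) (fun t : Icc 0 T => ev F (U t) (U1 t)) :=
    UB.ev (by linarith) F (hU.mono (by linarith)) (hU'.isDeriv hd')
  obtain ⟨N0, hN0⟩ := exists_norm_tr_sub_le (m := 0)
    (f := fun t : Icc 0 T => ev F (U t) (U1 t)) (by linarith) hΦ (fun _ _ => by simp)
    (half_pos hη)
  obtain ⟨N1, hN1⟩ := exists_norm_ev_tr_sub_le F hσ hU hd (half_pos hη)
  refine ⟨max N0 N1, fun N hN t ht => ?_⟩
  have h0 := hN0 N (le_trans (le_max_left _ _) hN) ⟨t, ht⟩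
  have h1 := hN1 N (le_trans (le_max_right _ _) hN) t ht
  rw [norm_sub_rev] at h1
  have := norm_sub_le_norm_sub_add_norm_sub (tr N 0 (ev F (U t) (U1 t))) (ev F (U t) (U1 t))
    (ev F (tr N 0 (U t)) (tr N 1 (U t)))
  simp only at h0
  linarith

/-- Near time `0` the mean of `Im F_β` of the truncated solution keeps its sign. -/
lemma exists_betaMean_close (hσ : 1 / 2 < σ) (hT : 0 < T)
    (hU : UB (σ + 2) (fun t : Icc 0 T => U t))
    (hd : ∀ t ∈ Icc 0 T, IsDeriv (U t) (U1 t))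
    (hcU : ContinuousOn U (Icc 0 T)) (hcU1 : ContinuousOn U1 (Icc 0 T)) {η : ℝ} (hη : 0 < η) :
    ∃ τ, 0 < τ ∧ τ ≤ T ∧ ∃ N0 : ℕ, ∀ N ≥ N0, ∀ t ∈ Icc 0 τ,
      |(betaMean F (tr N 0 (U t)) (tr N 1 (U t))).im - (betaMean F (U 0) (U1 0)).im| ≤ η := by
  have hc : ContinuousOn (fun t => ev (MvPolynomial.pderiv 1 F) (U t) (U1 t)) (Icc 0 T) :=
    fun t ht => tendsto_ev (MvPolynomial.pderiv 1 F) (hcU t ht) (hcU1 t ht)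
  have h0 := Metric.continuousWithinAt_iff.mp (hc 0 (left_mem_Icc.mpr hT.le)) (η / 2) (half_pos hη)
  obtain ⟨δ, hδ, h0⟩ := h0
  obtain ⟨N0, hN0⟩ := exists_norm_ev_tr_sub_le (MvPolynomial.pderiv 1 F) hσ hU hd (half_pos hη)
  refine ⟨min T (δ / 2), by positivity, min_le_left _ _, N0, fun N hN t ht => ?_⟩
  have ht' : t ∈ Icc 0 T := ⟨ht.1, ht.2.trans (min_le_left _ _)⟩
  have h1 := hN0 N hN t ht'
  have h2 := h0 ht' (by
    rw [Real.dist_eq, sub_zero, abs_of_nonneg ht.1]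
    have := ht.2.trans (min_le_right _ _)
    linarith)
  rw [dist_eq_norm] at h2
  rw [← Complex.sub_im]
  refine (Complex.abs_im_le_norm _).trans ?_
  unfold betaMean
  rw [← Pi.sub_apply, ← cf_sub]
  refine (norm_cf_le _ 0).trans ?_
  have := norm_sub_le_norm_sub_add_norm_sub
    (ev (MvPolynomial.pderiv 1 F) (tr N 0 (U t)) (tr N 1 (U t)))
    (ev (MvPolynomial.pderiv 1 F) (U t) (U1 t)) (ev (MvPolynomial.pderiv 1 F) (U 0) (U1 0))
  linarith

/-- Uniform bounds for the truncated solutions. -/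
lemma exists_truncated_bounds (hσ : 1 / 2 < σ)
    (hU : UB (σ + 2) (fun t : Icc 0 T => U t)) (hd : ∀ t ∈ Icc 0 T, IsDeriv (U t) (U1 t)) :
    ∃ CR CW : ℝ, 0 ≤ CR ∧ 0 ≤ CW ∧ ∃ A : ℤ → ℝ, (∀ k, 0 ≤ A k) ∧ ∀ N : ℕ, ∀ t ∈ Icc 0 T,
      (∀ K : Finset ℤ, ∑ k ∈ K, (bracket k ^ σ * ‖cf (remainder F ε (tr N 0 (U t)) (tr N 1 (U t))
        (tr N 2 (U t)) (tr N 3 (U t)) (tr N 0 (ev F (U t) (U1 t)))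
        (tr N 1 (ev F (U t) (U1 t)))) k‖) ^ 2 ≤ CR) ∧
      (∀ K : Finset ℤ, ∑ k ∈ K, (bracket k ^ σ * ‖cf (gauge F (tr N 0 (U t)) (tr N 1 (U t)) *
        normalForm F (tr N 0 (U t)) (tr N 1 (U t)) (tr N 2 (U t))) k‖) ^ 2 ≤ CW) ∧
      ∀ k : ℤ, ∀ d d' d'' : CT, IsDeriv d d' → IsDeriv d' d'' →
        ‖cf (gauge F (tr N 0 (U t)) (tr N 1 (U t)) * d'') k‖ ≤ A k * ‖d‖ := by
  have hd' : ∀ t : Icc 0 T, IsDeriv (U t) (U1 t) := fun t => hd t t.2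
  have hU' : UB (σ + 1 + 1) (fun t : Icc 0 T => U t) := hU.mono (by linarith)
  have hΦ : UB (σ + 1) (fun t : Icc 0 T => ev F (U t) (U1 t)) :=
    UB.ev (by linarith) F (hU.mono (by linarith)) (hU'.isDeriv hd')
  -- The families are indexed by pairs `(N, t)`, which makes every bound below uniform in `N`.
  have bv := UB.tr (r := σ + 1) 0 (hU.mono (by push_cast; linarith))
  have bv1 := UB.tr (r := σ + 1) 1 (hU.mono (by push_cast; linarith))
  have bv2 := UB.tr (r := σ) 2 (hU.mono (by push_cast; linarith))
  have bf := UB.tr (r := σ) 0 (hΦ.mono (by push_cast; linarith))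
  have bf1 := UB.tr (r := σ) 1 (hΦ.mono (by push_cast; linarith))
  have bv' := bv.mono (q := σ) (by linarith)
  have bv1' := bv1.mono (q := σ) (by linarith)
  have hR := UB.remainder F hσ (ε := ε) bv bv1 bv2 bf bf1
    (fun p => isDeriv_tr _ _ _) (fun p => isDeriv_tr _ _ _)
    (fun p => isDeriv_tr _ _ _) (fun p => isDeriv_tr _ _ _)
  obtain ⟨CR, hCR0, hCR⟩ := hR.exists_sum_le
  have hG : UB σ _ := (UB.gauge F hσ bv' bv1').mono (by linarith)
  obtain ⟨CW, hCW0, hCW⟩ := (hG.mul hσ (UB.normalForm F hσ bv' bv1' bv2)).exists_sum_le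
  choose A hA0 hA using fun k : ℤ => exists_norm_cf_gauge_mul_le F hσ bv' bv1' bv2
    (fun p => isDeriv_tr _ _ _) (fun p => isDeriv_tr _ _ _) k
  exact ⟨CR, CW, hCR0, hCW0, A, hA0, fun N t ht => ⟨fun K => hCR (N, ⟨t, ht⟩) K,
    fun K => hCW (N, ⟨t, ht⟩) K, fun k => hA k (N, ⟨t, ht⟩)⟩⟩

/-- The truncation of `u` is forced by the truncation of `F(u)`, not by `F` of the truncation. The
last term records this defect. -/
lemma hasDerivAt_truncated (hε : ε * ε = 1) {t : ℝ} (hmode : ∀ k : ℤ, HasDerivAt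
      (fun t => cf (U t) k)
      ((ε : ℂ) * (Complex.I * (k : ℂ) ^ 2 * cf (U t) k + cf (ev F (U t) (U1 t)) k)) t)
    (N : ℕ) (k : ℤ) :
    HasDerivAt (fun t => cf (gauge F (tr N 0 (U t)) (tr N 1 (U t)) *
        normalForm F (tr N 0 (U t)) (tr N 1 (U t)) (tr N 2 (U t))) k)
      ((ε : ℂ) * ((Complex.I * (k : ℂ) ^ 2 + Complex.I * k *
          betaMean F (tr N 0 (U t)) (tr N 1 (U t))) *
          cf (gauge F (tr N 0 (U t)) (tr N 1 (U t)) *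
            normalForm F (tr N 0 (U t)) (tr N 1 (U t)) (tr N 2 (U t))) k
        + (cf (remainder F ε (tr N 0 (U t)) (tr N 1 (U t)) (tr N 2 (U t)) (tr N 3 (U t))
            (tr N 0 (ev F (U t) (U1 t))) (tr N 1 (ev F (U t) (U1 t)))) k
          + cf (gauge F (tr N 0 (U t)) (tr N 1 (U t)) * (tr N 2 (ev F (U t) (U1 t))
            - (hess F (tr N 0 (U t)) (tr N 1 (U t)) (tr N 2 (U t))
            + dev F (tr N 0 (U t)) (tr N 1 (U t)) (tr N 2 (U t)) (tr N 3 (U t))))) k))) t := by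
  have h0 : HasDerivAt (fun t => tr N 0 (U t)) ((ε : ℂ) • (tr N 0 (ev F (U t) (U1 t))
    - Complex.I • tr N 2 (U t))) t := hasDerivAt_tr hmode N 0
  have h1 : HasDerivAt (fun t => tr N 1 (U t)) ((ε : ℂ) • (tr N 1 (ev F (U t) (U1 t))
    - Complex.I • tr N 3 (U t))) t := hasDerivAt_tr hmode N 1
  have h2 : HasDerivAt (fun t => tr N 2 (U t)) ((ε : ℂ) • (tr N 2 (ev F (U t) (U1 t))
    - Complex.I • tr N 4 (U t))) t := hasDerivAt_tr hmode N 2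
  have h := hasDerivAt_cf_gauge_mul_normalForm F hε (u0 := fun t => tr N 0 (U t))
    (u1 := fun t => tr N 1 (U t)) (u2 := fun t => tr N 2 (U t)) h0 h1 h2
    (isDeriv_tr N 0 _) (isDeriv_tr N 1 _) (isDeriv_tr N 2 _) (isDeriv_tr N 3 _) k
  rw [add_assoc] at h
  exact h

set_option maxHeartbeats 400000 in
/-- The growing modes of the gauged normal form variable gain half a derivative at time `0`. -/
lemma sq_indicator_gauge_mul_normalForm_ne_top (hε : ε * ε = 1) (hσ : 1 / 2 < σ) (hT : 0 < T)
    (hU : UB (σ + 2) (fun t : Icc 0 T => U t))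
    (hd : ∀ t ∈ Icc 0 T, IsDeriv (U t) (U1 t)) (hd1 : ∀ t ∈ Icc 0 T, IsDeriv (U1 t) (U2 t))
    (hcU : ContinuousOn U (Icc 0 T)) (hcU1 : ContinuousOn U1 (Icc 0 T))
    (hmode : ∀ k : ℤ, ∀ t ∈ Ioo 0 T, HasDerivAt (fun t => cf (U t) k)
      ((ε : ℂ) * (Complex.I * (k : ℂ) ^ 2 * cf (U t) k + cf (ev F (U t) (U1 t)) k)) t)
    (hθ : (betaMean F (U 0) (U1 0)).im ≠ 0) :
    sq (σ + 1 / 2) ({k : ℤ | ε * k * (betaMean F (U 0) (U1 0)).im < 0}.indicator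
      (cf (gauge F (U 0) (U1 0) * normalForm F (U 0) (U1 0) (U2 0)))) ≠ ⊤ := by
  set θ := (betaMean F (U 0) (U1 0)).im with hθdef
  set S := {k : ℤ | ε * k * θ < 0} with hS
  have hθ' : 0 < |θ| := abs_pos.mpr hθ
  have hε1 : |ε| = 1 := by
    have : |ε| * |ε| = 1 := by rw [← abs_mul, hε, abs_one]
    nlinarith [abs_nonneg ε]
  obtain ⟨τ, hτ, hτT, N0, hN0⟩ := exists_betaMean_close F hσ hT hU hd hcU hcU1 (half_pos hθ')
  have hsub : Icc 0 τ ⊆ Icc 0 T := Icc_subset_Icc_right hτT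
  obtain ⟨CR, CW, hCR0, hCW0, A, hA0, hbd⟩ := exists_truncated_bounds F (ε := ε) hσ hU hd
  -- On `[0, τ]` and for large `N` the imaginary part of the mean differs from `θ` by at most
  -- `|θ|/2`, so the modes in `S` grow at least at half the limiting rate.
  set β := |θ| / 2 with hβ
  have hβ0 : 0 < β := half_pos hθ'
  set C := 2 / (β * τ) * CW + 2 / β * (2 * (CR + 1)) * τ with hC
  -- bound for the truncated problem
  have main : ∀ K : Finset ℤ, (∀ k ∈ K, k ∈ S) → ∃ N1 : ℕ, ∀ N ≥ N1,
      ∑ k ∈ K, bracket k * (bracket k ^ σ * ‖cf (gauge F (tr N 0 (U 0)) (tr N 1 (U 0)) *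
        normalForm F (tr N 0 (U 0)) (tr N 1 (U 0)) (tr N 2 (U 0))) k‖) ^ 2 ≤ C := by
    intro K hK
    -- The defect in mode `k` is at most `A k * η`, so its weighted square sum over `K` is at most
    -- `Q η²`; `η` is chosen to make this at most `1`. Only the threshold on `N` depends on `K`, and
    -- `C` does not.
    set Q := ∑ k ∈ K, (bracket k ^ σ * A k) ^ 2
    have hQ : 0 ≤ Q := Finset.sum_nonneg fun _ _ => sq_nonneg _
    set η := min 1 (1 / (Q + 1))
    have hη : 0 < η := by positivity
    obtain ⟨N1, hN1⟩ := exists_norm_tr_ev_sub_le F hσ hU hd hη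
    refine ⟨max N0 N1, fun N hN => ?_⟩
    have hNN0 := hN0 N (le_trans (le_max_left _ _) hN)
    have hNN1 := hN1 N (le_trans (le_max_right _ _) hN)
    have hk0 : ∀ k ∈ K, k ≠ 0 := fun k hk h => by
      have := hK k hk
      rw [hS, mem_ofPred_eq, h] at this
      simp at this
    have := energy_bound (K := K) (σ := σ) (β := β) (τ := τ) (C := 2 * (CR + 1)) (ε := ε) hβ0 hτ hε
      (w := fun k t => cf (gauge F (tr N 0 (U t)) (tr N 1 (U t)) *
        normalForm F (tr N 0 (U t)) (tr N 1 (U t)) (tr N 2 (U t))) k)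
      (ρ := fun k t => cf (remainder F ε (tr N 0 (U t)) (tr N 1 (U t)) (tr N 2 (U t)) (tr N 3 (U t))
          (tr N 0 (ev F (U t) (U1 t))) (tr N 1 (ev F (U t) (U1 t)))) k
        + cf (gauge F (tr N 0 (U t)) (tr N 1 (U t)) * (tr N 2 (ev F (U t) (U1 t))
          - (hess F (tr N 0 (U t)) (tr N 1 (U t)) (tr N 2 (U t))
            + dev F (tr N 0 (U t)) (tr N 1 (U t)) (tr N 2 (U t)) (tr N 3 (U t))))) k)
      (b := fun t => betaMean F (tr N 0 (U t)) (tr N 1 (U t))) hk0 ?_ ?_ ?_ ?_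
    · refine this.trans ?_
      rw [hC]
      gcongr
      exact (hbd N τ (hsub (right_mem_Icc.mpr hτ.le))).2.1 K
    · intro k _
      have hc : ∀ m, ContinuousOn (fun t => tr N m (U t)) (Icc 0 τ) := fun m =>
        (tr N m).continuous.comp_continuousOn (hcU.mono hsub)
      exact fun t ht => tendsto_cf_gauge_mul_normalForm F (hc 0 t ht) (hc 1 t ht) (hc 2 t ht) k
    · intro k _ t ht
      have htT : t ∈ Ioo 0 T := ⟨ht.1, ht.2.trans_le hτT⟩
      exact hasDerivAt_truncated F hε (fun k => hmode k t htT) N k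
    · intro k hk t ht
      have h1 := hNN0 t (Ioo_subset_Icc_self ht)
      have h2 : ε * k * θ < 0 := hK k hk
      have h3 : |ε * k * θ| = |(k : ℝ)| * |θ| := by rw [abs_mul, abs_mul, hε1, one_mul]
      rw [abs_of_neg h2] at h3
      set x := (betaMean F (tr N 0 (U t)) (tr N 1 (U t))).im
      have h4 : ε * k * (x - θ) ≤ |(k : ℝ)| * (|θ| / 2) := by
        refine (le_abs_self _).trans ?_
        rw [abs_mul, abs_mul, hε1, one_mul]
        gcongr
      rw [hβ]
      nlinarith
    · intro t ht
      have htT : t ∈ Icc 0 T := hsub (Ioo_subset_Icc_self ht)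
      have h1 := (hbd N t htT).1 K
      have h2 : ∑ k ∈ K, (bracket k ^ σ * ‖cf (gauge F (tr N 0 (U t)) (tr N 1 (U t)) *
          (tr N 2 (ev F (U t) (U1 t)) - (hess F (tr N 0 (U t)) (tr N 1 (U t)) (tr N 2 (U t))
            + dev F (tr N 0 (U t)) (tr N 1 (U t)) (tr N 2 (U t)) (tr N 3 (U t))))) k‖) ^ 2 ≤ 1 := by
        -- The defect is exactly the second derivative of the commutator of truncation and
        -- nonlinearity.
        have hdd := (isDeriv_tr N 0 (ev F (U t) (U1 t))).sub
          (isDeriv_ev F (isDeriv_tr N 0 (U t)) (isDeriv_tr N 1 (U t)))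
        have hdd1 := (isDeriv_tr N 1 (ev F (U t) (U1 t))).sub
          (isDeriv_dev F (isDeriv_tr N 0 (U t)) (isDeriv_tr N 1 (U t)) (isDeriv_tr N 2 (U t)))
        calc _ ≤ ∑ k ∈ K, (bracket k ^ σ * (A k * η)) ^ 2 := by
              refine Finset.sum_le_sum fun k _ => ?_
              have := bracket_pos k
              have := hA0 k
              gcongr
              exact ((hbd N t htT).2.2 k _ _ _ hdd hdd1).trans (by gcongr; exact hNN1 t htT)
          _ = Q * η ^ 2 := by
              rw [Finset.sum_mul]
              exact Finset.sum_congr rfl fun k _ => by ring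
          _ ≤ Q * η := by
              gcongr
              exact pow_le_of_le_one hη.le (min_le_left _ _) two_ne_zero
          _ ≤ Q * (1 / (Q + 1)) := by gcongr; exact min_le_right _ _
          _ ≤ 1 := by rw [mul_one_div, div_le_one (by linarith)]; linarith
      calc _ ≤ ∑ k ∈ K, 2 * ((bracket k ^ σ * ‖cf (remainder F ε (tr N 0 (U t)) (tr N 1 (U t))
              (tr N 2 (U t)) (tr N 3 (U t)) (tr N 0 (ev F (U t) (U1 t)))
              (tr N 1 (ev F (U t) (U1 t)))) k‖) ^ 2
            + (bracket k ^ σ * ‖cf (gauge F (tr N 0 (U t)) (tr N 1 (U t)) *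
              (tr N 2 (ev F (U t) (U1 t)) - (hess F (tr N 0 (U t)) (tr N 1 (U t)) (tr N 2 (U t))
              + dev F (tr N 0 (U t)) (tr N 1 (U t)) (tr N 2 (U t)) (tr N 3 (U t))))) k‖) ^ 2) := by
            refine Finset.sum_le_sum fun k _ => ?_
            have := bracket_pos k
            refine le_trans ?_ (add_sq_le (a := _) (b := _))
            rw [← mul_add]
            gcongr
            exact norm_add_le _ _
        _ ≤ 2 * (CR + 1) := by
            rw [← Finset.mul_sum, Finset.sum_add_distrib]
            gcongr
  -- passage to the limit
  refine ne_top_of_le_ne_top ENNReal.ofReal_ne_top (sq_indicator_le (C := C) fun K hK => ?_)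
  obtain ⟨N1, hN1⟩ := main K hK
  have h0T : (0 : ℝ) ∈ Icc 0 T := left_mem_Icc.mpr hT.le
  have hlim : ∀ m : ℕ, ∀ g : CT, UB σ (fun _ : Unit => g) →
      (∀ k : ℤ, cf g k = (Complex.I * k) ^ m * cf (U 0) k) →
      Tendsto (fun N => tr N m (U 0)) atTop (𝓝 g) := by
    intro m g hg hgk
    rw [Metric.tendsto_atTop]
    intro η hη
    obtain ⟨M, hM⟩ := exists_norm_tr_sub_le hσ (f := fun _ : Unit => U 0) (m := m) hg
      (fun _ => hgk) (half_pos hη)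
    exact ⟨M, fun N hN => by
      rw [dist_eq_norm]
      exact (hM N hN ()).trans_lt (half_lt_self hη)⟩
  have hU0 : UB (σ + 2) (fun _ : Unit => U 0) := by
    obtain ⟨D, hD, h⟩ := hU
    exact ⟨D, hD, fun _ => h ⟨0, h0T⟩⟩
  have hU10 : UB (σ + 1) (fun _ : Unit => U1 0) :=
    (hU0.mono (q := σ + 1 + 1) (by linarith)).isDeriv fun _ => hd 0 h0T
  have hU20 : UB σ (fun _ : Unit => U2 0) := hU10.isDeriv fun _ => hd1 0 h0T
  have l0 := hlim 0 (U 0) (hU0.mono (by linarith)) (fun k => by simp)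
  have l1 := hlim 1 (U1 0) (hU10.mono (by linarith)) (fun k => by rw [hd 0 h0T k, pow_one])
  have l2 := hlim 2 (U2 0) hU20 (fun k => by rw [hd1 0 h0T k, hd 0 h0T k]; ring)
  have hW : ∀ k, Tendsto (fun N => cf (gauge F (tr N 0 (U 0)) (tr N 1 (U 0)) *
        normalForm F (tr N 0 (U 0)) (tr N 1 (U 0)) (tr N 2 (U 0))) k) atTop
      (𝓝 (cf (gauge F (U 0) (U1 0) * normalForm F (U 0) (U1 0) (U2 0)) k)) := fun k =>
    tendsto_cf_gauge_mul_normalForm F l0 l1 l2 k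
  refine le_of_tendsto (tendsto_finsetSum K fun k _ =>
    ((((hW k).norm).const_mul (bracket k ^ σ)).pow 2).const_mul (bracket k)) ?_
  exact eventually_atTop.mpr ⟨N1, hN1⟩

end Smoothing

/-! ### Undoing the gauge and the normal form -/

lemma tsum_enorm_ne_top_of_sq_ne_top {r : ℝ} (hr : 1 / 2 < r) {a : ℤ → ℂ} (h : sq r a ≠ ⊤) :
    ∑' k, ‖a k‖ₑ ≠ ⊤ := by
  have h1 := tsum_enorm_sq_le (r := r) a
  have hw := tsum_wt_ne_top (p := -2 * r) (by linarith)
  have h2 : (∑' k, ‖a k‖ₑ) ^ 2 ≠ ⊤ := ne_top_of_le_ne_top (by finiteness) h1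
  simpa using h2

lemma UB.ne_top {ι : Type*} {r : ℝ} {f : ι → CT} (h : UB r f) (i : ι) : sq r (cf (f i)) ≠ ⊤ := by
  obtain ⟨C, hC, h⟩ := h
  exact ne_top_of_le_ne_top hC (h i)

lemma exp_neg_mul_exp (g : CT) : NormedSpace.exp (-g) * NormedSpace.exp g = 1 := by
  let _ : NormedAlgebra ℚ CT := NormedAlgebra.restrictScalars ℚ ℂ CT
  rw [← NormedSpace.exp_add, neg_add_cancel, NormedSpace.exp_zero]

/-- The growing modes of the second derivative of the data gain half a derivative. -/
lemma sq_indicator_second_deriv_ne_top (F : MvPolynomial (Fin 4) ℂ) {ε σ T : ℝ} {U U1 U2 : ℝ → CT}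
    (hε : ε * ε = 1) (hσ : 1 / 2 < σ) (hT : 0 < T)
    (hU : UB (σ + 2) (fun t : Icc 0 T => U t))
    (hd : ∀ t ∈ Icc 0 T, IsDeriv (U t) (U1 t)) (hd1 : ∀ t ∈ Icc 0 T, IsDeriv (U1 t) (U2 t))
    (hcU : ContinuousOn U (Icc 0 T)) (hcU1 : ContinuousOn U1 (Icc 0 T))
    (hmode : ∀ k : ℤ, ∀ t ∈ Ioo 0 T, HasDerivAt (fun t => cf (U t) k)
      ((ε : ℂ) * (Complex.I * (k : ℂ) ^ 2 * cf (U t) k + cf (ev F (U t) (U1 t)) k)) t)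
    (hθ : (betaMean F (U 0) (U1 0)).im ≠ 0) :
    sq (σ + 1 / 2) ({k : ℤ | ε * k * (betaMean F (U 0) (U1 0)).im < 0}.indicator
      (cf (U2 0))) ≠ ⊤ := by
  have hW := sq_indicator_gauge_mul_normalForm_ne_top F hε hσ hT hU hd hd1 hcU hcU1 hmode hθ
  set θ := (betaMean F (U 0) (U1 0)).im with hθdef
  set S := {k : ℤ | ε * k * θ < 0} with hS
  have h0T : (0 : ℝ) ∈ Icc 0 T := left_mem_Icc.mpr hT.le
  have hU0 : UB (σ + 2) (fun _ : Unit => U 0) := by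
    obtain ⟨D, hD, h⟩ := hU
    exact ⟨D, hD, fun _ => h ⟨0, h0T⟩⟩
  have hU10 : UB (σ + 1) (fun _ : Unit => U1 0) :=
    (hU0.mono (q := σ + 1 + 1) (by linarith)).isDeriv fun _ => hd 0 h0T
  have hU20 : UB σ (fun _ : Unit => U2 0) := hU10.isDeriv fun _ => hd1 0 h0T
  have hU0' := hU0.mono (q := σ) (by linarith)
  have hU10' := hU10.mono (q := σ) (by linarith)
  set W := gauge F (U 0) (U1 0) * normalForm F (U 0) (U1 0) (U2 0) with hWdef
  have bW : UB σ (fun _ : Unit => W) := ((UB.gauge F hσ hU0' hU10').mono (by linarith)).mul hσ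
    (UB.normalForm F hσ hU0' hU10' hU20)
  -- The inverse of the gauge factor, one derivative smoother than `W`.
  set E' := NormedSpace.exp (-((Complex.I / 2) • prim (ev (MvPolynomial.pderiv 1 F) (U 0) (U1 0))))
    with hE'
  have bE' : UB (σ + 1) (fun _ : Unit => E') := UB.exp (by linarith)
    ((UB.ev hσ (MvPolynomial.pderiv 1 F) hU0' hU10').prim.smul _).neg
  have hV : normalForm F (U 0) (U1 0) (U2 0) = E' * W := by
    rw [hWdef, ← mul_assoc, hE', gauge, exp_neg_mul_exp, one_mul]
  -- `S` consists of the integers of one strict sign, so `l` is zero or of the sign opposite to `k`,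
  -- and `|k - l| = |k| + |l|`.
  have hSl : ∀ k ∈ S, ∀ l ∉ S, |k| ≤ |k - l| := by
    intro k hk l hl
    have hk' : (k : ℝ) * (ε * θ) < 0 := by
      have : ε * k * θ < 0 := hk
      linarith [this]
    have hl' : 0 ≤ (l : ℝ) * (ε * θ) := by
      have : ¬ (ε * l * θ < 0) := hl
      push Not at this
      linarith [this]
    rcases lt_trichotomy (ε * θ) 0 with h | h | h
    · have h1 : (0 : ℝ) < k := by nlinarith
      have h2 : (l : ℝ) ≤ 0 := by nlinarith
      have h1' : 0 < k := by exact_mod_cast h1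
      have h2' : l ≤ 0 := by exact_mod_cast h2
      rw [abs_of_pos h1', abs_of_pos (by linarith)]
      linarith
    · rw [h] at hk'; simp at hk'
    · have h1 : (k : ℝ) < 0 := by nlinarith
      have h2 : (0 : ℝ) ≤ l := by nlinarith
      have h1' : k < 0 := by exact_mod_cast h1
      have h2' : 0 ≤ l := by exact_mod_cast h2
      rw [abs_of_neg h1', abs_of_neg (by linarith)]
      linarith
  have h1 := sq_conv_one_sided (r := σ + 1 / 2) (by linarith) hSl (enorm_cf_mul_le E' W)
  have h2 : sq (σ + 1 / 2) (S.indicator (cf (normalForm F (U 0) (U1 0) (U2 0)))) ≠ ⊤ := by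
    rw [hV]
    refine ne_top_of_le_ne_top ?_ h1
    have e1 := tsum_enorm_ne_top_of_sq_ne_top hσ (bW.ne_top ())
    have e2 := tsum_enorm_ne_top_of_sq_ne_top hσ ((bE'.mono (q := σ) (by linarith)).ne_top ())
    have e3 := (bE'.mono (q := σ + 1 / 2) (by linarith)).ne_top ()
    finiteness
  have bG : UB (σ + 1 / 2) (fun _ : Unit => (-(Complex.I / 2)) • ev F (U 0) (U1 0)) :=
    (UB.ev (by linarith) F (hU0.mono (by linarith)) (hU10.mono (by linarith))).smul _
  have hsplit : S.indicator (cf (U2 0)) =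
      S.indicator (cf (normalForm F (U 0) (U1 0) (U2 0))) +
        S.indicator (cf ((-(Complex.I / 2)) • ev F (U 0) (U1 0))) := by
    rw [← indicator_add', ← cf_add, normalForm, neg_smul, add_neg_cancel_right]
  rw [hsplit]
  refine ne_top_of_le_ne_top ?_ (sq_add_le _ _ _)
  have h3 : sq (σ + 1 / 2) (S.indicator (cf ((-(Complex.I / 2)) • ev F (U 0) (U1 0)))) ≠ ⊤ := by
    refine ne_top_of_le_ne_top (bG.ne_top ()) (sq_mono_of_le fun k => ?_)
    by_cases hk : k ∈ S
    · rw [indicator_of_mem hk]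
    · rw [indicator_of_notMem hk]; simp
  finiteness

/-! ### The embedding of `Hˢ` into continuous functions -/

lemma tsum_enorm_weightedCoeff_sq {s : ℝ} (f : Sobolev s) :
    sq s (fourierCoeff (f.toL2 : Torus → ℂ)) = ‖f‖ₑ ^ 2 := by
  have h1 : ‖f‖ = ‖Sobolev.toSeq s f‖ := rfl
  have h2 := lp.norm_rpow_eq_tsum (p := 2) (by simp) (Sobolev.toSeq s f)
  have h3 := (lp.memℓp (Sobolev.toSeq s f)).summable (p := 2) (by simp)
  simp only [ENNReal.toReal_ofNat, Real.rpow_ofNat] at h2 h3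
  rw [← ofReal_norm, ← ENNReal.ofReal_pow (norm_nonneg _), h1, h2,
    ENNReal.ofReal_tsum_of_nonneg (fun _ => by positivity) h3]
  unfold sq
  congr 1; ext k
  rw [sq_term_eq]
  congr 2
  change _ = ‖weightedCoeff s f.toL2 k‖
  rw [weightedCoeff, norm_mul, Complex.norm_real, Real.norm_of_nonneg]
  exact Real.rpow_nonneg (bracket_pos k).le s

lemma fourierCoeff_add_L2 (f g : L2T) (k : ℤ) : fourierCoeff ((f + g : L2T) : Torus → ℂ) k =
    fourierCoeff (f : Torus → ℂ) k + fourierCoeff (g : Torus → ℂ) k := by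
  simp_rw [← fourierBasis_repr, map_add]; rfl

lemma fourierCoeff_smul_L2 (c : ℂ) (f : L2T) (k : ℤ) :
    fourierCoeff ((c • f : L2T) : Torus → ℂ) k = c * fourierCoeff (f : Torus → ℂ) k := by
  simp_rw [← fourierBasis_repr, map_smul]; rfl

/-- The coefficients of the `m`-th derivative. -/
def derivCoeff {s : ℝ} (m : ℕ) (f : Sobolev s) (k : ℤ) : ℂ :=
  (Complex.I * k) ^ m * fourierCoeff (f.toL2 : Torus → ℂ) k

lemma sq_derivCoeff_le {s : ℝ} (m : ℕ) (f : Sobolev s) :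
    sq (s - m) (derivCoeff m f) ≤ ‖f‖ₑ ^ 2 := by
  rw [← tsum_enorm_weightedCoeff_sq]
  refine ENNReal.tsum_le_tsum fun k => pow_le_pow_left' ?_ 2
  rw [derivCoeff, enorm_mul, enorm_pow, ← mul_assoc]
  have hw : wt s k = wt (s - m) k * wt m k := by rw [← wt_add, sub_add_cancel]
  rw [hw]
  gcongr
  refine (pow_le_pow_left' (enorm_I_mul_intCast_le_wt k) m).trans (le_of_eq ?_)
  rw [wt, wt, ← ENNReal.ofReal_pow (by have := bracket_pos k; positivity), Real.rpow_one,
    Real.rpow_natCast]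

lemma summable_derivCoeff {s : ℝ} {m : ℕ} (hs : m + 1 / 2 < s) (f : Sobolev s) :
    Summable (derivCoeff m f) := by
  have h1 : sq (s - m) (derivCoeff m f) ≠ ⊤ :=
    ne_top_of_le_ne_top (by finiteness) (sq_derivCoeff_le m f)
  have h2 := tsum_enorm_ne_top_of_sq_ne_top (by linarith) h1
  refine Summable.of_norm ?_
  have := ENNReal.summable_toReal h2
  simpa using this

/-- The `m`-th derivative of a function in `Hˢ` as a continuous function, `s > m + 1/2`. -/
def derivCT {s : ℝ} (m : ℕ) (f : Sobolev s) : CT := syn (derivCoeff m f)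

section

variable {s : ℝ} {m : ℕ}

lemma cf_derivCT (hs : m + 1 / 2 < s) (f : Sobolev s) : cf (derivCT m f) = derivCoeff m f :=
  cf_syn (summable_derivCoeff hs f)

lemma isDeriv_derivCT (hs : (m + 1 : ℕ) + 1 / 2 < s) (f : Sobolev s) :
    IsDeriv (derivCT m f) (derivCT (m + 1) f) := fun k => by
  rw [cf_derivCT hs, cf_derivCT (by push_cast at hs; linarith), derivCoeff, derivCoeff]
  ring

/-- The Sobolev embedding: a linear map, bounded because the `ℓ¹` norm of the coefficients dominates
the sup norm. -/
lemma continuous_derivCT (hs : m + 1 / 2 < s) : Continuous (derivCT m : Sobolev s → CT) := by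
  let L : Sobolev s →ₗ[ℂ] CT :=
    { toFun := derivCT m
      map_add' := fun f g => cf_injective (by
        rw [cf_add, cf_derivCT hs, cf_derivCT hs, cf_derivCT hs]
        ext k
        simp only [derivCoeff, Pi.add_apply]
        rw [← mul_add, ← fourierCoeff_add_L2]; rfl)
      map_smul' := fun c f => cf_injective (by
        rw [RingHom.id_apply, cf_smul, cf_derivCT hs, cf_derivCT hs]
        ext k
        simp only [derivCoeff, Pi.smul_apply, smul_eq_mul]
        have e : fourierCoeff ((c • f).toL2 : Torus → ℂ) k = c * fourierCoeff (f.toL2 : Torus → ℂ) k :=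
          fourierCoeff_smul_L2 c f.toL2 k
        rw [e]; ring) }
  have hw := tsum_wt_ne_top (p := -2 * (s - m)) (by linarith)
  set D := 2 * ∑' k, wt (-2 * (s - m)) k with hD
  have hDt : D ≠ ⊤ := by finiteness
  refine AddMonoidHomClass.continuous_of_bound L (Real.sqrt D.toReal) fun f => ?_
  change ‖derivCT m f‖ ≤ _
  have h1 : ‖derivCT m f‖ₑ ^ 2 ≤ D * ‖f‖ₑ ^ 2 := by
    refine (pow_le_pow_left' (enorm_le_tsum_cf _) 2).trans ?_
    rw [cf_derivCT hs]
    refine (tsum_enorm_sq_le (r := s - m) _).trans ?_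
    gcongr
    exact sq_derivCoeff_le m f
  have h2 := ENNReal.toReal_mono (by finiteness) h1
  simp only [ENNReal.toReal_pow, ENNReal.toReal_mul, toReal_enorm] at h2
  rw [← Real.sqrt_sq (norm_nonneg f), ← Real.sqrt_mul ENNReal.toReal_nonneg]
  exact Real.le_sqrt_of_sq_le h2

end

lemma toLp_eq_of_fourierCoeff {f : L2T} {g : CT}
    (h : ∀ k, fourierCoeff (f : Torus → ℂ) k = cf g k) :
    f = ContinuousMap.toLp 2 torusMeasure ℂ g := by
  apply (fourierBasis (T := 2 * Real.pi)).repr.injective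
  ext k
  rw [toLp_repr, fourierBasis_repr, h]

lemma ae_eq_of_fourierCoeff {f : L2T} {g : CT}
    (h : ∀ k, fourierCoeff (f : Torus → ℂ) k = cf g k) : (f : Torus → ℂ) =ᵐ[torusMeasure] g := by
  rw [toLp_eq_of_fourierCoeff h]
  exact ContinuousMap.coeFn_toLp (E := ℂ) (p := 2) (𝕜 := ℂ) torusMeasure g

lemma fourierCoeff_fourierMultiplier {m : ℤ → ℂ} {f : L2T}
    (h : Memℓp (fun k => m k * fourierCoeff (f : Torus → ℂ) k) 2) (k : ℤ) :
    fourierCoeff (fourierMultiplier m f : Torus → ℂ) k = m k * fourierCoeff (f : Torus → ℂ) k := by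
  rw [fourierMultiplier, dif_pos h, ← fourierBasis_repr, LinearIsometryEquiv.apply_symm_apply]

lemma memℓp_two_of_tsum_ne_top {a : ℤ → ℂ} (h : ∑' k, ‖a k‖ₑ ^ 2 ≠ ⊤) : Memℓp a 2 := by
  refine memℓp_gen ?_
  have := ENNReal.summable_toReal h
  simpa using this

lemma toL2_ae_eq {s : ℝ} (hs : 1 / 2 < s) (f : Sobolev s) :
    (f.toL2 : Torus → ℂ) =ᵐ[torusMeasure] derivCT 0 f :=
  ae_eq_of_fourierCoeff fun k => by
    rw [cf_derivCT (by simpa using hs), derivCoeff]; simp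

lemma dx_ae_eq {s : ℝ} (hs : 3 / 2 < s) (f : Sobolev s) :
    (dx f.toL2 : Torus → ℂ) =ᵐ[torusMeasure] derivCT 1 f := by
  refine ae_eq_of_fourierCoeff fun k => ?_
  rw [cf_derivCT (by push_cast; linarith), derivCoeff, pow_one, dx, fourierCoeff_fourierMultiplier]
  -- Square summability has to be verified, since otherwise the multiplier takes its default value
  -- `0`.
  refine memℓp_two_of_tsum_ne_top ?_
  have h1 := (sq_mono (show (0 : ℝ) ≤ s - (1 : ℕ) by push_cast; linarith) (derivCoeff 1 f)).trans
    (sq_derivCoeff_le 1 f)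
  have h2 : sq 0 (derivCoeff 1 f) ≠ ⊤ := ne_top_of_le_ne_top (by finiteness) h1
  simpa [sq, wt_zero, derivCoeff] using h2

/-! ### From the weak formulation to the Fourier modes -/

/-- Compare `h` with `Φ t = c + ∫₀ᵗ f`. Testing against primitives of bump functions `g` and
integrating by parts gives `∫ g (h - Φ) = 0`, and continuity upgrades equality almost everywhere to
equality on `[0, T]`. -/
lemma eq_add_integral_of_weak_of_continuous {h f : ℝ → ℂ} {c : ℂ} {T : ℝ} (hT : 0 < T)
    (hh : Continuous h) (hf : Continuous f)
    (H : ∀ η : ℝ → ℝ, ContDiff ℝ ((⊤ : ℕ∞) : WithTop ℕ∞) η →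
      (∃ T' < T, ∀ t, T' ≤ t → η t = 0) →
      -(∫ t in (0 : ℝ)..T, ((deriv η t : ℝ) : ℂ) * h t) - c * η 0 = ∫ t in (0 : ℝ)..T, (η t : ℂ) * f t) :
    ∀ t ∈ Icc 0 T, h t = c + ∫ s in (0 : ℝ)..t, f s := by
  set Φ : ℝ → ℂ := fun t => c + ∫ s in (0 : ℝ)..t, f s with hΦ
  have hΦd : ∀ t, HasDerivAt Φ (f t) t := fun t =>
    (intervalIntegral.integral_hasDerivAt_right (hf.intervalIntegrable _ _)
      (hf.stronglyMeasurableAtFilter _ _) hf.continuousAt).const_add c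
  have hΦc : Continuous Φ := continuous_iff_continuousAt.mpr fun t => (hΦd t).continuousAt
  have key : ∀ᵐ t, t ∈ Ioo 0 T → h t - Φ t = 0 := by
    refine isOpen_Ioo.ae_eq_zero_of_integral_contDiff_smul_eq_zero
      ((hh.sub hΦc).locallyIntegrable.locallyIntegrableOn _) fun g hg hgc hgT => ?_
    -- The primitive based at `T` vanishes near `T`, as a test function must, but not necessarily at
    -- `0`; this is how the initial value `c` enters.
    set η : ℝ → ℝ := fun t => ∫ s in T..t, g s with hη
    have hηd : ∀ t, HasDerivAt η (g t) t := fun t =>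
      intervalIntegral.integral_hasDerivAt_right (hg.continuous.intervalIntegrable _ _)
        (hg.continuous.stronglyMeasurableAtFilter _ _) hg.continuous.continuousAt
    have hderiv : deriv η = g := funext fun t => (hηd t).deriv
    have hg0 : ∀ t, t ∉ Ioo 0 T → g t = 0 := fun t ht =>
      image_eq_zero_of_notMem_tsupport fun h => ht (hgT h)
    have hηs : ContDiff ℝ ((⊤ : ℕ∞) : WithTop ℕ∞) η := by
      rw [contDiff_infty_iff_deriv, hderiv]
      exact ⟨fun t => (hηd t).differentiableAt, hg⟩
    have hTs : T ∉ tsupport g := fun h => lt_irrefl _ (hgT h).2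
    obtain ⟨e, he, hball⟩ := Metric.eventually_nhds_iff_ball.mp
      (notMem_tsupport_iff_eventuallyEq.mp hTs)
    have hη0 : ∀ t, T - e / 2 ≤ t → η t = 0 := by
      intro t ht
      refine intervalIntegral.integral_zero_ae (.of_forall fun x hx => ?_)
      rcases lt_or_ge x T with hxT | hxT
      · have hx1 : T - e / 2 ≤ x := (le_min (by linarith) ht).trans hx.1.le
        exact hball x (by rw [Metric.mem_ball, Real.dist_eq, abs_lt]; constructor <;> linarith)
      · exact hg0 x fun h => by linarith [h.2]
    have h1 := H η hηs ⟨T - e / 2, by linarith, hη0⟩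
    have hηC : ∀ t, HasDerivAt (fun t => (η t : ℂ)) (g t : ℂ) t := fun t => (hηd t).ofReal_comp
    have hgC : Continuous fun t => (g t : ℂ) := Complex.continuous_ofReal.comp hg.continuous
    have h2 := intervalIntegral.integral_mul_deriv_eq_deriv_mul (a := 0) (b := T)
      (fun t _ => hηC t) (fun t _ => hΦd t) (hgC.intervalIntegrable _ _)
      (hf.intervalIntegrable _ _)
    rw [h2, hη0 T (by linarith), hderiv] at h1
    have h3 : Φ 0 = c := by simp [hΦ]
    rw [h3] at h1
    have h4 : ∫ t in (0 : ℝ)..T, (g t : ℂ) * (h t - Φ t) = 0 := by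
      simp_rw [mul_sub]
      have h5 : IntervalIntegrable (fun t => (g t : ℂ) * h t) volume 0 T :=
        (hgC.mul hh).intervalIntegrable _ _
      have h6 : IntervalIntegrable (fun t => (g t : ℂ) * Φ t) volume 0 T :=
        (hgC.mul hΦc).intervalIntegrable _ _
      rw [intervalIntegral.integral_sub h5 h6]
      push_cast at h1
      linear_combination -h1
    rw [intervalIntegral.integral_of_le hT.le,
      setIntegral_eq_integral_of_forall_compl_eq_zero] at h4
    · simpa using h4
    · intro t ht
      rw [hg0 t fun h => ht ⟨h.1, h.2.le⟩]; simp
  have key' : h =ᵐ[volume.restrict (Icc 0 T)] Φ := by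
    rw [← restrict_Ioo_eq_restrict_Icc]
    rw [EventuallyEq, ae_restrict_iff' measurableSet_Ioo]
    filter_upwards [key] with t ht h using sub_eq_zero.mp (ht h)
  exact Measure.eqOn_Icc_of_ae_eq volume hT.ne key' hh.continuousOn hΦc.continuousOn

/-- A weak solution of `h' = f`, `h 0 = c` is a classical one. -/
lemma hasDerivAt_of_weak {h f : ℝ → ℂ} {c : ℂ} {T : ℝ} (hT : 0 < T)
    (hh : ContinuousOn h (Icc 0 T)) (hf : ContinuousOn f (Icc 0 T))
    (H : ∀ η : ℝ → ℝ, ContDiff ℝ ((⊤ : ℕ∞) : WithTop ℕ∞) η →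
      (∃ T' < T, ∀ t, T' ≤ t → η t = 0) →
      -(∫ t in (0 : ℝ)..T, ((deriv η t : ℝ) : ℂ) * h t) - c * η 0 = ∫ t in (0 : ℝ)..T, (η t : ℂ) * f t) :
    h 0 = c ∧ ∀ t ∈ Ioo 0 T, HasDerivAt h (f t) t := by
  -- Constant extension outside `[0, T]` makes both functions continuous on all of `ℝ` without
  -- changing the integrals.
  set h' := IccExtend hT.le ((Icc 0 T).domRestrict h) with hh'
  set f' := IccExtend hT.le ((Icc 0 T).domRestrict f) with hf'
  have eh : ∀ t ∈ Icc 0 T, h' t = h t := fun t ht => IccExtend_of_mem _ _ ht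
  have ef : ∀ t ∈ Icc 0 T, f' t = f t := fun t ht => IccExtend_of_mem _ _ ht
  have ch : Continuous h' := hh.domRestrict.Icc_extend'
  have cf : Continuous f' := hf.domRestrict.Icc_extend'
  have key := eq_add_integral_of_weak_of_continuous (c := c) hT ch cf fun η hη hη0 => by
    have e1 : ∫ t in (0 : ℝ)..T, ((deriv η t : ℝ) : ℂ) * h' t =
        ∫ t in (0 : ℝ)..T, ((deriv η t : ℝ) : ℂ) * h t :=
      intervalIntegral.integral_congr fun t ht => by
        rw [uIcc_of_le hT.le] at ht
        simp only [eh t ht]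
    have e2 : ∫ t in (0 : ℝ)..T, (η t : ℂ) * f' t = ∫ t in (0 : ℝ)..T, (η t : ℂ) * f t :=
      intervalIntegral.integral_congr fun t ht => by
        rw [uIcc_of_le hT.le] at ht
        simp only [ef t ht]
    rw [e1, e2]
    exact H η hη hη0
  have h0 : (0 : ℝ) ∈ Icc 0 T := left_mem_Icc.mpr hT.le
  refine ⟨by rw [← eh 0 h0, key 0 h0]; simp, fun t ht => ?_⟩
  rw [← ef t (Ioo_subset_Icc_self ht)]
  have hd : HasDerivAt (fun t => c + ∫ s in (0 : ℝ)..t, f' s) (f' t) t :=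
    (intervalIntegral.integral_hasDerivAt_right (cf.intervalIntegrable _ _)
      (cf.stronglyMeasurableAtFilter _ _) cf.continuousAt).const_add c
  refine hd.congr_of_eventuallyEq ?_
  filter_upwards [Icc_mem_nhds ht.1 ht.2] with x hx
  rw [← eh x hx, key x hx]

lemma contDiff_fourier (n : ℤ) :
    ContDiff ℝ ((⊤ : ℕ∞) : WithTop ℕ∞) (fun y : ℝ => fourier n (y : Torus)) := by
  simp_rw [fourier_coe_apply]
  have h : ContDiff ℝ ((⊤ : ℕ∞) : WithTop ℕ∞) (fun y : ℝ => (y : ℂ)) := Complex.ofRealCLM.contDiff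
  exact ((contDiff_const.mul h).div_const _).cexp

lemma smoothST_mul_fourier {η : ℝ → ℝ} (hη : ContDiff ℝ ((⊤ : ℕ∞) : WithTop ℕ∞) η) (n : ℤ) :
    SmoothST (fun t x => (η t : ℂ) * fourier n x) := by
  have h1 : ContDiff ℝ ((⊤ : ℕ∞) : WithTop ℕ∞) fun p : ℝ × ℝ => (η p.1 : ℂ) :=
    Complex.ofRealCLM.contDiff.comp (hη.comp contDiff_fst)
  exact h1.mul ((contDiff_fourier n).comp contDiff_snd)

lemma torusDeriv_const_mul_fourier (c : ℂ) (n : ℤ) :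
    torusDeriv (fun x => c * fourier n x) = fun x => (Complex.I * n * c) * fourier n x := by
  funext x
  induction x using QuotientAddGroup.induction_on with
  | H x =>
    have h1 := (hasDerivAt_fourier (2 * Real.pi) n (x + 0)).comp_const_add x 0
    have h2 := (h1.const_mul c).deriv
    have hpi : (Real.pi : ℂ) ≠ 0 := Complex.ofReal_ne_zero.mpr Real.pi_ne_zero
    refine Eq.trans ?_ (h2.trans ?_)
    · rfl
    · rw [add_zero]
      push_cast
      field_simp

lemma pairing_const_mul_fourier {f : Torus → ℂ} {g : CT} (h : f =ᵐ[torusMeasure] g) (c : ℂ)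
    (k : ℤ) : pairing f (fun x => c * fourier (-k) x) = c * cf g k := by
  rw [pairing, cf, coef_apply, fourierCoeff, ← integral_const_mul]
  refine integral_congr_ae ?_
  filter_upwards [h] with x hx
  rw [hx, smul_eq_mul]
  ring

/-! ### The Wirtinger derivative -/

/-- The chain rule for `ev`, applied to constant functions on the torus and evaluated at a point. -/
lemma hasDerivAt_nonlin (F : MvPolynomial (Fin 4) ℂ) (a b z : ℂ) :
    HasDerivAt (fun r : ℝ => nonlin F a (b + z * r))
      (nonlin (MvPolynomial.pderiv 1 F) a b * z +
        nonlin (MvPolynomial.pderiv 3 F) a b * conj z) 0 := by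
  have h0 : HasDerivAt (fun r : ℝ => b + z * (r : ℂ)) z 0 := by
    have := ((hasDerivAt_id (0 : ℝ)).ofReal_comp.const_mul z).const_add b
    simpa using this
  have h1 : HasDerivAt (fun r : ℝ => (b + z * (r : ℂ)) • (1 : CT)) (z • (1 : CT)) 0 :=
    h0.smul_const 1
  have h2 := HasDerivAt.ev F (hasDerivAt_const (0 : ℝ) (a • (1 : CT))) h1
  have h3 := (ContinuousMap.evalCLM ℝ (0 : Torus)).hasFDerivAt.comp_hasDerivAt (0 : ℝ) h2
  refine (h3.congr_deriv ?_).congr_of_eventuallyEq (.of_forall fun r => ?_)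
  · simp [dev, Fin.sum_univ_four, jet, ev_apply, mul_comm]
  · simp [ev_apply]

/-- In the combination of the directions `1` and `i` the contributions of the slot `β̄` cancel and
those of `β` add up, so the Wirtinger derivative is the formal partial derivative. -/
lemma nonlinBeta_eq (F : MvPolynomial (Fin 4) ℂ) (a b : ℂ) :
    nonlinBeta F a b = nonlin (MvPolynomial.pderiv 1 F) a b := by
  have h1 := (hasDerivAt_nonlin F a b 1).deriv
  have h2 := (hasDerivAt_nonlin F a b Complex.I).deriv
  simp only [one_mul, map_one, Complex.conj_I] at h1 h2
  rw [nonlinBeta, h1, h2]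
  linear_combination (-(1 / 2) * nonlin (MvPolynomial.pderiv 1 F) a b +
    1 / 2 * nonlin (MvPolynomial.pderiv 3 F) a b) * Complex.I_mul_I

lemma imBetaMean_eq (F : MvPolynomial (Fin 4) ℂ) {s : ℝ} (hs : 3 / 2 < s) (φ : Sobolev s) :
    imBetaMean F φ.toL2 = (betaMean F (derivCT 0 φ) (derivCT 1 φ)).im := by
  set g := ev (MvPolynomial.pderiv 1 F) (derivCT 0 φ) (derivCT 1 φ) with hg
  have h1 : imBetaMean F φ.toL2 = ∫ x, (g x).im ∂torusMeasure := by
    refine integral_congr_ae ?_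
    filter_upwards [toL2_ae_eq (by linarith) φ, dx_ae_eq hs φ] with x h1 h2
    rw [h1, h2, nonlinBeta_eq, hg, ev_apply]
  have h2 : betaMean F (derivCT 0 φ) (derivCT 1 φ) = ∫ x, g x ∂torusMeasure := by
    rw [betaMean, cf, coef_apply, fourierCoeff]
    simp [hg]
  rw [h1, h2]
  exact integral_im (𝕜 := ℂ) (g.continuous.integrable_of_hasCompactSupport
    (HasCompactSupport.of_compactSpace _))

/-! ### Gain of regularity -/

lemma eq_of_cf_derivCT_zero_eq {s : ℝ} (hs : 1 / 2 < s) {f g : Sobolev s}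
    (h : ∀ k, cf (derivCT 0 f) k = cf (derivCT 0 g) k) : f = g := by
  refine Subtype.ext ((fourierBasis (T := 2 * Real.pi)).repr.injective (lp.ext (funext fun k => ?_)))
  rw [fourierBasis_repr, fourierBasis_repr]
  have := h k
  rw [cf_derivCT (by simpa using hs), cf_derivCT (by simpa using hs)] at this
  simp only [derivCoeff, pow_zero, one_mul] at this
  exact this

/-- The weak equation is needed only against characters in space. Both time directions are covered:
`ε = 1` forward, `ε = -1` after reversing time. -/
lemma sq_indicator_derivCT_ne_top (F : MvPolynomial (Fin 4) ℂ) {ε s T : ℝ} (hε : ε * ε = 1)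
    (hs : 5 / 2 < s) (hT : 0 < T) {φ : Sobolev s} {w : ℝ → Sobolev s}
    (hw : ContinuousOn w (Icc 0 T))
    (H : ∀ (k : ℤ) (η : ℝ → ℝ), ContDiff ℝ ((⊤ : ℕ∞) : WithTop ℕ∞) η →
      (∃ T' < T, ∀ t, T' ≤ t → η t = 0) →
      -(∫ t in (0 : ℝ)..T, ((deriv η t : ℝ) : ℂ) * cf (derivCT 0 (w t)) k)
        - cf (derivCT 0 φ) k * η 0 =
      ∫ t in (0 : ℝ)..T, (η t : ℂ) * (ε * (Complex.I * (k : ℂ) ^ 2 * cf (derivCT 0 (w t)) k +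
        cf (ev F (derivCT 0 (w t)) (derivCT 1 (w t))) k)))
    (hθ : imBetaMean F φ.toL2 ≠ 0) :
    sq (s - 2 + 1 / 2) ({k : ℤ | ε * k * imBetaMean F φ.toL2 < 0}.indicator
      (cf (derivCT 2 φ))) ≠ ⊤ := by
  have c0 : ContinuousOn (fun t => derivCT 0 (w t)) (Icc 0 T) :=
    (continuous_derivCT (by push_cast; linarith)).comp_continuousOn hw
  have c1 : ContinuousOn (fun t => derivCT 1 (w t)) (Icc 0 T) :=
    (continuous_derivCT (by push_cast; linarith)).comp_continuousOn hw
  have cmode : ∀ k : ℤ, ContinuousOn (fun t => cf (derivCT 0 (w t)) k) (Icc 0 T) := fun k =>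
    (coef k).continuous.comp_continuousOn c0
  have cev : ContinuousOn (fun t => ev F (derivCT 0 (w t)) (derivCT 1 (w t))) (Icc 0 T) :=
    fun t ht => tendsto_ev F (c0 t ht) (c1 t ht)
  have cevk : ∀ k : ℤ, ContinuousOn
      (fun t => cf (ev F (derivCT 0 (w t)) (derivCT 1 (w t))) k) (Icc 0 T) := fun k =>
    (coef k).continuous.comp_continuousOn cev
  have hode : ∀ k : ℤ, cf (derivCT 0 (w 0)) k = cf (derivCT 0 φ) k ∧ ∀ t ∈ Ioo 0 T,
      HasDerivAt (fun t => cf (derivCT 0 (w t)) k)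
        (ε * (Complex.I * (k : ℂ) ^ 2 * cf (derivCT 0 (w t)) k +
          cf (ev F (derivCT 0 (w t)) (derivCT 1 (w t))) k)) t := fun k =>
    hasDerivAt_of_weak hT (cmode k)
      (continuousOn_const.mul ((continuousOn_const.mul (cmode k)).add (cevk k))) (H k)
  -- The initial condition is not assumed pointwise; it follows from the weak equation and the
  -- continuity of the modes.
  have hw0 : w 0 = φ := eq_of_cf_derivCT_zero_eq (by linarith) fun k => (hode k).1
  have hU : UB (s - 2 + 2) (fun t : Icc 0 T => derivCT 0 (w t)) := by
    obtain ⟨C, hC⟩ := isCompact_Icc.exists_bound_of_continuousOn hw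
    refine ⟨ENNReal.ofReal C ^ 2, by finiteness, fun t => ?_⟩
    have h1 := sq_derivCoeff_le 0 (w t)
    rw [← cf_derivCT (by push_cast; linarith)] at h1
    simp only [Nat.cast_zero, sub_zero] at h1
    rw [sub_add_cancel]
    refine h1.trans (pow_le_pow_left' ?_ 2)
    rw [← ofReal_norm]
    exact ENNReal.ofReal_le_ofReal (hC t t.2)
  rw [imBetaMean_eq F (by linarith)] at hθ ⊢
  rw [← hw0] at hθ ⊢
  exact sq_indicator_second_deriv_ne_top F (U := fun t => derivCT 0 (w t))
    (U1 := fun t => derivCT 1 (w t)) (U2 := fun t => derivCT 2 (w t)) hε (by linarith) hT hU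
    (fun t _ => isDeriv_derivCT (by push_cast; linarith) (w t))
    (fun t _ => isDeriv_derivCT (by push_cast; linarith) (w t)) c0 c1 (fun k => (hode k).2) hθ

/-- Away from `k = 0`, two derivatives are comparable to `⟨k⟩²`, so order `s - 2 + 1/2` for `∂ₓ²φ`
means order `s + 1/2` for `φ`. -/
lemma fourierMultiplier_mem_sobolev {s δ : ℝ} (hs : 5 / 2 < s) (hδ : δ ≤ 1 / 2) {φ : Sobolev s}
    {A : Set ℤ} {p : ℤ → Prop} [DecidablePred p] (hp : ∀ k, p k → k ∈ A ∧ k ≠ 0)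
    (h : sq (s - 2 + 1 / 2) (A.indicator (cf (derivCT 2 φ))) ≠ ⊤) :
    fourierMultiplier (fun k => if p k then 1 else 0) φ.toL2 ∈ sobolev (s + δ) := by
  set a := fourierCoeff (φ.toL2 : Torus → ℂ) with ha
  have h0 : sq 0 a ≠ ⊤ := by
    refine ne_top_of_le_ne_top ?_ (sq_mono (show (0 : ℝ) ≤ s by linarith) a)
    rw [tsum_enorm_weightedCoeff_sq]
    finiteness
  have hm : Memℓp (fun k => (if p k then 1 else 0) * a k) 2 := by
    refine memℓp_two_of_tsum_ne_top (ne_top_of_le_ne_top h0 (ENNReal.tsum_le_tsum fun k => ?_))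
    rw [wt_zero, one_mul]
    split_ifs <;> simp
  refine memℓp_two_of_tsum_ne_top ?_
  -- The `4` is the square of the constant in `⟨k⟩² ≤ 2k²`, valid for `k ≠ 0`.
  have h4 : (4 : ℝ≥0∞) * sq (s - 2 + 1 / 2) (A.indicator (cf (derivCT 2 φ))) ≠ ⊤ := by finiteness
  refine ne_top_of_le_ne_top h4 ?_
  rw [sq, ← ENNReal.tsum_mul_left]
  refine ENNReal.tsum_le_tsum fun k => ?_
  rw [weightedCoeff, fourierCoeff_fourierMultiplier hm]
  by_cases hk : p k
  · obtain ⟨hkA, hk0⟩ := hp k hk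
    rw [if_pos hk, one_mul, indicator_of_mem hkA, cf_derivCT (by push_cast; linarith),
      sq_term_eq, derivCoeff, ← ofReal_norm, ← ENNReal.ofReal_pow (norm_nonneg _),
      show (4 : ℝ≥0∞) = ENNReal.ofReal 4 by simp, ← ENNReal.ofReal_mul (by norm_num)]
    refine ENNReal.ofReal_le_ofReal ?_
    have hb := one_le_bracket k
    have hb0 := bracket_pos k
    have e1 : bracket k ^ (s + δ) ≤ bracket k ^ (s - 2 + 1 / 2) * bracket k ^ 2 := by
      rw [← Real.rpow_natCast, ← Real.rpow_add hb0]
      exact Real.rpow_le_rpow_of_exponent_le hb (by push_cast; linarith)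
    have e2 : bracket k ^ 2 ≤ 2 * (k : ℝ) ^ 2 := by
      rw [bracket_sq]
      have : (1 : ℝ) ≤ (k : ℝ) ^ 2 := by
        exact_mod_cast (one_le_sq_iff_one_le_abs k).mpr (Int.one_le_abs hk0)
      linarith
    rw [norm_mul, norm_mul, norm_pow, norm_mul, Complex.norm_I, one_mul, Complex.norm_real,
      Real.norm_of_nonneg (by positivity), Complex.norm_intCast, sq_abs, ← ha]
    refine (pow_le_pow_left₀ (by positivity) (mul_le_mul_of_nonneg_right
      (e1.trans (mul_le_mul_of_nonneg_left e2 (by positivity))) (norm_nonneg _)) 2).trans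
      (le_of_eq (by ring))
  · rw [if_neg hk]; simp

/-! ### Testing the equation against the characters -/

lemma pairing_toL2 {s : ℝ} (hs : 1 / 2 < s) (f : Sobolev s) (c : ℂ) (k : ℤ) :
    pairing f.toL2 (fun x => c * fourier (-k) x) = c * cf (derivCT 0 f) k :=
  pairing_const_mul_fourier (toL2_ae_eq hs f) c k

lemma pairing_nonlin (F : MvPolynomial (Fin 4) ℂ) {s : ℝ} (hs : 3 / 2 < s) (f : Sobolev s) (c : ℂ)
    (k : ℤ) : pairing (fun x => nonlin F (f.toL2 x) (dx f.toL2 x)) (fun x => c * fourier (-k) x) =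
      c * cf (ev F (derivCT 0 f) (derivCT 1 f)) k := by
  refine pairing_const_mul_fourier ?_ c k
  filter_upwards [toL2_ae_eq (by linarith) f, dx_ae_eq hs f] with x h1 h2
  rw [h1, h2, ev_apply]

lemma torusDeriv_torusDeriv_const_mul_fourier (c : ℂ) (k : ℤ) :
    torusDeriv (torusDeriv fun x => c * fourier (-k) x) =
      fun x => (-(k : ℂ) ^ 2 * c) * fourier (-k) x := by
  rw [torusDeriv_const_mul_fourier, torusDeriv_const_mul_fourier]
  funext x
  push_cast
  linear_combination (k : ℂ) ^ 2 * c * fourier (-k) x * Complex.I_mul_I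

section

variable {F : MvPolynomial (Fin 4) ℂ} {s T : ℝ} {φ : Sobolev s} {u : ℝ → Sobolev s}

/-- The weak mode equations combine into one time integral. -/
lemma combine_weak {a b : ℝ} {w : ℝ → Sobolev s} (hs : 5 / 2 < s) (hw : ContinuousOn w (uIcc a b))
    (F : MvPolynomial (Fin 4) ℂ) {η : ℝ → ℝ} (hη : Continuous η) (k : ℤ) :
    ∫ t in a..b, (η t : ℂ) * (Complex.I * (k : ℂ) ^ 2 * cf (derivCT 0 (w t)) k +
        cf (ev F (derivCT 0 (w t)) (derivCT 1 (w t))) k) =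
      -(Complex.I * ∫ t in a..b, (-(k : ℂ) ^ 2 * η t) * cf (derivCT 0 (w t)) k) +
        ∫ t in a..b, (η t : ℂ) * cf (ev F (derivCT 0 (w t)) (derivCT 1 (w t))) k := by
  have c0 : ContinuousOn (fun t => derivCT 0 (w t)) (uIcc a b) :=
    (continuous_derivCT (by push_cast; linarith)).comp_continuousOn hw
  have c1 : ContinuousOn (fun t => derivCT 1 (w t)) (uIcc a b) :=
    (continuous_derivCT (by push_cast; linarith)).comp_continuousOn hw
  have cmode : ContinuousOn (fun t => cf (derivCT 0 (w t)) k) (uIcc a b) :=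
    (coef k).continuous.comp_continuousOn c0
  have cev : ContinuousOn (fun t => ev F (derivCT 0 (w t)) (derivCT 1 (w t))) (uIcc a b) :=
    fun t ht => tendsto_ev F (c0 t ht) (c1 t ht)
  have cevk : ContinuousOn (fun t => cf (ev F (derivCT 0 (w t)) (derivCT 1 (w t))) k) (uIcc a b) :=
    (coef k).continuous.comp_continuousOn cev
  have cη : Continuous fun t => (η t : ℂ) := Complex.continuous_ofReal.comp hη
  have i1 : IntervalIntegrable
      (fun t => -Complex.I * ((-(k : ℂ) ^ 2 * η t) * cf (derivCT 0 (w t)) k)) volume a b :=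
    (continuousOn_const.mul ((continuousOn_const.mul cη.continuousOn).mul cmode)).intervalIntegrable
  have i2 : IntervalIntegrable
      (fun t => (η t : ℂ) * cf (ev F (derivCT 0 (w t)) (derivCT 1 (w t))) k) volume a b :=
    (cη.continuousOn.mul cevk).intervalIntegrable
  rw [← neg_mul, ← intervalIntegral.integral_const_mul, ← intervalIntegral.integral_add i1 i2]
  refine intervalIntegral.integral_congr fun t _ => ?_
  ring

lemma IsForwardSolution.sq_ne_top (hu : IsForwardSolution F s T φ u) (hs : 5 / 2 < s) (hT : 0 < T)
    (hc : ContinuousOn u (Icc 0 T)) (hθ : imBetaMean F φ.toL2 ≠ 0) :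
    sq (s - 2 + 1 / 2) ({k : ℤ | k * imBetaMean F φ.toL2 < 0}.indicator
      (cf (derivCT 2 φ))) ≠ ⊤ := by
  have := sq_indicator_derivCT_ne_top F (ε := 1) (by norm_num) hs hT hc (fun k η hη hη0 => ?_) hθ
  · simpa only [one_mul] using this
  obtain ⟨T', hT', hη0⟩ := hη0
  -- The test function is `η(t) e^{-ikx}`, which picks out the `k`-th mode.
  have h1 := hu.weak _ (smoothST_mul_fourier hη (-k))
    ⟨T', hT', fun t ht => by funext x; simp [hη0 t ht]⟩
  have hd : ∀ t, (fun x : Torus => deriv (fun τ => (η τ : ℂ) * fourier (-k) x) t) =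
      fun x => ((deriv η t : ℝ) : ℂ) * fourier (-k) x := fun t => funext fun x =>
    (((hη.differentiable (by simp)) t).hasDerivAt.ofReal_comp.mul_const _).deriv
  simp only [hd, torusDeriv_torusDeriv_const_mul_fourier,
    pairing_toL2 (show 1 / 2 < s by linarith), pairing_nonlin F (show 3 / 2 < s by linarith)] at h1
  simp only [Complex.ofReal_one, one_mul]
  rw [combine_weak hs (by rwa [uIcc_of_le hT.le]) F hη.continuous, ← h1]
  ring

lemma IsBackwardSolution.sq_ne_top (hu : IsBackwardSolution F s T φ u) (hs : 5 / 2 < s)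
    (hT : 0 < T) (hc : ContinuousOn u (Icc (-T) 0)) (hθ : imBetaMean F φ.toL2 ≠ 0) :
    sq (s - 2 + 1 / 2) ({k : ℤ | 0 < k * imBetaMean F φ.toL2}.indicator
      (cf (derivCT 2 φ))) ≠ ⊤ := by
  -- The reflected function `u(-t)` satisfies the mode equations with `ε = -1`, which reverses the
  -- sign condition on `k`.
  have hw : ContinuousOn (fun t => u (-t)) (Icc 0 T) :=
    hc.comp continuousOn_neg fun t ht => ⟨neg_le_neg ht.2, neg_nonpos.mpr ht.1⟩
  have := sq_indicator_derivCT_ne_top F (ε := -1) (by norm_num) hs hT hw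
    (fun k η hη hη0 => ?_) hθ
  · simpa only [neg_mul, one_mul, neg_lt_zero] using this
  obtain ⟨T', hT', hη0⟩ := hη0
  have hη' : ContDiff ℝ ((⊤ : ℕ∞) : WithTop ℕ∞) fun t => η (-t) := hη.comp contDiff_neg
  -- The test function is reflected as well; the substitutions `t ↦ -t` below bring the integrals
  -- back to `[0, T]`.
  have h1 := hu.weak _ (smoothST_mul_fourier hη' (-k))
    ⟨T', hT', fun t ht => by funext x; simp [hη0 (-t) (by linarith)]⟩
  have hd : ∀ t, (fun x : Torus => deriv (fun τ => (η (-τ) : ℂ) * fourier (-k) x) t) =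
      fun x => ((-(deriv η (-t)) : ℝ) : ℂ) * fourier (-k) x := fun t => funext fun x => by
    have h := (((hη.differentiable (by simp)) (-t)).hasDerivAt.scomp t (hasDerivAt_neg t))
    have h' := (h.ofReal_comp.mul_const (fourier (-k) x)).deriv
    simpa using h'
  simp only [hd, torusDeriv_torusDeriv_const_mul_fourier,
    pairing_toL2 (show 1 / 2 < s by linarith), pairing_nonlin F (show 3 / 2 < s by linarith)] at h1
  have h2 := intervalIntegral.integral_comp_neg (a := 0) (b := T)
    (fun t => ((-(deriv η (-t)) : ℝ) : ℂ) * cf (derivCT 0 (u t)) k)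
  have h3 := intervalIntegral.integral_comp_neg (a := 0) (b := T)
    (fun t => (-(k : ℂ) ^ 2 * (η (-t) : ℂ)) * cf (derivCT 0 (u t)) k)
  have h4 := intervalIntegral.integral_comp_neg (a := 0) (b := T)
    (fun t => (η (-t) : ℂ) * cf (ev F (derivCT 0 (u t)) (derivCT 1 (u t))) k)
  simp only [neg_neg, neg_zero, Complex.ofReal_neg, neg_mul,
    intervalIntegral.integral_neg] at h1 h2 h3 h4
  have h5 := combine_weak hs (by rwa [uIcc_of_le hT.le]) F hη.continuous k (a := 0) (b := T)
    (w := fun t => u (-t))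
  have h6 : ∫ t in (0 : ℝ)..T, (η t : ℂ) * (((-1 : ℝ) : ℂ) *
      (Complex.I * (k : ℂ) ^ 2 * cf (derivCT 0 (u (-t))) k +
        cf (ev F (derivCT 0 (u (-t))) (derivCT 1 (u (-t)))) k)) =
      -∫ t in (0 : ℝ)..T, (η t : ℂ) * (Complex.I * (k : ℂ) ^ 2 * cf (derivCT 0 (u (-t))) k +
        cf (ev F (derivCT 0 (u (-t))) (derivCT 1 (u (-t)))) k) := by
    rw [← intervalIntegral.integral_neg]
    refine intervalIntegral.integral_congr fun t _ => ?_
    push_cast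
    ring
  rw [h6, h5]
  simp only [neg_mul, intervalIntegral.integral_neg] at h1 h2 h3 h4 ⊢
  rw [h4]
  linear_combination -h1
    - Complex.I * h3 + h2

lemma projNeg_mem (hs : 5 / 2 < s) {A : Set ℤ} (hA : ∀ k : ℤ, k < 0 → k ∈ A)
    (h : sq (s - 2 + 1 / 2) (A.indicator (cf (derivCT 2 φ))) ≠ ⊤) {δ : ℝ}
    (hδ : δ ∈ Ioo (0 : ℝ) (1 / 2)) : projNeg φ.toL2 ∈ sobolev (s + δ) :=
  fourierMultiplier_mem_sobolev hs hδ.2.le (fun k hk => ⟨hA k hk, hk.ne⟩) h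

lemma projPos_mem (hs : 5 / 2 < s) {A : Set ℤ} (hA : ∀ k : ℤ, 0 < k → k ∈ A)
    (h : sq (s - 2 + 1 / 2) (A.indicator (cf (derivCT 2 φ))) ≠ ⊤) {δ : ℝ}
    (hδ : δ ∈ Ioo (0 : ℝ) (1 / 2)) : projPos φ.toL2 ∈ sobolev (s + δ) :=
  fourierMultiplier_mem_sobolev hs hδ.2.le (fun k hk => ⟨hA k hk, hk.ne'⟩) h

end

end

end TorusNLS

/-! ### The theorem in both time directions -/

theorem mainTheorem3 (F : MvPolynomial (Fin 4) ℂ) (s T : ℝ) (hs : 5 / 2 < s) (hT : 0 < T)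
    (φ : TorusNLS.Sobolev s) :
    (∀ u : ℝ → TorusNLS.Sobolev s, ContinuousOn u (Set.Icc 0 T) →
      TorusNLS.IsForwardSolution F s T φ u →
        (0 < TorusNLS.imBetaMean F φ.toL2 →
          ∀ δ ∈ Set.Ioo (0 : ℝ) (1 / 2), TorusNLS.projNeg φ.toL2 ∈ TorusNLS.sobolev (s + δ)) ∧
        (TorusNLS.imBetaMean F φ.toL2 < 0 →
          ∀ δ ∈ Set.Ioo (0 : ℝ) (1 / 2), TorusNLS.projPos φ.toL2 ∈ TorusNLS.sobolev (s + δ))) ∧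
    (∀ u : ℝ → TorusNLS.Sobolev s, ContinuousOn u (Set.Icc (-T) 0) →
      TorusNLS.IsBackwardSolution F s T φ u →
        (0 < TorusNLS.imBetaMean F φ.toL2 →
          ∀ δ ∈ Set.Ioo (0 : ℝ) (1 / 2), TorusNLS.projPos φ.toL2 ∈ TorusNLS.sobolev (s + δ)) ∧
        (TorusNLS.imBetaMean F φ.toL2 < 0 →
          ∀ δ ∈ Set.Ioo (0 : ℝ) (1 / 2), TorusNLS.projNeg φ.toL2 ∈ TorusNLS.sobolev (s + δ))) := by
  refine ⟨fun u hc hu => ⟨fun hθ δ hδ => ?_, fun hθ δ hδ => ?_⟩,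
    fun u hc hu => ⟨fun hθ δ hδ => ?_, fun hθ δ hδ => ?_⟩⟩
  · exact TorusNLS.projNeg_mem hs (fun k hk => mul_neg_of_neg_of_pos (Int.cast_lt_zero.mpr hk) hθ)
      (hu.sq_ne_top hs hT hc hθ.ne') hδ
  · exact TorusNLS.projPos_mem hs (fun k hk => mul_neg_of_pos_of_neg (Int.cast_pos.mpr hk) hθ)
      (hu.sq_ne_top hs hT hc hθ.ne) hδ
  · exact TorusNLS.projPos_mem hs (fun k hk => mul_pos (Int.cast_pos.mpr hk) hθ)
      (hu.sq_ne_top hs hT hc hθ.ne') hδ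
  · exact TorusNLS.projNeg_mem hs (fun k hk => mul_pos_of_neg_of_neg (Int.cast_lt_zero.mpr hk) hθ)
      (hu.sq_ne_top hs hT hc hθ.ne) hδ
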